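/- For a set $A\subseteq[n]\times[n]$ of positions of an $n\times n$ chessboard let $M(A)$ be the simplicial complex of nontaking rooks on $A$: its faces are the subsets of $A$ no two elements of which lie in the same row or the same column. Let $\tilde H_*$ denote reduced simplicial homology over $\mathbb Z$, and put $\nu_m=\lfloor (m+1)/3\rfloor-1$. A space $X$ is called $k$-connected if for all $0\le d\le k+1$ every continuous map from the unit sphere of $\mathbb R^d$ to $X$ extends continuously to the closed unit ball; a simplicial complex is called $k$-connected if its geometric realization is. Let $$D_n=\{(i,j)\in[n]\times[n]: i\ne j\},\qquad \Gamma(n,k)=\{(i,j)\in[n]\times[n]:|j-i|\le k\},$$ and for $n\ge3$ let $B_n=\bigcup_{i=0}^{N}S_i\cup R_n$, where $$S_i=\{(3i+1,3i+1),(3i+1,3i+2),(3i+2,3i+3),(3i+3,3i+3)\},$$ and $N=\frac{n-3}3$, $R_n=\emptyset$ if $n\equiv0\bmod 3$; $N=\frac{n-5}3$, $R_n=\{(n-1,n-1),(n-1,n)\}$ if $n\equiv2\bmod 3$; $N=\frac{n-7}3$, $R_n=\{n-3,n-2,n-1,n\}\times\{n-3,n-2,n-1,n\}$ if $n\equiv1\bmod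 3$ (so $B_4=R_4$). (i) For all $n\ge3$, $\tilde H_{\nu_{2n}}(M(D_n))\ne0$, and $M(D_n)$ is not $\nu_{2n}$-connected. (So the Björner–Welker theorem that $M(D_n)$ is $(\nu_{2n}-1)$-connected is sharp.) (ii) For all $n\ge3$ and all $A\subseteq[n]\times[n]$ with $B_n\subseteq A$, $\tilde H_{\nu_{2n}}(M(A))\ne0$, and $M(A)$ is not $\nu_{2n}$-connected. (iii) If $n=6$ or $n\ge8$, then for all $A\subseteq[n]\times[n]$ with $\Gamma(n,2\nu_{2n}+1-n)\subseteq A$, $\tilde H_{\nu_{2n}}(M(A))\ne0$, and $M(A)$ is not $\nu_{2n}$-connected. (So Ziegler's theorem that every such $M(A)$ is $(\nu_{2n}-1)$-connected is sharp for these $n$.) -/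

import Mathlib

/-! ### Reduced simplicial homology over the integers -/

/-- The simplicial boundary map on formal integer combinations of finite vertex sets. A finite set
`{v₀ < v₁ < ⋯ < v_k}` stands for the oriented simplex `[v₀, …, v_k]`, and
`∂[v₀, …, v_k] = ∑ i, (-1)^i [v₀, …, v̂ᵢ, …, v_k]`; the index `i` of a vertex `v` of `σ` is the
number of vertices of `σ` below `v`. A single vertex is sent to the empty simplex `∅`
(augmentation), and `∅` is sent to `0`. -/
noncomputable def simplicialBoundary (V : Type*) [LinearOrder V] :
    (Finset V →₀ ℤ) →ₗ[ℤ] (Finset V →₀ ℤ) :=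
  Finsupp.lift (Finset V →₀ ℤ) ℤ (Finset V) fun σ =>
    ∑ v ∈ σ, Finsupp.single (σ.erase v) ((-1 : ℤ) ^ (σ.filter (· < v)).card)

namespace PreAbstractSimplicialComplex

variable {V : Type*}

/-- The `k`-th augmented chain group `C_k(K)`: integer combinations of the faces of `K` with
`k + 1` vertices, where the empty face (of dimension `-1`) counts as a face. -/
noncomputable def chains (K : PreAbstractSimplicialComplex V) (k : ℤ) :
    Submodule ℤ (Finset V →₀ ℤ) :=
  Finsupp.supported ℤ ℤ {σ | (σ ∈ K.faces ∨ σ = ∅) ∧ (σ.card : ℤ) = k + 1}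

variable [LinearOrder V]

/-- The group `Z_k(K)` of `k`-cycles. -/
noncomputable def cycles (K : PreAbstractSimplicialComplex V) (k : ℤ) :
    Submodule ℤ (Finset V →₀ ℤ) :=
  K.chains k ⊓ LinearMap.ker (simplicialBoundary V)

/-- The group `B_k(K)` of `k`-boundaries. -/
noncomputable def boundaries (K : PreAbstractSimplicialComplex V) (k : ℤ) :
    Submodule ℤ (Finset V →₀ ℤ) :=
  (K.chains (k + 1)).map (simplicialBoundary V)

/-- The reduced simplicial homology group `H̃_k(K) = Z_k(K) / B_k(K)` over the integers. -/
abbrev ReducedHomology (K : PreAbstractSimplicialComplex V) (k : ℤ) : Type _ :=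
  K.cycles k ⧸ (K.boundaries k).submoduleOf (K.cycles k)

end PreAbstractSimplicialComplex

/-! ### Geometric realization and connectivity -/

/-- The geometric realization of a simplicial complex on a finite vertex set, with its barycentric
coordinates: the points of the standard simplex whose support is a face. -/
def PreAbstractSimplicialComplex.realization {V : Type*} [Fintype V]
    (K : PreAbstractSimplicialComplex V) : Set (V → ℝ) :=
  {x | x ∈ stdSimplex ℝ V ∧ ∃ σ ∈ K.faces, ∀ v, v ∈ σ ↔ x v ≠ 0}

/-- A space `X` is `k`-connected if for every `d ≤ k + 1` every continuous map from the unit sphere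
`S^(d-1)` of `ℝ^d` to `X` extends to the closed unit ball. For `d = 0` the sphere is empty and the
ball is a point, so this says that `X` is nonempty when `k ≥ -1`. -/
def IsTopologicallyConnected (k : ℤ) (X : Type*) [TopologicalSpace X] : Prop :=
  ∀ d : ℕ, (d : ℤ) ≤ k + 1 →
    ∀ f : C(Metric.sphere (0 : EuclideanSpace ℝ (Fin d)) 1, X),
      ∃ g : C(Metric.closedBall (0 : EuclideanSpace ℝ (Fin d)) 1, X),
        ∀ x : Metric.sphere (0 : EuclideanSpace ℝ (Fin d)) 1,
          g ⟨x, Metric.sphere_subset_closedBall x.2⟩ = f x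

/-! ### Rook complexes -/

/-- The positions of an `m × n` chessboard, ordered lexicographically (the order only serves to
orient simplices). Rows and columns are numbered from `1`, see `Position.row`, `Position.col`. -/
abbrev Position (m n : ℕ) : Type := Fin m ×ₗ Fin n

/-- The row, in `{1, …, m}`, of a position. -/
def Position.row {m n : ℕ} (p : Position m n) : ℕ := ((ofLex p).1 : ℕ) + 1

/-- The column, in `{1, …, n}`, of a position. -/
def Position.col {m n : ℕ} (p : Position m n) : ℕ := ((ofLex p).2 : ℕ) + 1

/-- The simplicial complex `M(A)` of nontaking rooks on a set `A` of positions: its faces are the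
nonempty sets of positions in `A`, no two of which share a row or a column. -/
def rookComplex {m n : ℕ} (A : Set (Position m n)) :
    PreAbstractSimplicialComplex (Position m n) where
  faces := {σ | σ.Nonempty ∧ (∀ p ∈ σ, p ∈ A) ∧
    ∀ p ∈ σ, ∀ q ∈ σ, p ≠ q → p.row ≠ q.row ∧ p.col ≠ q.col}
  isRelLowerSet_faces := by
    rintro σ ⟨hne, hA, hσ⟩
    refine ⟨hne, fun τ hτ hτne => ⟨hτne, fun p hp => hA p (hτ hp), ?_⟩⟩
    exact fun p hp q hq hpq => hσ p (hτ hp) q (hτ hq) hpq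

/-- `ν_n = ⌊(n + 1) / 3⌋ - 1`. -/
def nu (n : ℕ) : ℤ := (((n + 1) / 3 : ℕ) : ℤ) - 1

/-- The board `D_n`: the `n × n` board with the diagonal removed. -/
def diagonalRemoved (n : ℕ) : Set (Position n n) := {p | p.row ≠ p.col}

/-- The block `S_i = {(3i+1,3i+1), (3i+1,3i+2), (3i+2,3i+3), (3i+3,3i+3)}`. -/
def blockS (i : ℕ) : Set (ℕ × ℕ) :=
  {(3 * i + 1, 3 * i + 1), (3 * i + 1, 3 * i + 2), (3 * i + 2, 3 * i + 3), (3 * i + 3, 3 * i + 3)}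

/-- The number `N + 1` of blocks `S_0, …, S_N` in the pattern `B_n` (for `n ≥ 3`), that is
`n / 3`, `(n - 2) / 3`, `(n - 4) / 3` for `n ≡ 0, 2, 1` modulo `3`. -/
def numBlocks (n : ℕ) : ℕ :=
  if n % 3 = 0 then n / 3 else if n % 3 = 2 then (n - 2) / 3 else (n - 4) / 3

/-- The remaining part `R_n` of the pattern `B_n` (for `n ≥ 3`). -/
def restR (n : ℕ) : Set (ℕ × ℕ) :=
  if n % 3 = 0 then ∅
  else if n % 3 = 2 then {(n - 1, n - 1), (n - 1, n)}
  else {n - 3, n - 2, n - 1, n} ×ˢ {n - 3, n - 2, n - 1, n}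

/-- The pattern `B_n = S_0 ∪ ⋯ ∪ S_N ∪ R_n`, as a set of positions of the `n × n` board. -/
def patternB (n : ℕ) : Set (Position n n) :=
  {p | (∃ i < numBlocks n, (p.row, p.col) ∈ blockS i) ∨ (p.row, p.col) ∈ restR n}

/-- The band `Γ(n, k) = {(i, j) ∈ [n] × [n] : |j - i| ≤ k}`. -/
def bandBoard (n : ℕ) (k : ℤ) : Set (Position n n) :=
  {p | |(p.col : ℤ) - (p.row : ℤ)| ≤ k}

/-! ### Wedge, contraction and boundary on chains of finite sets -/

/-! Read a position as the edge joining its row to its column in the complete graph on the `2n` rows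
and columns. Rook placements become matchings, so every `M(A)` is a subcomplex of one matching
complex on `2n` vertices. It suffices to find an integral cycle on the smallest board that does not
bound in that matching complex: it then survives on every larger board.

Write `d = ⌊(2n+1)/3⌋`, the number of edges in a simplex of dimension `ν_{2n}`. The cycles are
products of cherries `{a,b} - {a,c}` on disjoint triples, and non-bounding is detected modulo 3. On
`3j+1` vertices `exists_isFundamental` builds, over a field with `3 = 0`, a functional that kills
boundaries and sends a product of `j` cherries to the sign of the list formed by the omitted vertex
and the triples. The construction is by induction on `j`. For a fixed vertex `v` the stars of the
edges `vc` are cones, and several of them meet in a smaller matching complex, which is acyclic in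
low degrees (`isAcyclicAt_matchings`). A Mayer–Vietoris argument (`exists_functional_edgeStars`)
assembles the functionals of the pairwise intersections, subject to a cocycle condition. By
`cycle_mem_cherrySpan` this condition need only be checked on products of cherries, where it says
that three equal signs add up to zero. A perfect matching of the remaining vertices, which lies in
no star, interferes only for six of them (`functional_bdry_perfect_matching`).

If `n` is `0` or `2` modulo 3, then `3d ≤ 2n` and the boards carry a product of `d` cherries. If `n`
is `1` modulo 3, then `3d = 2n + 1` and one vertex is missing. A two-dimensional cycle on the edges
of an octagon then replaces three cherries; contracting it with one edge leaves two cherries on the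
other six vertices, so the functional on fewer vertices applies.

Failure of connectivity follows from failure of acyclicity by
`mem_boundaries_of_isTopologicallyConnected`. There the identity of the realization is extended over
the cone on a cycle, and a finely subdivided cone is labelled by vertices. This gives a simplicial
chain, and Sperner's lemma identifies its boundary with the cycle. -/

theorem single_eq_smul {V R : Type*} [CommRing R] (σ : Finset V) (a : R) :
    Finsupp.single σ a = a • Finsupp.single σ (1 : R) := by simp

section ChainOperators

variable {V : Type*} [LinearOrder V] {R : Type*} [CommRing R]

/-- The sign `(-1)^i`, where `i` is the number of elements of `σ` below `v`. -/
def faceSign (R : Type*) [CommRing R] (v : V) (σ : Finset V) : R :=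
  (-1) ^ (σ.filter (· < v)).card

/-- Left exterior multiplication by a vertex. -/
noncomputable def wedge (R : Type*) [CommRing R] (v : V) : (Finset V →₀ R) →ₗ[R] (Finset V →₀ R) :=
  Finsupp.lift _ R _ fun σ => if v ∈ σ then 0 else Finsupp.single (insert v σ) (faceSign R v σ)

/-- Contraction with a vertex. -/
noncomputable def contract (R : Type*) [CommRing R] (v : V) :
    (Finset V →₀ R) →ₗ[R] (Finset V →₀ R) :=
  Finsupp.lift _ R _ fun σ => if v ∈ σ then Finsupp.single (σ.erase v) (faceSign R v σ) else 0

/-- The simplicial boundary with coefficients in `R`. -/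
noncomputable def bdry (R : Type*) [CommRing R] : (Finset V →₀ R) →ₗ[R] (Finset V →₀ R) :=
  Finsupp.lift _ R _ fun σ => ∑ v ∈ σ, Finsupp.single (σ.erase v) (faceSign R v σ)

theorem bdry_int : bdry (V := V) ℤ = simplicialBoundary V := rfl

theorem wedge_single (v : V) (σ : Finset V) : wedge R v (Finsupp.single σ 1) =
    if v ∈ σ then 0 else Finsupp.single (insert v σ) (faceSign R v σ) := by
  rw [wedge, Finsupp.lift_apply, Finsupp.sum_single_index (by simp), one_smul]

theorem contract_single (v : V) (σ : Finset V) : contract R v (Finsupp.single σ 1) =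
    if v ∈ σ then Finsupp.single (σ.erase v) (faceSign R v σ) else 0 := by
  rw [contract, Finsupp.lift_apply, Finsupp.sum_single_index (by simp), one_smul]

theorem bdry_single (σ : Finset V) : bdry R (Finsupp.single σ 1) =
    ∑ v ∈ σ, contract R v (Finsupp.single σ 1) := by
  simp only [bdry, Finsupp.lift_apply, zero_smul, Finsupp.sum_single_index, one_smul]
  exact Finset.sum_congr rfl fun v hv => by simp [contract_single, hv]

theorem faceSign_mul_self (v : V) (σ : Finset V) : faceSign R v σ * faceSign R v σ = 1 := by
  simp [faceSign, ← mul_pow]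

theorem faceSign_insert {v w : V} {σ : Finset V} (h : w ∉ σ) :
    faceSign R v (insert w σ) = (if w < v then -1 else 1) * faceSign R v σ := by
  unfold faceSign
  rw [Finset.filter_insert]
  split_ifs with hw
  · rw [Finset.card_insert_of_notMem (by simp [h]), pow_succ']
  · simp

theorem faceSign_insert_self {v : V} {σ : Finset V} :
    faceSign R v (insert v σ) = faceSign R v σ := by
  unfold faceSign
  rw [Finset.filter_insert]
  simp

theorem faceSign_erase {v w : V} {σ : Finset V} (h : w ∈ σ) :
    faceSign R v σ = (if w < v then -1 else 1) * faceSign R v (σ.erase w) := by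
  conv_lhs => rw [← Finset.insert_erase h]
  exact faceSign_insert (by simp)

theorem lt_sign_mul {v w : V} (h : v ≠ w) :
    ((if v < w then -1 else 1) * (if w < v then -1 else 1) : R) = -1 := by
  rcases lt_or_gt_of_ne h with h | h <;> simp [h, not_lt.2 h.le]

theorem wedge_single' (v : V) (σ : Finset V) (a : R) : wedge R v (Finsupp.single σ a) =
    if v ∈ σ then 0 else Finsupp.single (insert v σ) (a * faceSign R v σ) := by
  rw [single_eq_smul, map_smul, wedge_single]; split_ifs <;> simp

theorem contract_single' (v : V) (σ : Finset V) (a : R) : contract R v (Finsupp.single σ a) =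
    if v ∈ σ then Finsupp.single (σ.erase v) (a * faceSign R v σ) else 0 := by
  rw [single_eq_smul, map_smul, contract_single]; split_ifs <;> simp

theorem wedge_wedge (v w : V) (x : Finset V →₀ R) :
    wedge R v (wedge R w x) = -wedge R w (wedge R v x) := by
  have key : (wedge R v).comp (wedge R w) = -((wedge R w).comp (wedge R v)) := by
    ext1 σ; ext1
    simp only [LinearMap.comp_apply, Finsupp.lsingle_apply, LinearMap.neg_apply, wedge_single]
    rcases eq_or_ne v w with rfl | h
    · split_ifs <;> simp [wedge_single']
    · by_cases hv : v ∈ σ <;> by_cases hw : w ∈ σ <;>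
        simp [hv, hw, wedge_single', h, h.symm, -Finsupp.single_mul]
      rw [Finset.insert_comm, faceSign_insert hw, faceSign_insert hv, ← Finsupp.single_neg]
      congr 1
      have := lt_sign_mul (R := R) h
      rcases lt_or_gt_of_ne h with h | h <;> simp [h, not_lt.2 h.le, mul_comm]
  exact LinearMap.congr_fun key x

theorem wedge_self (v : V) (x : Finset V →₀ R) : wedge R v (wedge R v x) = 0 := by
  have key : (wedge R v).comp (wedge R v) = 0 := by
    ext1 σ; ext1
    simp only [LinearMap.comp_apply, Finsupp.lsingle_apply, wedge_single]
    split_ifs <;> simp [wedge_single']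
  exact LinearMap.congr_fun key x

/-- The anticommutation relation between creation and annihilation operators. With `wedge_wedge` it
replaces the bookkeeping of orientation signs in all that follows. -/
theorem contract_wedge (v w : V) (x : Finset V →₀ R) :
    contract R w (wedge R v x) = (if v = w then x else 0) - wedge R v (contract R w x) := by
  have key : (contract R w).comp (wedge R v) =
      (if v = w then LinearMap.id else 0) - (wedge R v).comp (contract R w) := by
    ext1 σ; ext1
    simp only [LinearMap.comp_apply, Finsupp.lsingle_apply, LinearMap.sub_apply, wedge_single,
      contract_single]
    rcases eq_or_ne v w with rfl | h
    · by_cases hv : v ∈ σ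
      · have := faceSign_insert_self (R := R) (v := v) (σ := σ.erase v)
        rw [Finset.insert_erase hv] at this
        simp [hv, wedge_single', this, faceSign_mul_self]
      · simp [hv, contract_single', faceSign_insert_self, faceSign_mul_self]
    · by_cases hv : v ∈ σ <;> by_cases hw : w ∈ σ <;>
        simp [hv, hw, wedge_single', contract_single', h, h.symm, -Finsupp.single_mul]
      rw [Finset.erase_insert_of_ne h, faceSign_insert hv, ← Finsupp.single_neg]
      congr 1
      rw [faceSign_erase (v := v) hw]
      rcases lt_or_gt_of_ne h with h | h <;> simp [h, not_lt.2 h.le, mul_comm]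
  have := LinearMap.congr_fun key x
  simp only [LinearMap.comp_apply, LinearMap.sub_apply] at this
  rw [this]; split_ifs <;> simp

theorem bdry_eq_sum_contract {T σ : Finset V} (h : σ ⊆ T) : bdry R (Finsupp.single σ 1) =
    ∑ v ∈ T, contract R v (Finsupp.single σ 1) := by
  rw [bdry_single]
  exact Finset.sum_subset h fun v _ hv => by simp [contract_single, hv]

/-- Summing the anticommutation relation over `w` gives this cone formula, since the boundary is the
sum of all contractions. In particular a cycle `x` is the boundary of `v ∧ x`. -/
theorem bdry_wedge (v : V) (x : Finset V →₀ R) :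
    bdry R (wedge R v x) = x - wedge R v (bdry R x) := by
  have key : (bdry R).comp (wedge R v) = LinearMap.id - (wedge R v).comp (bdry R) := by
    ext1 σ; ext1
    simp only [LinearMap.comp_apply, Finsupp.lsingle_apply, LinearMap.sub_apply, LinearMap.id_apply]
    have h1 : bdry R (wedge R v (Finsupp.single σ 1)) =
        ∑ w ∈ insert v σ, contract R w (wedge R v (Finsupp.single σ 1)) := by
      rw [wedge_single]
      split_ifs
      · simp
      · rw [single_eq_smul, map_smul, bdry_eq_sum_contract subset_rfl, Finset.smul_sum]
        refine Finset.sum_congr rfl fun w _ => ?_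
        rw [← map_smul, ← single_eq_smul]
    rw [h1, bdry_eq_sum_contract (Finset.subset_insert v σ), map_sum, Finset.sum_congr rfl
      (fun w _ => contract_wedge v w _), Finset.sum_sub_distrib, Finset.sum_ite_eq]
    simp
  exact LinearMap.congr_fun key x

theorem bdry_single_empty : bdry R (Finsupp.single (∅ : Finset V) 1) = 0 := by
  simp [bdry_single]

theorem contract_single_empty (v : V) : contract R v (Finsupp.single (∅ : Finset V) 1) = 0 := by
  simp [contract_single]

theorem single_eq_wedge {v : V} {σ : Finset V} (h : v ∈ σ) : (Finsupp.single σ 1 : Finset V →₀ R) =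
    faceSign R v σ • wedge R v (Finsupp.single (σ.erase v) 1) := by
  have := faceSign_insert_self (R := R) (v := v) (σ := σ.erase v)
  rw [Finset.insert_erase h] at this
  simp [wedge_single, Finset.insert_erase h, ← this, faceSign_mul_self]

/-- A property of chains that is linear and stable under wedging holds for all chains. -/
theorem chain_induction {p : (Finset V →₀ R) → Prop} (h0 : p (Finsupp.single ∅ 1))
    (hadd : ∀ x y, p x → p y → p (x + y)) (hsmul : ∀ (a : R) x, p x → p (a • x))
    (hw : ∀ v x, p x → p (wedge R v x)) (x : Finset V →₀ R) : p x := by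
  have hs : ∀ (σ : Finset V), p (Finsupp.single σ 1) := by
    intro σ
    induction σ using Finset.induction_on with
    | empty => exact h0
    | insert v σ hv ih =>
      rw [single_eq_wedge (Finset.mem_insert_self v σ), Finset.erase_insert hv]
      exact hsmul _ _ (hw _ _ ih)
  induction x using Finsupp.induction_linear with
  | zero => simpa using hsmul 0 _ h0
  | add x y hx hy => exact hadd _ _ hx hy
  | single σ a => rw [single_eq_smul]; exact hsmul _ _ (hs σ)

theorem bdry_bdry (x : Finset V →₀ R) : bdry R (bdry R x) = 0 := by
  induction x using chain_induction with
  | h0 => simp [bdry_single_empty]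
  | hadd x y hx hy => simp [hx, hy]
  | hsmul a x hx => simp [hx]
  | hw v x hx => simp [bdry_wedge, hx]

/-- Taking the link of a vertex commutes with the boundary up to sign, so composing a functional
that kills boundaries with a contraction gives another one. -/
theorem bdry_contract (v : V) (x : Finset V →₀ R) :
    bdry R (contract R v x) = -contract R v (bdry R x) := by
  induction x using chain_induction with
  | h0 => simp [bdry_single_empty, contract_single_empty]
  | hadd x y hx hy => simp [hx, hy, add_comm]
  | hsmul a x hx => simp [hx]
  | hw w x hx =>
    rw [contract_wedge, bdry_wedge, map_sub, map_sub, contract_wedge, bdry_wedge, hx]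
    split_ifs <;> (simp; try abel)

/-! ### Induced chain maps and change of coefficients -/

variable {W : Type*} [LinearOrder W] {A : Type*} [CommRing A]

/-- The chain map induced by an order embedding of the vertices, from integral chains to chains
with arbitrary coefficients. -/
noncomputable def chainMap (A : Type*) [CommRing A] (f : V ↪o W) :
    (Finset V →₀ ℤ) →ₗ[ℤ] (Finset W →₀ A) :=
  Finsupp.lift _ ℤ _ fun σ => Finsupp.single (σ.map f.toEmbedding) (1 : A)

theorem chainMap_single (f : V ↪o W) (σ : Finset V) :
    chainMap A f (Finsupp.single σ 1) = Finsupp.single (σ.map f.toEmbedding) 1 := by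
  simp [chainMap]

theorem faceSign_map (f : V ↪o W) (v : V) (σ : Finset V) :
    faceSign A (f v) (σ.map f.toEmbedding) = faceSign A v σ := by
  unfold faceSign
  rw [Finset.filter_map, Finset.card_map]
  congr 2
  ext; simp

theorem faceSign_cast (v : V) (σ : Finset V) : ((faceSign ℤ v σ : ℤ) : A) = faceSign A v σ := by
  simp [faceSign]

theorem chainMap_wedge (f : V ↪o W) (v : V) (x : Finset V →₀ ℤ) :
    chainMap A f (wedge ℤ v x) = wedge A (f v) (chainMap A f x) := by
  induction x using Finsupp.induction_linear with
  | zero => simp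
  | add x y hx hy => simp [hx, hy]
  | single σ a =>
    rw [single_eq_smul, map_smul, map_smul, map_smul, map_zsmul]
    congr 1
    rw [wedge_single, chainMap_single, wedge_single]
    by_cases h : v ∈ σ
    · simp [h]
    · simp only [h, if_false, RelEmbedding.coe_toEmbedding, Finset.mem_map,
        EmbeddingLike.apply_eq_iff_eq, exists_eq_right]
      rw [single_eq_smul, map_smul, chainMap_single, Finset.map_insert, faceSign_map,
        Finsupp.smul_single, zsmul_one, faceSign_cast]
      rfl

theorem chainMap_bdry (f : V ↪o W) (x : Finset V →₀ ℤ) :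
    chainMap A f (bdry ℤ x) = bdry A (chainMap A f x) := by
  induction x using chain_induction with
  | h0 => simp [bdry_single_empty, chainMap_single]
  | hadd x y hx hy => simp [hx, hy]
  | hsmul a x hx => rw [map_smul, map_smul, map_smul, map_zsmul, hx]
  | hw w x hx => simp [bdry_wedge, chainMap_wedge, hx]

end ChainOperators

/-! ### Chains of a family of finite sets -/

section ChainsOf

variable {V : Type*} {F : Type*} [CommRing F]

/-- The chains with coefficients in `F` spanned by the faces of `K` with `d` vertices. -/
noncomputable def chainsOf (F : Type*) [CommRing F] (K : Set (Finset V)) (d : ℕ) :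
    Submodule F (Finset V →₀ F) :=
  Finsupp.supported F F {σ | σ ∈ K ∧ σ.card = d}

theorem mem_chainsOf {K : Set (Finset V)} {d : ℕ} {x : Finset V →₀ F} :
    x ∈ chainsOf F K d ↔ ∀ σ ∈ x.support, σ ∈ K ∧ σ.card = d := by
  rw [chainsOf, Finsupp.mem_supported]; rfl

theorem single_mem_chainsOf {K : Set (Finset V)} {d : ℕ} {σ : Finset V} (h : σ ∈ K)
    (hd : σ.card = d) (a : F) : Finsupp.single σ a ∈ chainsOf F K d :=
  Finsupp.single_mem_supported _ _ ⟨h, hd⟩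

theorem chainsOf_le {K : Set (Finset V)} {d : ℕ} {P : Submodule F (Finset V →₀ F)}
    (h : ∀ σ ∈ K, σ.card = d → Finsupp.single σ 1 ∈ P) : chainsOf F K d ≤ P := by
  rw [chainsOf, Finsupp.supported_eq_span_single, Submodule.span_le]
  rintro _ ⟨σ, ⟨h1, h2⟩, rfl⟩
  exact h σ h1 h2

theorem chainsOf_mono {K L : Set (Finset V)} (h : K ⊆ L) (d : ℕ) :
    chainsOf F K d ≤ chainsOf F L d :=
  chainsOf_le fun _ hσ hd => single_mem_chainsOf (h hσ) hd 1

theorem chainsOf_mono_card {K L : Set (Finset V)} {d : ℕ} (h : ∀ σ ∈ K, σ.card = d → σ ∈ L) :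
    chainsOf F K d ≤ chainsOf F L d :=
  chainsOf_le fun σ hσ hd => single_mem_chainsOf (h σ hσ hd) hd 1

theorem chainsOf_union (K L : Set (Finset V)) (d : ℕ) :
    chainsOf F (K ∪ L) d = chainsOf F K d ⊔ chainsOf F L d := by
  rw [chainsOf, chainsOf, chainsOf, ← Finsupp.supported_union]
  congr 1; ext; simp [or_and_right]

theorem chainsOf_inter (K L : Set (Finset V)) (d : ℕ) :
    chainsOf F (K ∩ L) d = chainsOf F K d ⊓ chainsOf F L d := by
  rw [chainsOf, chainsOf, chainsOf, ← Finsupp.supported_inter]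
  congr 1; ext; simp

theorem eqOn_chainsOf {M : Type*} [AddCommGroup M] [Module F M] {K : Set (Finset V)} {d : ℕ}
    {f g : (Finset V →₀ F) →ₗ[F] M}
    (h : ∀ σ ∈ K, σ.card = d → f (Finsupp.single σ 1) = g (Finsupp.single σ 1))
    {x : Finset V →₀ F} (hx : x ∈ chainsOf F K d) : f x = g x :=
  chainsOf_le (P := LinearMap.eqLocus f g) h hx

variable [LinearOrder V]

theorem wedge_mem_chainsOf {K L : Set (Finset V)} {d : ℕ} {v : V}
    (h : ∀ σ ∈ K, v ∉ σ → insert v σ ∈ L) {x : Finset V →₀ F} (hx : x ∈ chainsOf F K d) :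
    wedge F v x ∈ chainsOf F L (d + 1) := by
  refine chainsOf_le (P := (chainsOf F L (d + 1)).comap (wedge F v)) (fun σ hσ hd => ?_) hx
  rw [Submodule.mem_comap, wedge_single]
  split_ifs with hv
  · exact zero_mem _
  · exact single_mem_chainsOf (h σ hσ hv) (by rw [Finset.card_insert_of_notMem hv, hd]) _

theorem contract_mem_chainsOf {K L : Set (Finset V)} {d : ℕ} {v : V}
    (h : ∀ σ ∈ K, v ∈ σ → σ.erase v ∈ L) {x : Finset V →₀ F} (hx : x ∈ chainsOf F K (d + 1)) :
    contract F v x ∈ chainsOf F L d := by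
  refine chainsOf_le (P := (chainsOf F L d).comap (contract F v)) (fun σ hσ hd => ?_) hx
  rw [Submodule.mem_comap, contract_single]
  split_ifs with hv
  · exact single_mem_chainsOf (h σ hσ hv) (by rw [Finset.card_erase_of_mem hv, hd]; rfl) _
  · exact zero_mem _

theorem bdry_mem_chainsOf {K : Set (Finset V)} (hK : IsLowerSet K) {d : ℕ} {x : Finset V →₀ F}
    (hx : x ∈ chainsOf F K (d + 1)) : bdry F x ∈ chainsOf F K d := by
  refine chainsOf_le (P := (chainsOf F K d).comap (bdry F)) (fun σ hσ hd => ?_) hx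
  rw [Submodule.mem_comap, bdry_single]
  exact sum_mem fun v _ => contract_mem_chainsOf (fun τ hτ _ => hK (Finset.erase_subset v τ) hτ)
    (single_mem_chainsOf hσ hd 1)

end ChainsOf

/-! ### Acyclicity and nerve arguments -/

section Nerve

variable {V : Type*} {F : Type*} [Field F] [LinearOrder V]

/-- The reduced homology of `K` over `F` vanishes at the chains with `d` vertices. -/
def IsAcyclicAt (F : Type*) [Field F] (K : Set (Finset V)) (d : ℕ) : Prop :=
  ∀ x ∈ chainsOf F K d, bdry F x = 0 → ∃ y ∈ chainsOf F K (d + 1), bdry F y = x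

/-- The connecting map of Mayer–Vietoris at the level of chains: the boundaries of the two parts
cancel, so each lies in both complexes. -/
theorem exists_split_cycle {A B : Set (Finset V)} (hA : IsLowerSet A) (hB : IsLowerSet B) {d : ℕ}
    {z : Finset V →₀ F} (hz : z ∈ chainsOf F (A ∪ B) (d + 1)) (h0 : bdry F z = 0) :
    ∃ z₁ ∈ chainsOf F A (d + 1), ∃ z₂ ∈ chainsOf F B (d + 1), z = z₁ + z₂ ∧
      bdry F z₁ ∈ chainsOf F (A ∩ B) d ∧ bdry F z₂ = -bdry F z₁ := by
  rw [chainsOf_union] at hz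
  obtain ⟨z₁, h1, z₂, h2, rfl⟩ := Submodule.mem_sup.1 hz
  have h3 : bdry F z₂ = -bdry F z₁ := by
    rw [map_add] at h0; exact eq_neg_of_add_eq_zero_right h0
  refine ⟨z₁, h1, z₂, h2, rfl, ?_, h3⟩
  rw [chainsOf_inter]
  refine ⟨bdry_mem_chainsOf hA h1, ?_⟩
  rw [← neg_neg (bdry F z₁), ← h3]
  exact neg_mem (bdry_mem_chainsOf hB h2)

variable {ι : Type*}

omit [LinearOrder V] in
-- The only face without vertices is `∅`, so a nonzero chain in this degree already lies in any
-- member containing `∅`. This starts the inductions on degree, where no boundary can be split off.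
theorem exists_mem_chainsOf_of_card_zero {S : Finset ι} {K : ι → Set (Finset V)}
    {x : Finset V →₀ F} (hx : x ∈ chainsOf F (⋃ i ∈ S, K i) 0) :
    x = 0 ∨ ∃ i ∈ S, x ∈ chainsOf F (K i) 0 := by
  rw [or_iff_not_imp_left]
  intro h
  obtain ⟨σ, hσ⟩ := Finsupp.support_nonempty_iff.2 h
  rw [mem_chainsOf] at hx
  obtain ⟨h1, h2⟩ := hx σ hσ
  simp only [Set.mem_iUnion] at h1
  obtain ⟨i, hi, h1⟩ := h1
  refine ⟨i, hi, mem_chainsOf.2 fun τ hτ => ⟨?_, (hx τ hτ).2⟩⟩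
  rw [Finset.card_eq_zero.1 (hx τ hτ).2, ← Finset.card_eq_zero.1 h2]
  exact h1

omit [LinearOrder V] in
theorem isLowerSet_biUnion {S : Finset ι} {K : ι → Set (Finset V)} (hK : ∀ i, IsLowerSet (K i)) :
    IsLowerSet (⋃ i ∈ S, K i) :=
  isLowerSet_iUnion₂ fun i _ => hK i

omit [LinearOrder V] in
theorem biUnion_insert_eq [DecidableEq ι] (k : ι) (S : Finset ι) (K : ι → Set (Finset V)) :
    (⋃ i ∈ insert k S, K i) = (⋃ i ∈ S, K i) ∪ K k := by
  rw [Finset.set_biUnion_insert, Set.union_comm]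

omit [LinearOrder V] in
theorem biInter_inter_eq [DecidableEq ι] (k : ι) {T : Finset ι} (hT : T.Nonempty)
    (K : ι → Set (Finset V)) : (⋂ i ∈ T, (K i ∩ K k)) = ⋂ i ∈ insert k T, K i := by
  obtain ⟨j, hj⟩ := hT
  ext σ
  simp only [Set.mem_iInter, Set.mem_inter_iff, Finset.mem_insert, forall_eq_or_imp]
  exact ⟨fun h => ⟨(h j hj).2, fun i hi => (h i hi).1⟩, fun h i hi => ⟨h.2 i hi, h.1⟩⟩

/-- If the intersections of a family of complexes are acyclic in a range of degrees, then so is the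
union. -/
theorem isAcyclicAt_biUnion (S : Finset ι) (K : ι → Set (Finset V)) (hK : ∀ i, IsLowerSet (K i))
    (d : ℕ) (h : ∀ T ⊆ S, T.Nonempty → ∀ i, i + T.card = d + 1 → IsAcyclicAt F (⋂ j ∈ T, K j) i) :
    IsAcyclicAt F (⋃ i ∈ S, K i) d := by
  classical
  induction S using Finset.induction_on generalizing K d with
  | empty =>
    intro x hx _
    refine ⟨0, zero_mem _, ?_⟩
    rw [map_zero]
    refine (eqOn_chainsOf (f := LinearMap.id) (g := 0) (fun σ hσ => ?_) hx).symm
    simp at hσ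
  | insert k S hk ih =>
    intro z hz h0
    cases d with
    | zero =>
      rcases exists_mem_chainsOf_of_card_zero hz with rfl | ⟨i, hi, hzi⟩
      · exact ⟨0, zero_mem _, map_zero _⟩
      · have := h {i} (by simpa using hi) (by simp) 0 (by simp)
        rw [Finset.set_biInter_singleton] at this
        obtain ⟨y, hy, hyz⟩ := this z hzi h0
        exact ⟨y, chainsOf_mono (Set.subset_biUnion_of_mem (u := fun i => K i) hi) _ hy, hyz⟩
    | succ d =>
      rw [biUnion_insert_eq] at hz ⊢
      obtain ⟨z₁, h1, z₂, h2, rfl, h3, h4⟩ :=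
        exists_split_cycle (isLowerSet_biUnion hK) (hK k) hz h0
      have hU : ((⋃ i ∈ S, K i) ∩ K k) = ⋃ i ∈ S, (K i ∩ K k) := by
        rw [Set.iUnion₂_inter]
      -- The common boundary is filled by `w` inside the intersection; shifting `w` from one part to
      -- the other turns both parts into cycles.
      obtain ⟨w, hw, hw'⟩ := ih (fun i => K i ∩ K k) (fun i => (hK i).inter (hK k)) d
        (fun T hT hne i hi => by
          rw [biInter_inter_eq k hne]
          refine h _ (Finset.insert_subset_insert k hT) (Finset.insert_nonempty _ _) i ?_
          rw [Finset.card_insert_of_notMem fun hkT => hk (hT hkT)]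
          lia) _ (hU ▸ h3) (bdry_bdry z₁)
      rw [← hU] at hw
      obtain ⟨y₁, hy₁, hy₁'⟩ := ih K hK (d + 1)
        (fun T hT => h T (hT.trans (Finset.subset_insert _ _))) (z₁ - w)
        (sub_mem h1 (chainsOf_mono Set.inter_subset_left _ hw)) (by rw [map_sub, hw', sub_self])
      have hk' := h {k} (by simp) (by simp) (d + 1) (by simp)
      rw [Finset.set_biInter_singleton] at hk'
      obtain ⟨y₂, hy₂, hy₂'⟩ := hk' (z₂ + w)
        (add_mem h2 (chainsOf_mono Set.inter_subset_right _ hw))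
        (by rw [map_add, hw', h4, neg_add_cancel])
      refine ⟨y₁ + y₂, ?_, by rw [map_add, hy₁', hy₂']; abel⟩
      rw [chainsOf_union]
      exact Submodule.add_mem_sup hy₁ hy₂

/-- If the intersections of at least two members of a family of complexes are acyclic in a range
of degrees, then the cycles of the union are sums of cycles of the members. -/
theorem exists_sum_cycles (S : Finset ι) (K : ι → Set (Finset V)) (hK : ∀ i, IsLowerSet (K i))
    (d : ℕ) (h : ∀ T ⊆ S, 2 ≤ T.card → ∀ i, i + T.card = d + 1 → IsAcyclicAt F (⋂ j ∈ T, K j) i)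
    {z : Finset V →₀ F} (hz : z ∈ chainsOf F (⋃ i ∈ S, K i) d) (h0 : bdry F z = 0) :
    ∃ w : ι → Finset V →₀ F, (∀ i ∈ S, w i ∈ chainsOf F (K i) d ∧ bdry F (w i) = 0) ∧
      z = ∑ i ∈ S, w i := by
  classical
  induction S using Finset.induction_on generalizing z with
  | empty =>
    refine ⟨0, by simp, ?_⟩
    rw [Finset.sum_empty]
    refine (eqOn_chainsOf (f := LinearMap.id) (g := 0) (fun σ hσ => ?_) hz)
    simp at hσ
  | insert k S hk ih =>
    cases d with
    | zero =>
      rcases exists_mem_chainsOf_of_card_zero hz with rfl | ⟨i, hi, hzi⟩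
      · exact ⟨0, fun i _ => ⟨zero_mem _, map_zero _⟩, by simp⟩
      · refine ⟨Pi.single i z, fun j _ => ?_, by
          rw [Finset.sum_eq_single_of_mem i hi fun j _ hj => Pi.single_eq_of_ne hj _,
            Pi.single_eq_same]⟩
        rcases eq_or_ne j i with rfl | hj
        · rw [Pi.single_eq_same]; exact ⟨hzi, h0⟩
        · rw [Pi.single_eq_of_ne hj]; exact ⟨zero_mem _, map_zero _⟩
    | succ d =>
      rw [biUnion_insert_eq] at hz
      obtain ⟨z₁, h1, z₂, h2, rfl, h3, h4⟩ :=
        exists_split_cycle (isLowerSet_biUnion hK) (hK k) hz h0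
      have hU : ((⋃ i ∈ S, K i) ∩ K k) = ⋃ i ∈ S, (K i ∩ K k) := by
        rw [Set.iUnion₂_inter]
      -- Every intersection used here also involves `K k`, hence at least two members; acyclicity of
      -- single members is never needed.
      obtain ⟨w, hw, hw'⟩ := isAcyclicAt_biUnion S (fun i => K i ∩ K k)
        (fun i => (hK i).inter (hK k)) d
        (fun T hT hne i hi => by
          have hc : (insert k T).card = T.card + 1 :=
            Finset.card_insert_of_notMem fun hkT => hk (hT hkT)
          rw [biInter_inter_eq k hne]
          have := hne.card_pos
          exact h _ (Finset.insert_subset_insert k hT) (by lia) i (by lia)) _ (hU ▸ h3)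
        (bdry_bdry z₁)
      rw [← hU] at hw
      obtain ⟨y, hy, hyz⟩ := ih (fun T hT => h T (hT.trans (Finset.subset_insert _ _)))
        (sub_mem h1 (chainsOf_mono Set.inter_subset_left _ hw)) (by rw [map_sub, hw', sub_self])
      refine ⟨Function.update y k (z₂ + w), fun i hi => ?_, ?_⟩
      · rcases eq_or_ne i k with rfl | hik
        · rw [Function.update_self]
          exact ⟨add_mem h2 (chainsOf_mono Set.inter_subset_right _ hw),
            by rw [map_add, hw', h4, neg_add_cancel]⟩
        · rw [Function.update_of_ne hik]
          exact hy i ((Finset.mem_insert.1 hi).resolve_left hik)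
      · have hS : ∑ i ∈ S, Function.update y k (z₂ + w) i = ∑ i ∈ S, y i :=
          Finset.sum_congr rfl fun i hi =>
            Function.update_of_ne (fun e : i = k => hk (e ▸ hi)) _ _
        rw [Finset.sum_insert hk, Function.update_self, hS, ← hyz]
        abel

/-- A functional that vanishes on the cycles of `K` factors through the boundary. -/
theorem exists_functional_comp_bdry (K : Set (Finset V)) (d : ℕ) (g : (Finset V →₀ F) →ₗ[F] F)
    (hg : ∀ x ∈ chainsOf F K d, bdry F x = 0 → g x = 0) :
    ∃ η : (Finset V →₀ F) →ₗ[F] F, ∀ x ∈ chainsOf F K d, g x = η (bdry F x) := by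
  set f := (bdry F).domRestrict (chainsOf F K d)
  have : g.domRestrict (chainsOf F K d) ∈ LinearMap.range f.dualMap := by
    -- This is where field coefficients matter: the image of a dual map is the annihilator of the
    -- kernel.
    have hr := LinearMap.range_dualMap_eq_dualAnnihilator_ker (K := F) (V₁ := chainsOf F K d)
      (V₂ := Finset V →₀ F) f
    refine hr.ge ((Submodule.mem_dualAnnihilator _).2 ?_)
    exact fun x hx => hg x.1 x.2 hx
  obtain ⟨η, hη⟩ := this
  exact ⟨η, fun x hx => (LinearMap.congr_fun hη ⟨x, hx⟩).symm⟩

omit [LinearOrder V] in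
-- Chains are free on faces, so a functional may be prescribed face by face; only agreement on
-- common faces is required.
theorem exists_functional_glue (A B : Set (Finset V)) (d : ℕ) (f g : (Finset V →₀ F) →ₗ[F] F)
    (h : ∀ σ ∈ A, σ ∈ B → σ.card = d → f (Finsupp.single σ 1) = g (Finsupp.single σ 1)) :
    ∃ Θ : (Finset V →₀ F) →ₗ[F] F, (∀ x ∈ chainsOf F A d, Θ x = f x) ∧
      ∀ x ∈ chainsOf F B d, Θ x = g x := by
  classical
  let Θ : (Finset V →₀ F) →ₗ[F] F := Finsupp.lift F F (Finset V) fun σ =>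
    if σ ∈ A then f (Finsupp.single σ 1) else g (Finsupp.single σ 1)
  have hΘ : ∀ σ, Θ (Finsupp.single σ 1) =
      if σ ∈ A then f (Finsupp.single σ 1) else g (Finsupp.single σ 1) := fun σ => by
    simp only [Θ]
    rw [Finsupp.lift_apply, Finsupp.sum_single_index (by simp), one_smul]
  refine ⟨Θ, fun x hx => eqOn_chainsOf (fun σ hσ _ => by rw [hΘ, if_pos hσ]) hx,
    fun x hx => eqOn_chainsOf (fun σ hσ hd => ?_) hx⟩
  rw [hΘ]
  split_ifs with hA
  · exact h σ hA hσ hd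
  · rfl

/-- Functionals `Θ i` on the members of a family of complexes that agree on common cycles glue to a
functional on the union, when the intersections of at least three members are acyclic in a range
of degrees. -/
theorem exists_functional_biUnion (S : Finset ι) (K : ι → Set (Finset V))
    (hK : ∀ i, IsLowerSet (K i)) (d : ℕ)
    (h : ∀ T ⊆ S, 3 ≤ T.card → ∀ i, i + T.card = d + 2 → IsAcyclicAt F (⋂ j ∈ T, K j) i)
    (Φ : (Finset V →₀ F) →ₗ[F] F) (Θ : ι → (Finset V →₀ F) →ₗ[F] F)
    (hΘ : ∀ i ∈ S, ∀ x ∈ chainsOf F (K i) (d + 1), Θ i (bdry F x) = Φ x)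
    (hΘΘ : ∀ i ∈ S, ∀ j ∈ S, i ≠ j → ∀ x ∈ chainsOf F (K i ∩ K j) d, bdry F x = 0 →
      Θ i x = Θ j x) :
    ∃ Θ' : (Finset V →₀ F) →ₗ[F] F,
      (∀ x ∈ chainsOf F (⋃ i ∈ S, K i) (d + 1), Θ' (bdry F x) = Φ x) ∧
      ∀ i ∈ S, ∀ x ∈ chainsOf F (K i) d, bdry F x = 0 → Θ' x = Θ i x := by
  classical
  induction S using Finset.induction_on with
  | empty =>
    refine ⟨0, fun x hx => ?_, by simp⟩
    refine eqOn_chainsOf (f := 0) (g := Φ) (fun σ hσ => ?_) hx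
    simp at hσ
  | insert k S hk ih =>
    obtain ⟨Θ₁, h1, h2⟩ := ih (fun T hT => h T (hT.trans (Finset.subset_insert _ _)))
      (fun i hi => hΘ i (Finset.mem_insert_of_mem hi))
      (fun i hi j hj => hΘΘ i (Finset.mem_insert_of_mem hi) j (Finset.mem_insert_of_mem hj))
    have hU : ((⋃ i ∈ S, K i) ∩ K k) = ⋃ i ∈ S, (K i ∩ K k) := by
      rw [Set.iUnion₂_inter]
    -- The two functionals agree on cycles of the overlap, so there they differ by some `η ∘ ∂`.
    -- Adding `η ∘ ∂` to `Θ k` makes them agree on all faces and changes no value on a cycle.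
    obtain ⟨η, hη⟩ := exists_functional_comp_bdry ((⋃ i ∈ S, K i) ∩ K k) d (Θ₁ - Θ k) (by
      intro x hx h0
      rw [hU] at hx
      obtain ⟨w, hw, rfl⟩ := exists_sum_cycles S (fun i => K i ∩ K k)
        (fun i => (hK i).inter (hK k)) d
        (fun T hT hne i hi => by
          have hc : (insert k T).card = T.card + 1 :=
            Finset.card_insert_of_notMem fun hkT => hk (hT hkT)
          rw [biInter_inter_eq k (Finset.card_pos.1 (by lia))]
          exact h _ (Finset.insert_subset_insert k hT) (by lia) i (by lia)) hx h0
      rw [map_sum]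
      refine Finset.sum_eq_zero fun i hi => ?_
      obtain ⟨hw1, hw2⟩ := hw i hi
      rw [LinearMap.sub_apply, h2 i hi _ (chainsOf_mono Set.inter_subset_left _ hw1) hw2,
        hΘΘ i (Finset.mem_insert_of_mem hi) k (Finset.mem_insert_self _ _)
          (fun e => hk (e ▸ hi)) _ hw1 hw2, sub_self])
    obtain ⟨Θ', h3, h4⟩ := exists_functional_glue (⋃ i ∈ S, K i) (K k) d Θ₁
      (Θ k + η ∘ₗ bdry F) (fun σ hσ hσ' hd => by
        have := hη _ (single_mem_chainsOf (F := F) (Set.mem_inter hσ hσ') hd 1)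
        rw [LinearMap.sub_apply] at this
        rw [LinearMap.add_apply, LinearMap.comp_apply, ← this]; ring)
    refine ⟨Θ', fun x hx => ?_, fun i hi x hx h0 => ?_⟩
    · rw [biUnion_insert_eq, chainsOf_union] at hx
      obtain ⟨x₁, hx₁, x₂, hx₂, rfl⟩ := Submodule.mem_sup.1 hx
      rw [map_add, map_add, map_add, h3 _ (bdry_mem_chainsOf (isLowerSet_biUnion hK) hx₁),
        h4 _ (bdry_mem_chainsOf (hK k) hx₂), h1 _ hx₁, LinearMap.add_apply, LinearMap.comp_apply,
        bdry_bdry, hΘ k (Finset.mem_insert_self _ _) _ hx₂, map_zero, add_zero]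
    · rcases Finset.mem_insert.1 hi with rfl | hi
      · rw [h4 _ hx, LinearMap.add_apply, LinearMap.comp_apply, h0, map_zero, add_zero]
      · rw [h3 _ (chainsOf_mono (Set.subset_biUnion_of_mem (u := fun i => K i) hi) _ hx),
          h2 i hi _ hx h0]

end Nerve

/-! ### Matching complexes -/

section Matching

/-- Unordered pairs of natural numbers, as lexicographically ordered pairs. -/
abbrev Edge : Type := ℕ ×ₗ ℕ

/-- The edge joining two vertices. -/
def edge (a b : ℕ) : Edge := if a < b then toLex (a, b) else toLex (b, a)

/-- The two ends of an edge. -/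
def ends (e : Edge) : Finset ℕ := {(ofLex e).1, (ofLex e).2}

/-- The matching complex of the complete graph on `S`, with the empty matching. -/
def matchings (S : Finset ℕ) : Set (Finset Edge) :=
  {σ | (∀ e ∈ σ, (ofLex e).1 < (ofLex e).2 ∧ ends e ⊆ S) ∧
    ∀ e ∈ σ, ∀ f ∈ σ, e ≠ f → Disjoint (ends e) (ends f)}

theorem edge_comm (a b : ℕ) : edge a b = edge b a := by
  unfold edge
  rcases lt_trichotomy a b with h | rfl | h
  · simp [h, not_lt.2 h.le]
  · rfl
  · simp [h, not_lt.2 h.le]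

theorem ends_edge (a b : ℕ) : ends (edge a b) = {a, b} := by
  unfold edge ends
  split_ifs
  · rfl
  · exact Finset.pair_comm b a

theorem edge_lt {a b : ℕ} (h : a ≠ b) : (ofLex (edge a b)).1 < (ofLex (edge a b)).2 := by
  unfold edge
  split_ifs with hab
  · exact hab
  · exact lt_of_le_of_ne (not_lt.1 hab) h.symm

theorem edge_right_inj {a b c : ℕ} (h : edge a b = edge a c) : b = c := by
  have h2 := congrArg ends h
  rw [ends_edge, ends_edge] at h2
  have hb : b ∈ ({a, c} : Finset ℕ) := h2 ▸ by simp
  have hc : c ∈ ({a, b} : Finset ℕ) := h2 ▸ by simp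
  simp only [Finset.mem_insert, Finset.mem_singleton] at hb hc
  lia

theorem exists_edge_eq {e : Edge} (he : (ofLex e).1 < (ofLex e).2) {v : ℕ} (hv : v ∈ ends e) :
    ∃ c, c ≠ v ∧ e = edge v c := by
  simp only [ends, Finset.mem_insert, Finset.mem_singleton] at hv
  rcases hv with rfl | rfl
  · exact ⟨_, he.ne', by unfold edge; rw [if_pos he]; rfl⟩
  · exact ⟨_, he.ne, by unfold edge; rw [if_neg (not_lt.2 he.le)]; rfl⟩

theorem isLowerSet_matchings (S : Finset ℕ) : IsLowerSet (matchings S) :=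
  fun _ _ h hσ => ⟨fun e he => hσ.1 e (h he), fun e he f hf => hσ.2 e (h he) f (h hf)⟩

theorem matchings_mono {S T : Finset ℕ} (h : S ⊆ T) : matchings S ⊆ matchings T :=
  fun _ hσ => ⟨fun e he => ⟨(hσ.1 e he).1, (hσ.1 e he).2.trans h⟩, hσ.2⟩

theorem empty_mem_matchings (S : Finset ℕ) : ∅ ∈ matchings S := by simp [matchings]

theorem notMem_ends {S : Finset ℕ} {σ : Finset Edge} (h : σ ∈ matchings S) {v : ℕ} (hv : v ∉ S)
    {e : Edge} (he : e ∈ σ) : v ∉ ends e :=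
  fun h' => hv ((h.1 e he).2 h')

theorem edge_notMem {S : Finset ℕ} {σ : Finset Edge} (h : σ ∈ matchings S) {v : ℕ} (hv : v ∉ S)
    (c : ℕ) : edge v c ∉ σ :=
  fun he => notMem_ends h hv he (by simp [ends_edge])

theorem insert_edge_mem {S T : Finset ℕ} {σ : Finset Edge} (h : σ ∈ matchings T) (hT : T ⊆ S)
    {a b : ℕ} (hab : a ≠ b) (ha : a ∈ S) (hb : b ∈ S) (ha' : a ∉ T) (hb' : b ∉ T) :
    insert (edge a b) σ ∈ matchings S := by
  have hd : ∀ f ∈ σ, Disjoint (ends (edge a b)) (ends f) := fun f hf => by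
    rw [ends_edge, Finset.disjoint_insert_left, Finset.disjoint_singleton_left]
    exact ⟨notMem_ends h ha' hf, notMem_ends h hb' hf⟩
  refine ⟨fun e he => ?_, fun e he f hf hef => ?_⟩
  · rcases Finset.mem_insert.1 he with rfl | he
    · refine ⟨edge_lt hab, ?_⟩
      rw [ends_edge]
      exact Finset.insert_subset ha (Finset.singleton_subset_iff.2 hb)
    · exact matchings_mono hT h |>.1 e he
  · rcases Finset.mem_insert.1 he with rfl | he <;> rcases Finset.mem_insert.1 hf with rfl | hf
    · exact absurd rfl hef
    · exact hd f hf
    · exact (hd e he).symm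
    · exact h.2 e he f hf hef

/-- The matchings on `insert v D` that are compatible with the edge `v c`. -/
def edgeStar (v : ℕ) (D : Finset ℕ) (c : ℕ) : Set (Finset Edge) :=
  {σ | σ.erase (edge v c) ∈ matchings (D.erase c)}

theorem isLowerSet_edgeStar (v : ℕ) (D : Finset ℕ) (c : ℕ) : IsLowerSet (edgeStar v D c) :=
  fun _ _ h hσ => isLowerSet_matchings _ (Finset.erase_subset_erase _ h) hσ

theorem mem_edgeStar_of_mem {v : ℕ} {D : Finset ℕ} {c : ℕ} {σ : Finset Edge}
    (h : σ ∈ matchings (D.erase c)) : σ ∈ edgeStar v D c :=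
  isLowerSet_matchings _ (Finset.erase_subset _ _) h

theorem insert_mem_edgeStar {v : ℕ} {D : Finset ℕ} {c : ℕ} {σ : Finset Edge}
    (h : σ ∈ edgeStar v D c) : insert (edge v c) σ ∈ edgeStar v D c := by
  unfold edgeStar at *
  rwa [Set.mem_ofPred_eq, Finset.erase_insert_eq_erase]

theorem edgeStar_subset {v : ℕ} {D : Finset ℕ} (hv : v ∉ D) {c : ℕ} (hc : c ∈ D) :
    edgeStar v D c ⊆ matchings (insert v D) := by
  intro σ hσ
  have : insert (edge v c) (σ.erase (edge v c)) ∈ matchings (insert v D) :=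
    insert_edge_mem hσ ((Finset.erase_subset _ _).trans (Finset.subset_insert _ _))
      (fun h => hv (h ▸ hc)) (Finset.mem_insert_self _ _) (Finset.mem_insert_of_mem hc)
      (fun h => hv (Finset.mem_of_mem_erase h)) (Finset.notMem_erase _ _)
  refine isLowerSet_matchings _ (fun e he => ?_) this
  by_cases h : e = edge v c <;> simp [h, he]

/-- Distinct edges at `v` conflict, so a matching compatible with two of them contains no edge at
`v` and must avoid every endpoint in `T`. -/
theorem biInter_edgeStar {v : ℕ} {D : Finset ℕ} (hv : v ∉ D) {T : Finset ℕ} (hT : 2 ≤ T.card) :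
    (⋂ c ∈ T, edgeStar v D c) = matchings (D \ T) := by
  ext σ
  simp only [Set.mem_iInter]
  constructor
  · intro h
    have key : ∀ c ∈ T, σ ∈ matchings (D.erase c) := by
      intro c hc
      have hcs := h c hc
      obtain ⟨c', hc', hne⟩ := Finset.exists_mem_ne (by lia : 1 < T.card) c
      have hn : edge v c ∉ σ := by
        intro he
        refine edge_notMem (h c' hc') (v := v) (fun h => hv (Finset.mem_of_mem_erase h)) c
          (Finset.mem_erase.2 ⟨fun h => hne (edge_right_inj h).symm, he⟩)
      rw [edgeStar, Set.mem_ofPred_eq, Finset.erase_eq_of_notMem hn] at hcs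
      exact hcs
    obtain ⟨c, hc⟩ := Finset.card_pos.1 (by lia : 0 < T.card)
    refine ⟨fun e he => ⟨((key c hc).1 e he).1, fun x hx => ?_⟩, (key c hc).2⟩
    rw [Finset.mem_sdiff]
    exact ⟨Finset.mem_of_mem_erase (((key c hc).1 e he).2 hx), fun hxT =>
      Finset.notMem_erase x D (((key x hxT).1 e he).2 hx)⟩
  · intro h c hc
    refine mem_edgeStar_of_mem (matchings_mono (fun x hx => ?_) h)
    rw [Finset.mem_sdiff] at hx
    exact Finset.mem_erase.2 ⟨fun e => hx.2 (e ▸ hc), hx.1⟩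

theorem edgeStar_inter {v : ℕ} {D : Finset ℕ} (hv : v ∉ D) {c c' : ℕ} (hc : c ≠ c') :
    edgeStar v D c ∩ edgeStar v D c' = matchings (D \ {c, c'}) := by
  rw [← biInter_edgeStar hv (Finset.card_pair hc).ge]
  simp

/-- A matching that contains `vc` lies in the star of `vc`; one that misses both `v` and some `c`
can be enlarged by `vc`. Only perfect matchings of `D` remain. -/
theorem mem_edgeStar_or {v : ℕ} {D : Finset ℕ} {σ : Finset Edge}
    (hσ : σ ∈ matchings (insert v D)) :
    (∃ c ∈ D, σ ∈ edgeStar v D c) ∨ σ ∈ matchings D ∧ D ⊆ σ.biUnion ends := by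
  by_cases h : ∃ e ∈ σ, v ∈ ends e
  · left
    obtain ⟨e, he, hve⟩ := h
    obtain ⟨c, hcv, rfl⟩ := exists_edge_eq (hσ.1 e he).1 hve
    have hc : c ∈ ends (edge v c) := by simp [ends_edge]
    refine ⟨c, Finset.mem_of_mem_insert_of_ne ((hσ.1 _ he).2 hc) hcv, ?_⟩
    refine ⟨fun f hf => ?_, fun f hf g hg =>
      hσ.2 f (Finset.mem_of_mem_erase hf) g (Finset.mem_of_mem_erase hg)⟩
    obtain ⟨hf1, hf2⟩ := Finset.mem_erase.1 hf
    have hd := hσ.2 f hf2 _ he hf1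
    refine ⟨(hσ.1 f hf2).1, fun x hx => Finset.mem_erase.2 ⟨?_, ?_⟩⟩
    · rintro rfl
      exact Finset.disjoint_left.1 hd hx hc
    · refine Finset.mem_of_mem_insert_of_ne ((hσ.1 _ hf2).2 hx) ?_
      rintro rfl
      exact Finset.disjoint_left.1 hd hx hve
  · push Not at h
    have hD : σ ∈ matchings D := ⟨fun e he => ⟨(hσ.1 e he).1, fun x hx =>
      Finset.mem_of_mem_insert_of_ne ((hσ.1 e he).2 hx) fun e' => h e he (e' ▸ hx)⟩, hσ.2⟩
    by_cases hc : D ⊆ σ.biUnion ends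
    · exact Or.inr ⟨hD, hc⟩
    · left
      obtain ⟨c, hcD, hc⟩ := Finset.not_subset.1 hc
      refine ⟨c, hcD, mem_edgeStar_of_mem ⟨fun e he => ⟨(hD.1 e he).1, fun x hx =>
        Finset.mem_erase.2 ⟨?_, (hD.1 e he).2 hx⟩⟩, hD.2⟩⟩
      rintro rfl
      exact hc (Finset.mem_biUnion.2 ⟨e, he, hx⟩)

theorem card_biUnion_ends_le (σ : Finset Edge) : (σ.biUnion ends).card ≤ 2 * σ.card := by
  rw [mul_comm]
  exact Finset.card_biUnion_le_card_mul _ _ _ fun e _ => Finset.card_le_two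

theorem mem_biUnion_edgeStar {v : ℕ} {D : Finset ℕ} {σ : Finset Edge}
    (hσ : σ ∈ matchings (insert v D)) (h : 2 * σ.card < D.card) :
    σ ∈ ⋃ c ∈ D, edgeStar v D c := by
  rcases mem_edgeStar_or hσ with h' | h'
  · simpa using h'
  · have := (Finset.card_le_card h'.2).trans (card_biUnion_ends_le σ)
    lia

variable {F : Type*} [Field F]

theorem biUnion_edgeStar_subset {v : ℕ} {D : Finset ℕ} (hv : v ∉ D) {T : Finset ℕ} (hT : T ⊆ D) :
    (⋃ c ∈ T, edgeStar v D c) ⊆ matchings (insert v D) :=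
  Set.iUnion₂_subset fun _ hc => edgeStar_subset hv (hT hc)

theorem wedge_mem_edgeStar {v : ℕ} {D : Finset ℕ} {c d : ℕ} {x : Finset Edge →₀ F}
    (hx : x ∈ chainsOf F (edgeStar v D c) d) :
    wedge F (edge v c) x ∈ chainsOf F (edgeStar v D c) (d + 1) :=
  wedge_mem_chainsOf (fun _ hσ _ => insert_mem_edgeStar hσ) hx

theorem bdry_wedge_of_cycle {V R : Type*} [LinearOrder V] [CommRing R] {x : Finset V →₀ R}
    (h : bdry R x = 0) (v : V) : bdry R (wedge R v x) = x := by
  rw [bdry_wedge, h, map_zero, sub_zero]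

/-- The star is a cone with apex the edge `vc`. -/
theorem isAcyclicAt_edgeStar (v : ℕ) (D : Finset ℕ) (c d : ℕ) :
    IsAcyclicAt F (edgeStar v D c) d :=
  fun x hx h0 => ⟨wedge F (edge v c) x, wedge_mem_edgeStar hx, bdry_wedge_of_cycle h0 _⟩

/-- The matching complex on `N` vertices has vanishing homology in the degrees `d - 1` with
`3 d + 2 ≤ N`. -/
theorem isAcyclicAt_matchings (d : ℕ) (S : Finset ℕ) (hS : 3 * d + 2 ≤ S.card) :
    IsAcyclicAt F (matchings S) d := by
  induction d using Nat.strong_induction_on generalizing S with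
  | _ d ih =>
    obtain ⟨v, hv⟩ := Finset.card_pos.1 (by lia : 0 < S.card)
    obtain ⟨D, hvD, rfl⟩ : ∃ D, v ∉ D ∧ insert v D = S :=
      ⟨S.erase v, Finset.notMem_erase v S, Finset.insert_erase hv⟩
    rw [Finset.card_insert_of_notMem hvD] at hS
    intro x hx h0
    have hacyc : IsAcyclicAt F (⋃ c ∈ D, edgeStar v D c) d := by
      refine isAcyclicAt_biUnion D _ (isLowerSet_edgeStar v D) d fun T hT hne i hi => ?_
      have hpos := hne.card_pos
      rcases Nat.lt_or_ge 1 T.card with h1 | h1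
      · rw [biInter_edgeStar hvD h1]
        refine ih i (by lia) _ ?_
        -- Removing `T` costs `|T|` vertices but lowers the degree by `|T| - 1`, which is worth
        -- three vertices each; for `|T| ≥ 2` this is a gain.
        rw [Finset.card_sdiff_of_subset hT]
        lia
      · obtain ⟨c, rfl⟩ := Finset.card_eq_one.1 (by lia : T.card = 1)
        rw [Finset.set_biInter_singleton]
        exact isAcyclicAt_edgeStar _ _ _ _
    obtain ⟨y, hy, hyx⟩ := hacyc x (chainsOf_mono_card
      (fun σ hσ hd => mem_biUnion_edgeStar hσ (by lia)) hx) h0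
    exact ⟨y, chainsOf_mono (biUnion_edgeStar_subset hvD subset_rfl) _ hy, hyx⟩

/-- Multiplication by the cycle `{a, b} - {a, c}`. -/
noncomputable def cherry (R : Type*) [CommRing R] (a b c : ℕ) :
    (Finset Edge →₀ R) →ₗ[R] (Finset Edge →₀ R) :=
  wedge R (edge a b) - wedge R (edge a c)

/-- The product of the cycles `{a, b} - {a, c}` over the successive triples of a list. -/
noncomputable def cherryProduct (R : Type*) [CommRing R] : List ℕ → (Finset Edge →₀ R)
  | a :: b :: c :: l => cherry R a b c (cherryProduct R l)
  | _ => Finsupp.single ∅ 1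

theorem cherry_apply {R : Type*} [CommRing R] (a b c : ℕ) (x : Finset Edge →₀ R) :
    cherry R a b c x = wedge R (edge a b) x - wedge R (edge a c) x := rfl

theorem bdry_cherry {R : Type*} [CommRing R] (a b c : ℕ) (x : Finset Edge →₀ R) :
    bdry R (cherry R a b c x) = -cherry R a b c (bdry R x) := by
  rw [cherry_apply, cherry_apply, map_sub, bdry_wedge, bdry_wedge]; abel

theorem bdry_cherryProduct {R : Type*} [CommRing R] (l : List ℕ) :
    bdry R (cherryProduct R l) = 0 := by
  induction l using cherryProduct.induct with
  | case1 a b c l ih => rw [cherryProduct, bdry_cherry, ih, map_zero, neg_zero]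
  | case2 l h => rw [cherryProduct]; exacts [bdry_single_empty, h]

/-- A cherry is a combination of single edges, hence an element of odd degree. This is the sign
matched by `listSign_block_swap`. -/
theorem cherry_cherry {R : Type*} [CommRing R] (a b c a' b' c' : ℕ) (x : Finset Edge →₀ R) :
    cherry R a b c (cherry R a' b' c' x) = -cherry R a' b' c' (cherry R a b c x) := by
  simp only [cherry_apply, map_sub]
  rw [wedge_wedge (edge a b), wedge_wedge (edge a b), wedge_wedge (edge a c),
    wedge_wedge (edge a c)]
  abel

theorem wedge_edge_mem {F : Type*} [CommRing F] {S T : Finset ℕ} (hT : T ⊆ S) {a b d : ℕ}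
    (hab : a ≠ b) (ha : a ∈ S)
    (hb : b ∈ S) (ha' : a ∉ T) (hb' : b ∉ T) {x : Finset Edge →₀ F}
    (hx : x ∈ chainsOf F (matchings T) d) :
    wedge F (edge a b) x ∈ chainsOf F (matchings S) (d + 1) :=
  wedge_mem_chainsOf (fun _ hσ _ => insert_edge_mem hσ hT hab ha hb ha' hb') hx

/-- The boundaries and the products of cherries. -/
noncomputable def cherrySpan (F : Type*) [Field F] (S : Finset ℕ) (d : ℕ) :
    Submodule F (Finset Edge →₀ F) :=
  (chainsOf F (matchings S) (d + 1)).map (bdry F) ⊔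
    Submodule.span F {x | ∃ l : List ℕ, l.Nodup ∧ l.toFinset = S ∧ x = cherryProduct F l}

/-- Multiplication by a cherry anticommutes with the boundary, so it preserves boundaries, and it
puts one more triple in front of a product. -/
theorem cherry_mem_cherrySpan {v c c' : ℕ} {D : Finset ℕ} (hv : v ∉ D) (hc : c ∈ D) (hc' : c' ∈ D)
    (hcc : c ≠ c') {d : ℕ} {x : Finset Edge →₀ F} (hx : x ∈ cherrySpan F (D \ {c, c'}) d) :
    cherry F v c c' x ∈ cherrySpan F (insert v D) (d + 1) := by
  have hvc : v ≠ c := fun h => hv (h ▸ hc)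
  have hvc' : v ≠ c' := fun h => hv (h ▸ hc')
  have : cherrySpan F (D \ {c, c'}) d ≤
      (cherrySpan F (insert v D) (d + 1)).comap (cherry F v c c') := by
    rw [cherrySpan, sup_le_iff, Submodule.span_le, Submodule.map_le_iff_le_comap]
    constructor
    · intro u hu
      rw [Submodule.mem_comap, Submodule.mem_comap, ← neg_neg (cherry F v c c' _), ← bdry_cherry]
      refine neg_mem (Submodule.mem_sup_left (Submodule.mem_map_of_mem ?_))
      have hs : D \ {c, c'} ⊆ insert v D :=
        Finset.sdiff_subset.trans (Finset.subset_insert _ _)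
      exact sub_mem
        (wedge_edge_mem hs hvc (by simp) (by simp [hc]) (by simp [hv]) (by simp) hu)
        (wedge_edge_mem hs hvc' (by simp) (by simp [hc']) (by simp [hv]) (by simp) hu)
    · rintro _ ⟨l, hl, hlD, rfl⟩
      refine Submodule.mem_sup_right (Submodule.subset_span ⟨v :: c :: c' :: l, ?_, ?_, rfl⟩)
      · have h1 : ∀ x, x ∈ l ↔ x ∈ D \ {c, c'} := fun x => by rw [← hlD, List.mem_toFinset]
        simp [h1, hv, hvc, hvc', hcc, hl]
      · simp only [List.toFinset_cons, hlD]
        congr 1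
        ext x
        simp only [Finset.mem_insert, Finset.mem_sdiff, Finset.mem_singleton]
        constructor
        · rintro (rfl | rfl | h)
          exacts [hc, hc', h.1]
        · tauto
  exact this hx

/-- In the first nonvanishing degree, every cycle of the matching complex on `3 d` vertices is
homologous to a combination of products of cherries. -/
theorem cycle_mem_cherrySpan (d : ℕ) (S : Finset ℕ) (hS : S.card = 3 * d) {z : Finset Edge →₀ F}
    (hz : z ∈ chainsOf F (matchings S) d) (h0 : bdry F z = 0) : z ∈ cherrySpan F S d := by
  induction d generalizing S z with
  | zero =>
    obtain rfl := Finset.card_eq_zero.1 hS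
    refine chainsOf_le (fun σ _ hσ => ?_) hz
    rw [Finset.card_eq_zero.1 hσ]
    exact Submodule.mem_sup_right (Submodule.subset_span ⟨[], by simp, by simp, rfl⟩)
  | succ d ih =>
    obtain ⟨v, hv⟩ := Finset.card_pos.1 (by lia : 0 < S.card)
    obtain ⟨D, hvD, rfl⟩ : ∃ D, v ∉ D ∧ insert v D = S :=
      ⟨S.erase v, Finset.notMem_erase v S, Finset.insert_erase hv⟩
    rw [Finset.card_insert_of_notMem hvD] at hS
    -- The stars are added one at a time. Adding the star of `vk` splits `z` into a cycle on the
    -- earlier stars, a cycle in the new cone, and cherries `{v,c} - {v,k}` times cycles on `3d`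
    -- vertices.
    have key : ∀ T ⊆ D, ∀ z ∈ chainsOf F (⋃ c ∈ T, edgeStar v D c) (d + 1), bdry F z = 0 →
        z ∈ cherrySpan F (insert v D) (d + 1) := by
      intro T
      induction T using Finset.induction_on with
      | empty =>
        intro _ z hz _
        have : z = 0 := eqOn_chainsOf (f := LinearMap.id) (g := 0)
          (fun σ hσ => by simp at hσ) hz
        rw [this]; exact zero_mem _
      | insert k T hk ihT =>
        intro hT z hz h0
        have hkD : k ∈ D := hT (Finset.mem_insert_self _ _)
        have hTD : T ⊆ D := (Finset.subset_insert _ _).trans hT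
        rw [biUnion_insert_eq] at hz
        obtain ⟨z₁, h1, z₂, h2, rfl, h3, h4⟩ := exists_split_cycle
          (isLowerSet_biUnion (isLowerSet_edgeStar v D)) (isLowerSet_edgeStar v D k) hz h0
        rw [Set.iUnion₂_inter] at h3
        obtain ⟨w, hw, hw'⟩ := exists_sum_cycles T (fun c => edgeStar v D c ∩ edgeStar v D k)
          (fun c => (isLowerSet_edgeStar v D c).inter (isLowerSet_edgeStar v D k)) d
          (fun U hU hcard i hi => by
            have hkU : k ∉ U := fun h => hk (hU h)
            have hc := Finset.card_insert_of_notMem hkU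
            rw [biInter_inter_eq k (Finset.card_pos.1 (by lia)), biInter_edgeStar hvD (by lia)]
            refine isAcyclicAt_matchings i _ ?_
            rw [Finset.card_sdiff_of_subset (Finset.insert_subset hkD (hU.trans hTD)), hc]
            lia) h3 (bdry_bdry z₁)
        have e1 : ∀ c ∈ T, bdry F (wedge F (edge v c) (w c)) = w c :=
          fun c hc => bdry_wedge_of_cycle (hw c hc).2 _
        have e2 : ∀ c ∈ T, bdry F (wedge F (edge v k) (w c)) = w c :=
          fun c hc => bdry_wedge_of_cycle (hw c hc).2 _
        have hz₁ : z₁ - ∑ c ∈ T, wedge F (edge v c) (w c) ∈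
            cherrySpan F (insert v D) (d + 1) := by
          refine ihT hTD _ (sub_mem h1 (sum_mem fun c hc => ?_)) ?_
          · exact chainsOf_mono (Set.subset_biUnion_of_mem (u := fun c => edgeStar v D c) hc) _
              (wedge_mem_edgeStar (chainsOf_mono Set.inter_subset_left _ (hw c hc).1))
          · rw [map_sub, map_sum, Finset.sum_congr rfl e1, hw', sub_self]
        have hz₂ : z₂ + ∑ c ∈ T, wedge F (edge v k) (w c) ∈
            cherrySpan F (insert v D) (d + 1) := by
          have hm : z₂ + ∑ c ∈ T, wedge F (edge v k) (w c) ∈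
              chainsOf F (edgeStar v D k) (d + 1) :=
            add_mem h2 (sum_mem fun c hc =>
              wedge_mem_edgeStar (chainsOf_mono Set.inter_subset_right _ (hw c hc).1))
          obtain ⟨y, hy, hy'⟩ := isAcyclicAt_edgeStar v D k (d + 1) _ hm
            (by rw [map_add, map_sum, Finset.sum_congr rfl e2, h4, hw', neg_add_cancel])
          rw [← hy']
          exact Submodule.mem_sup_left (Submodule.mem_map_of_mem
            (chainsOf_mono (edgeStar_subset hvD hkD) _ hy))
        have hz₃ : ∑ c ∈ T, cherry F v c k (w c) ∈ cherrySpan F (insert v D) (d + 1) := by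
          refine sum_mem fun c hc => ?_
          have hck : c ≠ k := fun h => hk (h ▸ hc)
          obtain ⟨hw1, hw2⟩ := hw c hc
          rw [edgeStar_inter hvD hck] at hw1
          refine cherry_mem_cherrySpan hvD (hTD hc) hkD hck (ih _ ?_ hw1 hw2)
          rw [Finset.card_sdiff_of_subset (Finset.insert_subset (hTD hc)
            (Finset.singleton_subset_iff.2 hkD)), Finset.card_pair hck]
          lia
        convert! add_mem (add_mem hz₁ hz₂) hz₃ using 1
        simp only [cherry_apply, Finset.sum_sub_distrib]
        abel
    cases d with
    | succ d =>
      exact key D subset_rfl z (chainsOf_mono_card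
        (fun σ hσ hd => mem_biUnion_edgeStar hσ (by lia)) hz) h0
    -- On three vertices the edge `bc` is a perfect matching of `D` and lies in no star. Subtracting
    -- the right multiple of the cherry `{c,b} - {c,v}` removes it from `z`.
    | zero =>
      obtain ⟨b, c, hbc, rfl⟩ := Finset.card_eq_two.1 (by lia : D.card = 2)
      simp only [Finset.mem_insert, Finset.mem_singleton, not_or] at hvD
      have hP : cherryProduct F [c, b, v] ∈ cherrySpan F (insert v {b, c}) 1 := by
        refine Submodule.mem_sup_right (Submodule.subset_span ⟨_, ?_, ?_, rfl⟩)
        · simp [hbc.symm, Ne.symm hvD.1, Ne.symm hvD.2]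
        · ext; simp; tauto
      have hP1 : cherryProduct F [c, b, v] =
          Finsupp.single {edge b c} 1 - Finsupp.single {edge v c} 1 := by
        simp [cherryProduct, cherry_apply, wedge_single, faceSign, edge_comm c]
      have hne : edge v c ≠ edge b c := by
        rw [edge_comm, edge_comm b]
        exact fun h => hvD.1 (edge_right_inj h)
      rw [← sub_add_cancel z (z {edge b c} • cherryProduct F [c, b, v])]
      refine add_mem (key _ subset_rfl _ ?_ ?_) (Submodule.smul_mem _ _ hP)
      · rw [mem_chainsOf]
        intro σ hσ
        rw [Finsupp.mem_support_iff] at hσ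
        have hσ' : σ ∈ matchings (insert v {b, c}) ∧ σ.card = 1 := by
          by_cases h1 : z σ = 0
          · by_cases h2 : σ = {edge v c}
            · subst h2
              refine ⟨?_, rfl⟩
              exact insert_edge_mem (σ := ∅) (T := ∅) (empty_mem_matchings _) (by simp) hvD.2
                (by simp) (by simp) (by simp) (by simp)
            · by_cases h3 : σ = {edge b c}
              · subst h3; simp [h1] at hσ
              · exfalso; apply hσ
                simp [hP1, h1, Ne.symm h2, Ne.symm h3]
          · exact mem_chainsOf.1 hz σ (Finsupp.mem_support_iff.2 h1)
        refine ⟨?_, hσ'.2⟩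
        rcases mem_edgeStar_or hσ'.1 with h | ⟨h, h'⟩
        · simpa using h
        · exfalso
          obtain ⟨e, rfl⟩ := Finset.card_eq_one.1 hσ'.2
          have hee := (h.1 e (by simp)).1
          rw [Finset.singleton_biUnion] at h'
          obtain ⟨x, hx, rfl⟩ := exists_edge_eq hee (h' (by simp : b ∈ _))
          have : c ∈ ends (edge b x) := h' (by simp)
          simp only [ends_edge, Finset.mem_insert, Finset.mem_singleton] at this
          obtain rfl := this.resolve_left hbc.symm
          apply hσ
          simp [hP1, hne]
      · rw [map_sub, map_smul, h0, bdry_cherryProduct, smul_zero, sub_zero]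

end Matching

/-! ### The sign of a list -/

section ListSign

variable {F : Type*} [Field F]

/-- The sign of the permutation that sorts a list of distinct numbers. -/
def listSign (F : Type*) [Field F] : List ℕ → F
  | [] => 1
  | a :: l => (l.map fun x => if x < a then (-1 : F) else 1).prod * listSign F l

theorem listSign_cons (a : ℕ) (l : List ℕ) : listSign F (a :: l) =
    (l.map fun x => if x < a then (-1 : F) else 1).prod * listSign F l := rfl

/-- The number of entries below `a` does not depend on the order of the tail, so relative signs
persist when a common head is added. -/
theorem listSign_cons_perm (a : ℕ) {l l' : List ℕ} (h : l.Perm l') {ε : F}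
    (he : listSign F l = ε * listSign F l') :
    listSign F (a :: l) = ε * listSign F (a :: l') := by
  rw [listSign_cons, listSign_cons, he, (h.map _).prod_eq]
  ring

theorem listSign_swap_head {a b : ℕ} (h : a ≠ b) (l : List ℕ) :
    listSign F (a :: b :: l) = -listSign F (b :: a :: l) := by
  simp only [listSign_cons, List.map_cons, List.prod_cons]
  rcases lt_or_gt_of_ne h with h | h <;> simp [h, not_lt.2 h.le] <;> ring

theorem listSign_swap (p : List ℕ) {a b : ℕ} (h : a ≠ b) (l : List ℕ) :
    listSign F (p ++ a :: b :: l) = -listSign F (p ++ b :: a :: l) := by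
  induction p with
  | nil => exact listSign_swap_head h l
  | cons x p ih =>
    rw [← neg_one_mul] at ih ⊢
    exact listSign_cons_perm x (List.Perm.append_left p (List.Perm.swap b a l)) ih

theorem listSign_mul_self (l : List ℕ) : listSign F l * listSign F l = 1 := by
  induction l with
  | nil => simp [listSign]
  | cons a l ih =>
    have : ∀ m : List ℕ, (m.map fun x => if x < a then (-1 : F) else 1).prod *
        (m.map fun x => if x < a then (-1 : F) else 1).prod = 1 := by
      intro m
      induction m with
      | nil => simp
      | cons b m ihm =>
        rw [List.map_cons, List.prod_cons, mul_mul_mul_comm, ihm]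
        split_ifs <;> simp
    rw [listSign_cons, mul_mul_mul_comm, ih, this, one_mul]

theorem listSign_ne_zero (l : List ℕ) : listSign F l ≠ 0 :=
  left_ne_zero_of_mul_eq_one (listSign_mul_self l)

theorem listSign_rotate {a b c d : ℕ} (ha : a ≠ d) (hb : b ≠ d) (hc : c ≠ d) (l : List ℕ) :
    listSign F (a :: b :: c :: d :: l) = -listSign F (d :: a :: b :: c :: l) := by
  have h1 : listSign F (a :: b :: c :: d :: l) = _ := listSign_swap [a, b] hc l
  have h2 : listSign F (a :: b :: d :: c :: l) = _ := listSign_swap [a] hb (c :: l)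
  have h3 : listSign F (a :: d :: b :: c :: l) = _ := listSign_swap [] ha (b :: c :: l)
  simp only [List.cons_append, List.nil_append] at h1 h2 h3
  rw [h1, h2, h3, neg_neg]

theorem listSign_rotate₂ (x : ℕ) {a b c d : ℕ} (ha : a ≠ d) (hb : b ≠ d) (hc : c ≠ d)
    (l : List ℕ) :
    listSign F (x :: a :: b :: c :: d :: l) = -listSign F (x :: d :: a :: b :: c :: l) := by
  rw [← neg_one_mul]
  refine listSign_cons_perm x ?_ (by rw [neg_one_mul]; exact listSign_rotate ha hb hc l)
  exact (List.perm_middle (l₁ := [a, b, c]))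

/-- Exchanging two blocks of length three takes nine transpositions, an odd number. -/
theorem listSign_block_swap {a b c d e f : ℕ} {l : List ℕ}
    (h : (a :: b :: c :: d :: e :: f :: l).Nodup) :
    listSign F (a :: b :: c :: d :: e :: f :: l) =
      -listSign F (d :: e :: f :: a :: b :: c :: l) := by
  simp only [List.nodup_cons, List.mem_cons, not_or] at h
  rw [listSign_rotate h.1.2.2.1 h.2.1.2.1 h.2.2.1.1,
    listSign_rotate₂ d h.1.2.2.2.1 h.2.1.2.2.1 h.2.2.1.2.1]
  have h1 := listSign_rotate₂ (F := F) e h.1.2.2.2.2.1 h.2.1.2.2.2.1 h.2.2.1.2.2.1 l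
  rw [← neg_one_mul] at h1
  have hp : (e :: a :: b :: c :: f :: l).Perm (e :: f :: a :: b :: c :: l) :=
    List.Perm.cons e (List.perm_middle (l₁ := [a, b, c]))
  rw [listSign_cons_perm d hp h1]
  simp

/-- The sign of a list and the product of cherries both change sign when adjacent triples are
exchanged. Hence the triple containing `v` can be moved to the front at the cost of the same `ε` in
both. -/
theorem exists_center {v : ℕ} (l : List ℕ) (n : ℕ) (hl : l.length = 3 * n) (hnd : l.Nodup)
    (hv : v ∈ l) : ∃ a b c m, ∃ ε : F, l.Perm (a :: b :: c :: m) ∧ (v = a ∨ v = b ∨ v = c) ∧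
      cherryProduct F l = ε • cherryProduct F (a :: b :: c :: m) ∧
      listSign F l = ε * listSign F (a :: b :: c :: m) := by
  induction n generalizing l with
  | zero => rw [List.length_eq_zero_iff.1 (by lia : l.length = 0)] at hv; simp at hv
  | succ n ih =>
    match l, hl with
    | a :: b :: c :: l, hl =>
      by_cases h : v = a ∨ v = b ∨ v = c
      · exact ⟨a, b, c, l, 1, List.Perm.refl _, h, by simp, by simp⟩
      · have hvl : v ∈ l := by simp only [List.mem_cons] at hv; tauto
        have hnl : l.Nodup := by simp only [List.nodup_cons] at hnd; exact hnd.2.2.2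
        obtain ⟨d, e, f, m, ε, hp, hv', hP, hs⟩ :=
          ih l (by simp only [List.length_cons] at hl; lia) hnl hvl
        have hp1 : (a :: b :: c :: l).Perm (a :: b :: c :: d :: e :: f :: m) :=
          ((hp.cons c).cons b).cons a
        have hp2 : (a :: b :: c :: d :: e :: f :: m).Perm (d :: e :: f :: a :: b :: c :: m) := by
          refine (List.perm_middle (l₁ := [a, b, c])).trans (List.Perm.cons d ?_)
          refine (List.perm_middle (l₁ := [a, b, c])).trans (List.Perm.cons e ?_)
          exact (List.perm_middle (l₁ := [a, b, c]))
        refine ⟨d, e, f, a :: b :: c :: m, -ε, hp1.trans hp2, hv', ?_, ?_⟩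
        · rw [cherryProduct, hP, map_smul, cherryProduct, cherry_cherry, cherryProduct,
            cherryProduct, smul_neg, neg_smul]
        · rw [listSign_cons_perm a ((hp.cons c).cons b)
            (listSign_cons_perm b (hp.cons c) (listSign_cons_perm c hp hs)),
            listSign_block_swap (hp1.nodup_iff.1 hnd)]
          ring

end ListSign

/-! ### A functional on the first nonvanishing homology of matching complexes -/

section Functional

variable {F : Type*} [Field F]

theorem cherryProduct_mem {F : Type*} [CommRing F] {l : List ℕ} (hl : l.Nodup)
    {d : ℕ} (hd : l.length = 3 * d) {S : Finset ℕ} (hS : ∀ x ∈ l, x ∈ S) :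
    cherryProduct F l ∈ chainsOf F (matchings S) d := by
  induction d generalizing l S with
  | zero =>
    rw [List.length_eq_zero_iff.1 (by lia : l.length = 0), cherryProduct]
    · exact single_mem_chainsOf (empty_mem_matchings _) rfl _
    · simp
  | succ d ih =>
    match l, hd with
    | a :: b :: c :: l, hd =>
      simp only [List.nodup_cons, List.mem_cons, not_or] at hl
      simp only [List.mem_cons, forall_eq_or_imp] at hS
      have hm := ih (S := l.toFinset) hl.2.2.2 (by simp only [List.length_cons] at hd; lia)
        (fun x hx => List.mem_toFinset.2 hx)
      have hlS : l.toFinset ⊆ S := fun x hx => hS.2.2.2 x (List.mem_toFinset.1 hx)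
      exact sub_mem
        (wedge_edge_mem hlS hl.1.1 hS.1 hS.2.1 (by simp [hl.1.2.2]) (by simp [hl.2.1.2]) hm)
        (wedge_edge_mem hlS hl.1.2.1 hS.1 hS.2.2.1 (by simp [hl.1.2.2]) (by simp [hl.2.2.1]) hm)

theorem contract_eq_zero_of_notMem {V : Type*} [LinearOrder V] {K : Set (Finset V)} {d : ℕ} {v : V}
    (h : ∀ σ ∈ K, v ∉ σ) {x : Finset V →₀ F} (hx : x ∈ chainsOf F K d) : contract F v x = 0 :=
  eqOn_chainsOf (g := 0) (fun σ hσ _ => by simp [contract_single, h σ hσ]) hx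

/-- Functionals `f c c'` on the first nonvanishing homology of the matching complexes on
`D \ {c, c'}` that satisfy the cocycle condition come from a functional on the union of the stars of
the edges `v c`. -/
theorem exists_functional_edgeStars {v : ℕ} {D : Finset ℕ} (hv : v ∉ D) {t : ℕ}
    (hD : D.card = 3 * t + 3) (f : ℕ → ℕ → (Finset Edge →₀ F) →ₗ[F] F)
    (hf : ∀ c ∈ D, ∀ c' ∈ D, c ≠ c' → ∀ u ∈ chainsOf F (matchings (D \ {c, c'})) (t + 1),
      f c c' (bdry F u) = 0)
    (hanti : ∀ c ∈ D, ∀ c' ∈ D, c ≠ c' → f c c' = -f c' c)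
    (hcocycle : ∀ c ∈ D, ∀ c' ∈ D, ∀ c'' ∈ D, c ≠ c' → c ≠ c'' → c' ≠ c'' →
      ∀ w ∈ chainsOf F (matchings (D \ {c, c', c''})) t, bdry F w = 0 →
        f c c' w - f c c'' w + f c' c'' w = 0) (T : Finset ℕ) (hT : T ⊆ D) :
    ∃ Φ : (Finset Edge →₀ F) →ₗ[F] F,
      (∀ u ∈ chainsOf F (⋃ c ∈ T, edgeStar v D c) (t + 2), Φ (bdry F u) = 0) ∧
      ∀ c ∈ T, ∀ c' ∈ T, c ≠ c' → ∀ w ∈ chainsOf F (matchings (D \ {c, c'})) t, bdry F w = 0 →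
        Φ (cherry F v c c' w) = f c c' w := by
  have hsub : ∀ c c', matchings (D \ {c, c'}) ⊆ edgeStar v D c := fun c c' σ hσ =>
    mem_edgeStar_of_mem (matchings_mono (fun x hx => by
      rw [Finset.mem_sdiff, Finset.mem_insert, not_or] at hx
      exact Finset.mem_erase.2 ⟨hx.2.1, hx.1⟩) hσ)
  have hsub' : ∀ c c', matchings (D \ {c, c'}) ⊆ edgeStar v D c' := fun c c' => by
    rw [Finset.pair_comm]; exact hsub c' c
  induction T using Finset.induction_on with
  | empty =>
    exact ⟨0, fun _ _ => rfl, fun c hc => absurd hc (Finset.notMem_empty c)⟩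
  | insert k T hk ih =>
    have hkD : k ∈ D := hT (Finset.mem_insert_self _ _)
    have hTD : T ⊆ D := (Finset.subset_insert _ _).trans hT
    obtain ⟨Φ, h1, h2⟩ := ih hTD
    have hck : ∀ c ∈ T, c ≠ k := fun c hc e => hk (e ▸ hc)
    have hU : ∀ c ∈ T, edgeStar v D c ⊆ ⋃ c ∈ T, edgeStar v D c := fun c hc =>
      Set.subset_biUnion_of_mem (u := fun c => edgeStar v D c) hc
    -- A functional `Θ` on the overlap of the new star with the old ones is sought with `Θ ∘ ∂ = Φ`.
    -- On cycles of the piece belonging to `c` it must be `Φ(vc ∧ ·) - f c k`, which is what the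
    -- prescribed value on `{v,c} - {v,k}` forces. On common cycles of two pieces these
    -- prescriptions agree by the cocycle condition.
    obtain ⟨Θ, h3, h4⟩ := exists_functional_biUnion T
      (fun c => edgeStar v D c ∩ edgeStar v D k)
      (fun c => (isLowerSet_edgeStar v D c).inter (isLowerSet_edgeStar v D k)) t
      (fun U hU hcard i hi => by
        have hkU : k ∉ U := fun h => hk (hU h)
        have hc := Finset.card_insert_of_notMem hkU
        rw [biInter_inter_eq k (Finset.card_pos.1 (by lia)), biInter_edgeStar hv (by lia)]
        refine isAcyclicAt_matchings i _ ?_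
        rw [Finset.card_sdiff_of_subset (Finset.insert_subset hkD (hU.trans hTD)), hc]
        lia) Φ (fun c => Φ ∘ₗ wedge F (edge v c) - f c k)
      (fun c hc x hx => by
        have hx1 := chainsOf_mono Set.inter_subset_left _ hx
        rw [edgeStar_inter hv (hck c hc)] at hx
        rw [LinearMap.sub_apply, LinearMap.comp_apply, hf c (hTD hc) k hkD (hck c hc) x hx,
          ← sub_eq_iff_eq_add'.2 (sub_eq_iff_eq_add.1 (bdry_wedge (edge v c) x).symm), map_sub,
          h1 _ (chainsOf_mono (hU c hc) _ (wedge_mem_edgeStar hx1)), sub_zero, sub_zero])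
      (fun c hc c' hc' hcc x hx h0 => by
        have hx1 : x ∈ chainsOf F (matchings (D \ {c, c'})) t := by
          rw [← edgeStar_inter hv hcc]
          exact chainsOf_mono (Set.inter_subset_inter Set.inter_subset_left
            Set.inter_subset_left) _ hx
        have hx2 : x ∈ chainsOf F (matchings (D \ {c, c', k})) t := by
          rw [← biInter_edgeStar hv ((Finset.card_pair hcc).ge.trans
            (Finset.card_le_card (by intro; simp; tauto)))]
          refine chainsOf_mono (fun σ hσ => ?_) _ hx
          simp only [Finset.mem_insert, Finset.mem_singleton, Set.mem_iInter]
          rintro _ (rfl | rfl | rfl)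
          exacts [hσ.1.1, hσ.2.1, hσ.1.2]
        have e1 := h2 c hc c' hc' hcc x hx1 h0
        have e2 := hcocycle c (hTD hc) c' (hTD hc') k hkD hcc (hck c hc) (hck c' hc') x hx2 h0
        rw [cherry_apply, map_sub] at e1
        simp only [LinearMap.sub_apply, LinearMap.comp_apply]
        linear_combination e1 + e2)
    let e := edge v k
    -- Write a chain of the new star as `e ∧ a + b` with `e` absent from `a` and `b`; the operator
    -- sends it to `a + ∂b`. On the overlap `a = 0`, so the result is `Θ(∂b) = Φ(b)`.
    obtain ⟨Φ', h5, h6⟩ := exists_functional_glue (⋃ c ∈ T, edgeStar v D c) (edgeStar v D k)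
      (t + 1) Φ (Θ ∘ₗ (contract F e + bdry F ∘ₗ contract F e ∘ₗ wedge F e)) (by
        intro σ hσ hσ' hd
        have hσ'' : σ ∈ ⋃ c ∈ T, edgeStar v D c ∩ edgeStar v D k := by
          rw [← Set.iUnion₂_inter]; exact ⟨hσ, hσ'⟩
        have heσ : e ∉ σ := by
          simp only [Set.mem_iUnion] at hσ''
          obtain ⟨c, hc, h⟩ := hσ''
          rw [edgeStar_inter hv (hck c hc)] at h
          exact edge_notMem h (by simp [hv]) _
        have hce : contract F e (Finsupp.single σ 1) = 0 := by simp [contract_single, heσ]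
        simp only [LinearMap.comp_apply, LinearMap.add_apply]
        rw [contract_wedge, if_pos rfl, hce, map_zero, sub_zero, zero_add,
          h3 _ (single_mem_chainsOf hσ'' hd 1)])
    -- In the same notation the boundary of `e ∧ a + b` is `-e ∧ ∂a + (a + ∂b)`, which the operator
    -- sends to `-∂a + ∂a = 0`.
    have hclosed : ∀ u, (Θ ∘ₗ (contract F e + bdry F ∘ₗ contract F e ∘ₗ wedge F e)) (bdry F u) =
        0 := by
      intro u
      have h7 : wedge F e (bdry F u) = u - bdry F (wedge F e u) := by rw [bdry_wedge]; abel
      simp only [LinearMap.comp_apply, LinearMap.add_apply]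
      rw [h7, map_sub, map_sub, bdry_contract e (bdry F (wedge F e u)), bdry_bdry, map_zero,
        neg_zero, sub_zero, bdry_contract e u, add_neg_cancel, map_zero]
    have hk' : ∀ c ∈ T, ∀ w ∈ chainsOf F (matchings (D \ {c, k})) t, bdry F w = 0 →
        Φ' (cherry F v c k w) = f c k w := by
      intro c hc w hw h0
      have hew : contract F e w = 0 := contract_eq_zero_of_notMem
        (fun σ hσ => edge_notMem hσ (by simp [hv]) _) hw
      have hΘ := h4 c hc w (by rw [edgeStar_inter hv (hck c hc)]; exact hw) h0
      rw [cherry_apply, map_sub,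
        h5 _ (chainsOf_mono (hU c hc) _ (wedge_mem_edgeStar (chainsOf_mono (hsub c k) _ hw))),
        h6 _ (wedge_mem_edgeStar (chainsOf_mono (hsub' c k) _ hw))]
      simp only [LinearMap.comp_apply, LinearMap.add_apply]
      rw [wedge_self, map_zero, map_zero, add_zero, contract_wedge, if_pos rfl, hew, map_zero,
        sub_zero, hΘ]
      simp only [LinearMap.sub_apply, LinearMap.comp_apply]
      ring
    refine ⟨Φ', fun u hu => ?_, fun c hc c' hc' hcc w hw h0 => ?_⟩
    · rw [biUnion_insert_eq, chainsOf_union] at hu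
      obtain ⟨u₁, hu₁, u₂, hu₂, rfl⟩ := Submodule.mem_sup.1 hu
      rw [map_add, map_add,
        h5 _ (bdry_mem_chainsOf (isLowerSet_biUnion (isLowerSet_edgeStar v D)) hu₁), h1 _ hu₁,
        h6 _ (bdry_mem_chainsOf (isLowerSet_edgeStar v D k) hu₂), hclosed, add_zero]
    · rcases Finset.mem_insert.1 hc with rfl | hc₁ <;>
        rcases Finset.mem_insert.1 hc' with rfl | hc₁'
      · exact absurd rfl hcc
      · rw [hanti _ hkD c' (hTD hc₁') hcc, LinearMap.neg_apply, ← hk' c' hc₁' w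
          (by rwa [Finset.pair_comm]) h0, cherry_apply, cherry_apply, ← map_neg]
        congr 1; abel
      · exact hk' c hc₁ w hw h0
      · rw [← h2 c hc₁ c' hc₁' hcc w hw h0, cherry_apply, map_sub, map_sub,
          h5 _ (chainsOf_mono (hU c hc₁) _ (wedge_mem_edgeStar (chainsOf_mono (hsub c c') _ hw))),
          h5 _ (chainsOf_mono (hU c' hc₁') _
            (wedge_mem_edgeStar (chainsOf_mono (hsub' c c') _ hw)))]

end Functional

/-! ### Values of a normalized functional on products and perfect matchings -/

section FunctionalValues

variable {F : Type*} [Field F]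

/-- This exchanges edges: if `e` and `f` are compatible with each other and with `x`, then `e ∧ x`
and `f ∧ x` are homologous. -/
theorem bdry_wedge_wedge {V R : Type*} [LinearOrder V] [CommRing R] {x : Finset V →₀ R}
    (h : bdry R x = 0) (e f : V) :
    bdry R (wedge R e (wedge R f x)) = wedge R f x - wedge R e x := by
  rw [bdry_wedge, bdry_wedge_of_cycle h]

/-- A functional on the first nonvanishing homology that is normalized on the products whose first
cherry is centred at `v` is normalized on all products of cherries. -/
theorem functional_cherryProduct {v : ℕ} {D : Finset ℕ} (hv : v ∉ D) {j : ℕ}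
    (hD : D.card = 3 * j + 3) {Φ : (Finset Edge →₀ F) →ₗ[F] F}
    (hΦ : ∀ u ∈ chainsOf F (⋃ c ∈ D, edgeStar v D c) (j + 2), Φ (bdry F u) = 0)
    (hc : ∀ x c c' m, (x :: v :: c :: c' :: m).Nodup →
      (x :: v :: c :: c' :: m).toFinset = insert v D →
      Φ (cherryProduct F (v :: c :: c' :: m)) = listSign F (x :: v :: c :: c' :: m))
    (x : ℕ) (l : List ℕ) (hnd : (x :: l).Nodup) (hl : (x :: l).toFinset = insert v D) :
    Φ (cherryProduct F l) = listSign F (x :: l) := by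
  have hlen : ∀ l : List ℕ, l.Nodup → l.toFinset = insert v D → l.length = 3 * j + 4 := by
    intro l h1 h2
    rw [← List.toFinset_card_of_nodup h1, h2, Finset.card_insert_of_notMem hv, hD]
  -- The chain `vy ∧ pq ∧ m` lies in the star of `vy`, so modulo boundaries the edge `pq` may be
  -- replaced by `vy`.
  have key : ∀ p q y m, (p :: q :: y :: m).Nodup → (∀ a ∈ p :: q :: y :: m, a ∈ D) →
      m.length = 3 * j → Φ (wedge F (edge p q) (cherryProduct F m)) =
        Φ (wedge F (edge v y) (cherryProduct F m)) := by
    intro p q y m h1 h2 h3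
    simp only [List.nodup_cons, List.mem_cons, not_or] at h1
    simp only [List.mem_cons, forall_eq_or_imp] at h2
    have hm : cherryProduct F m ∈ chainsOf F (matchings m.toFinset) j :=
      cherryProduct_mem h1.2.2.2 h3 fun x hx => List.mem_toFinset.2 hx
    have hpq : wedge F (edge p q) (cherryProduct F m) ∈ chainsOf F (edgeStar v D y) (j + 1) := by
      refine chainsOf_mono (K := matchings (D.erase y)) (fun σ hσ => mem_edgeStar_of_mem hσ) _
        (wedge_edge_mem (T := m.toFinset) (fun z hz => ?_) h1.1.1 ?_ ?_ ?_ ?_ hm)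
      · rw [List.mem_toFinset] at hz
        exact Finset.mem_erase.2 ⟨fun e => h1.2.2.1 (e ▸ hz), h2.2.2.2 z hz⟩
      · exact Finset.mem_erase.2 ⟨h1.1.2.1, h2.1⟩
      · exact Finset.mem_erase.2 ⟨h1.2.1.1, h2.2.1⟩
      · simp [h1.1.2.2]
      · simp [h1.2.1.2]
    have := hΦ _ (chainsOf_mono (Set.subset_biUnion_of_mem (u := fun c => edgeStar v D c)
      h2.2.2.1) _ (wedge_mem_edgeStar hpq))
    rw [bdry_wedge_wedge (bdry_cherryProduct m), map_sub] at this
    exact sub_eq_zero.1 this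
  -- If `v` is a leaf of the first cherry `{a,v} - {a,c}`, exchanging `{a,c}` for `{v,x}` gives
  -- `{v,a} - {v,x}`, which is centred at `v` and omits `c` instead of `x`.
  have hmid : ∀ x a c m, (x :: a :: v :: c :: m).Nodup →
      (x :: a :: v :: c :: m).toFinset = insert v D →
      Φ (cherryProduct F (a :: v :: c :: m)) = listSign F (x :: a :: v :: c :: m) := by
    intro x a c m h1 h2
    have h3 := hlen _ h1 h2
    have hmem : ∀ z, z ∈ (x :: a :: v :: c :: m) ↔ z ∈ insert v D := fun z => by
      rw [← h2, List.mem_toFinset]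
    have hp : (x :: a :: v :: c :: m).Perm (c :: v :: a :: x :: m) := by clear * -; grind
    have h4 := hc c a x m (hp.nodup_iff.1 h1) ((List.toFinset_eq_of_perm _ _ hp).symm.trans h2)
    simp only [List.nodup_cons, List.mem_cons, not_or] at h1
    have hmD : ∀ z ∈ a :: c :: x :: m, z ∈ D := by
      intro z hz
      refine Finset.mem_of_mem_insert_of_ne ((hmem z).1 (by clear * - hz; grind)) ?_
      rintro rfl
      clear * - hz h1
      grind
    have h5 := key a c x m (by simp only [List.nodup_cons, List.mem_cons, not_or]; tauto) hmD
      (by simp only [List.length_cons] at h3; lia)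
    rw [cherryProduct, cherry_apply, map_sub, h5, edge_comm, ← map_sub, ← cherry_apply,
      ← cherryProduct, h4]
    have s1 : listSign F (c :: v :: a :: x :: m) = _ := listSign_swap [] (Ne.symm h1.2.2.1.1) _
    have s2 : listSign F (v :: c :: a :: x :: m) = _ := listSign_swap [v] (Ne.symm h1.2.1.2.1) _
    have s3 : listSign F (v :: a :: c :: x :: m) = _ := listSign_swap [v, a] (Ne.symm h1.1.2.2.1) _
    have s4 : listSign F (v :: a :: x :: c :: m) = _ := listSign_swap [] (Ne.symm h1.2.1.1) _
    have s5 : listSign F (a :: v :: x :: c :: m) = _ := listSign_swap [a] (Ne.symm h1.1.2.1) _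
    have s6 : listSign F (a :: x :: v :: c :: m) = _ := listSign_swap [] (Ne.symm h1.1.1) _
    simp only [List.cons_append, List.nil_append] at s1 s2 s3 s4 s5 s6
    rw [s1, s2, s3, s4, s5, s6]
    simp
  have hhead : ∀ x a b c m, (v = a ∨ v = b ∨ v = c) → (x :: a :: b :: c :: m).Nodup →
      (x :: a :: b :: c :: m).toFinset = insert v D →
      Φ (cherryProduct F (a :: b :: c :: m)) = listSign F (x :: a :: b :: c :: m) := by
    rintro x a b c m (rfl | rfl | rfl) h1 h2
    · exact hc x b c m h1 h2
    · exact hmid x a c m h1 h2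
    · have hp : (x :: a :: b :: v :: m).Perm (x :: a :: v :: b :: m) := by clear * -; grind
      have h3 := hmid x a b m (hp.nodup_iff.1 h1) ((List.toFinset_eq_of_perm _ _ hp).symm.trans h2)
      simp only [List.nodup_cons, List.mem_cons, not_or] at h1
      have s1 : listSign F (x :: a :: b :: v :: m) = _ := listSign_swap [x, a] h1.2.2.1.1 _
      simp only [List.cons_append, List.nil_append] at s1
      rw [s1, ← h3, ← map_neg, cherryProduct, cherryProduct, cherry_apply, cherry_apply, neg_sub]
  -- When `v` is the omitted vertex, both edges of the first cherry `{a,b} - {a,c}` are exchanged,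
  -- giving `{v,c} - {v,b}` with `a` omitted.
  by_cases hx : x = v
  · subst hx
    match l, hlen _ hnd hl with
    | a :: b :: c :: m, h3 =>
      have hmem : ∀ z, z ∈ (x :: a :: b :: c :: m) ↔ z ∈ insert x D := fun z => by
        rw [← hl, List.mem_toFinset]
      have hmD : ∀ z ∈ a :: b :: c :: m, z ∈ D := by
        intro z hz
        refine Finset.mem_of_mem_insert_of_ne ((hmem z).1 (List.mem_cons_of_mem _ hz)) ?_
        rintro rfl
        exact (List.nodup_cons.1 hnd).1 hz
      have hp : (x :: a :: b :: c :: m).Perm (a :: x :: c :: b :: m) := by clear * -; grind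
      have h4 := hc a c b m (hp.nodup_iff.1 hnd) ((List.toFinset_eq_of_perm _ _ hp).symm.trans hl)
      have hm : m.length = 3 * j := by simp only [List.length_cons] at h3; lia
      have h5 := key a b c m (List.nodup_cons.1 hnd).2 hmD hm
      have hq : (a :: c :: b :: m).Perm (a :: b :: c :: m) := (List.Perm.swap b c m).cons a
      have h6 := key a c b m (hq.nodup_iff.2 (List.nodup_cons.1 hnd).2)
        (fun z hz => hmD z (hq.mem_iff.1 hz)) hm
      rw [cherryProduct, cherry_apply, map_sub, h5, h6, ← map_sub, ← cherry_apply,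
        ← cherryProduct, h4]
      simp only [List.nodup_cons, List.mem_cons, not_or] at hnd
      have s1 : listSign F (a :: x :: c :: b :: m) = _ := listSign_swap [] (Ne.symm hnd.1.1) _
      have s2 : listSign F (x :: a :: c :: b :: m) = _ :=
        listSign_swap [x, a] (Ne.symm hnd.2.2.1.1) _
      simp only [List.cons_append, List.nil_append] at s1 s2
      rw [s1, s2, neg_neg]
  · have hvl : v ∈ l := by
      have : v ∈ (x :: l).toFinset := by rw [hl]; exact Finset.mem_insert_self _ _
      rw [List.mem_toFinset, List.mem_cons] at this
      exact this.resolve_left (Ne.symm hx)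
    have hln := hlen _ hnd hl
    obtain ⟨a, b, c, m, ε, hp, hv', hP, hs⟩ := exists_center (F := F) l (j + 1)
      (by rw [List.length_cons] at hln; lia) (List.nodup_cons.1 hnd).2 hvl
    rw [hP, map_smul, listSign_cons_perm x hp hs, hhead x a b c m hv'
      ((hp.cons x).nodup_iff.1 hnd) ((List.toFinset_eq_of_perm _ _ (hp.cons x)).symm.trans hl),
      smul_eq_mul]

theorem card_biUnion_ends {S : Finset ℕ} {σ : Finset Edge} (hσ : σ ∈ matchings S) :
    (σ.biUnion ends).card = 2 * σ.card := by
  have h : ∀ e ∈ σ, (ends e).card = 2 := fun e he => Finset.card_pair (hσ.1 e he).1.ne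
  rw [Finset.card_biUnion fun e he f hf h => hσ.2 e he f hf h, Finset.sum_congr rfl h,
    Finset.sum_const, smul_eq_mul, mul_comm]

/-- A normalized functional vanishes on the boundary of a perfect matching of six vertices. -/
theorem functional_bdry_perfect_matching {v a b c d e f : ℕ}
    (hnd : [v, a, b, c, d, e, f].Nodup) {D : Finset ℕ} (hD : D = {a, b, c, d, e, f})
    {Φ : (Finset Edge →₀ F) →ₗ[F] F}
    (hΦ : ∀ u ∈ chainsOf F (⋃ c ∈ D, edgeStar v D c) 3, Φ (bdry F u) = 0)
    (hc : ∀ x l, (x :: l).Nodup → (x :: l).toFinset = insert v D →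
      Φ (cherryProduct F l) = listSign F (x :: l)) :
    Φ (bdry F (wedge F (edge a b) (wedge F (edge c d) (wedge F (edge e f)
      (Finsupp.single ∅ 1))))) = 0 := by
  have h0 : bdry F (Finsupp.single (∅ : Finset Edge) 1) = 0 := bdry_single_empty
  -- The boundary of `vx ∧ pq ∧ rs` lies in the star of `vx`. So the value on a pair of edges
  -- missing `v` is a difference of values on pairs containing an edge at `v`.
  have key : ∀ x p q r s y, [x, y, p, q, r, s].Perm [a, b, c, d, e, f] →
      Φ (wedge F (edge p q) (wedge F (edge r s) (Finsupp.single ∅ 1))) =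
        Φ (wedge F (edge v x) (wedge F (edge r s) (Finsupp.single ∅ 1))) -
        Φ (wedge F (edge v x) (wedge F (edge p q) (Finsupp.single ∅ 1))) := by
    intro x p q r s y hp
    have hn : [x, y, p, q, r, s].Nodup := hp.nodup_iff.2 (List.nodup_cons.1 hnd).2
    have hn' := hn
    simp only [List.nodup_cons, List.mem_cons, not_or, List.not_mem_nil, not_false_eq_true] at hn'
    have hm : ∀ z ∈ [x, y, p, q, r, s], z ∈ D := fun z hz => by
      rw [hD]; simpa using hp.mem_iff.1 hz
    have hE : ∀ z ∈ [p, q, r, s], z ∈ D.erase x := fun z hz =>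
      Finset.mem_erase.2 ⟨by clear * - hn hz; grind, hm z (by clear * - hz; grind)⟩
    have h1 : wedge F (edge p q) (wedge F (edge r s) (Finsupp.single ∅ 1)) ∈
        chainsOf F (edgeStar v D x) 2 := by
      refine chainsOf_mono (K := matchings (D.erase x)) (fun σ hσ => mem_edgeStar_of_mem hσ) _
        (wedge_edge_mem (T := {r, s}) (fun z hz => hE z (by simp at hz; simp; tauto)) hn'.2.2.1.1
          (hE p (by simp)) (hE q (by simp)) (by simp; tauto) (by simp; tauto)
          (wedge_edge_mem (T := ∅) (by simp) hn'.2.2.2.2.1.1 (by simp) (by simp) (by simp) (by simp)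
            (single_mem_chainsOf (empty_mem_matchings _) rfl 1)))
    have h2 := hΦ _ (chainsOf_mono (Set.subset_biUnion_of_mem (u := fun c => edgeStar v D c)
      (hm x (by simp))) _ (wedge_mem_edgeStar h1))
    rw [bdry_wedge, bdry_wedge_wedge h0, map_sub, map_sub, map_sub] at h2
    linear_combination h2
  have val : ∀ x l, [v, a, b, c, d, e, f].Perm (x :: l) →
      Φ (cherryProduct F l) = listSign F (x :: l) := fun x l hp =>
    hc x l (hp.nodup_iff.1 hnd) (by rw [← List.toFinset_eq_of_perm _ _ hp, hD]; simp)
  -- The three pairs of edges in the boundary are rewritten with edges at `v`. The four cherry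
  -- values below account for the resulting combination and their signs cancel exactly, without
  -- using characteristic 3.
  have e1 := key a c d e f b (by clear * -; grind)
  have e2 := key c a b e f d (by clear * -; grind)
  have e3 := key e a b c d f (by clear * -; grind)
  have v1 := val d [v, a, c, e, f, b] (by clear * -; grind)
  have v2 := val f [v, a, c, b, e, d] (by clear * -; grind)
  have v3 := val f [v, e, a, d, c, b] (by clear * -; grind)
  have v4 := val f [v, c, e, b, a, d] (by clear * -; grind)
  simp only [cherryProduct, cherry_apply, map_sub] at v1 v2 v3 v4
  rw [edge_comm b e] at v2
  rw [edge_comm d c, edge_comm d b] at v3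
  rw [edge_comm b a] at v4
  rw [bdry_wedge, bdry_wedge_wedge h0, map_sub, map_sub, map_sub, e1, e2, e3]
  simp only [List.nodup_cons, List.mem_cons, not_or, List.not_mem_nil, not_false_eq_true] at hnd
  have t1 : listSign F [d, v, a, c, e, f, b] = _ := listSign_swap [d, v, a, c] (by tauto) _
  have t2 : listSign F [d, v, a, c, f, e, b] = _ := listSign_swap [d, v, a] (by tauto) _
  have t3 : listSign F [d, v, a, f, c, e, b] = _ := listSign_swap [d, v] (by tauto) _
  have t4 : listSign F [d, v, f, a, c, e, b] = _ := listSign_swap [d] (by tauto) _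
  have t5 : listSign F [d, f, v, a, c, e, b] = _ := listSign_swap [] (by tauto) _
  have t6 : listSign F [f, d, v, a, c, e, b] = _ := listSign_swap [f] (by tauto) _
  have t7 : listSign F [f, v, d, a, c, e, b] = _ := listSign_swap [f, v] (by tauto) _
  have t8 : listSign F [f, v, a, d, c, e, b] = _ := listSign_swap [f, v, a] (by tauto) _
  have t9 : listSign F [f, v, a, c, d, e, b] = _ := listSign_swap [f, v, a, c] (by tauto) _
  have t10 : listSign F [f, v, a, c, e, d, b] = _ := listSign_swap [f, v, a, c, e] (by tauto) _
  have t11 : listSign F [f, v, a, c, e, b, d] = _ := listSign_swap [f, v, a, c] (by tauto) _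
  have r1 : listSign F [f, v, e, a, d, c, b] = _ := listSign_swap [f, v, e, a] (by tauto) _
  have r2 : listSign F [f, v, e, a, c, d, b] = _ := listSign_swap [f, v, e] (by tauto) _
  have r3 : listSign F [f, v, e, c, a, d, b] = _ := listSign_swap [f, v] (by tauto) _
  have r4 : listSign F [f, v, c, e, a, d, b] = _ := listSign_swap [f, v, c, e, a] (by tauto) _
  have r5 : listSign F [f, v, c, e, a, b, d] = _ := listSign_swap [f, v, c, e] (by tauto) _
  simp only [List.cons_append, List.nil_append] at t1 t2 t3 t4 t5 t6 t7 t8 t9 t10 t11 r1 r2 r3 r4 r5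
  rw [t1, t2, t3, t4, t5, t6, t7, t8, t9, t10, t11] at v1
  rw [r1, r2, r3, r4, r5] at v3
  linear_combination v1 + v2 + v3 + v4

end FunctionalValues

/-! ### The fundamental functional -/

section Fundamental

variable {F : Type*} [Field F]

theorem listSign_cons₃_perm {l l' : List ℕ} (h : l.Perm l') (a b c : ℕ) :
    listSign F (a :: b :: c :: l) =
      listSign F (a :: b :: c :: l') * listSign F l' * listSign F l := by
  have h1 : listSign F l = listSign F l * listSign F l' * listSign F l' := by
    rw [mul_assoc, listSign_mul_self, mul_one]
  rw [listSign_cons_perm a ((h.cons c).cons b)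
    (listSign_cons_perm b (h.cons c) (listSign_cons_perm c h h1))]
  ring

/-- A functional on the homology of the matching complex on `3 * j + 1` vertices that is
normalized on products of cherries. -/
def IsFundamental (j : ℕ) (S : Finset ℕ) (Φ : (Finset Edge →₀ F) →ₗ[F] F) : Prop :=
  (∀ u ∈ chainsOf F (matchings S) (j + 1), Φ (bdry F u) = 0) ∧
    ∀ x l, (x :: l).Nodup → (x :: l).toFinset = S → Φ (cherryProduct F l) = listSign F (x :: l)

/-- The pairwise functionals are the fundamental functionals on `3j+1` vertices, rescaled so that
their values become signs of lists on all vertices. Characteristic 3 is exactly what makes them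
satisfy the cocycle condition. -/
theorem exists_isFundamental_edgeStars (h3 : (3 : F) = 0) {v : ℕ} {D : Finset ℕ} (hv : v ∉ D)
    {j : ℕ} (hD : D.card = 3 * j + 3) (G : Finset ℕ → (Finset Edge →₀ F) →ₗ[F] F)
    (hG : ∀ S : Finset ℕ, S.card = 3 * j + 1 → IsFundamental j S (G S)) :
    ∃ Φ : (Finset Edge →₀ F) →ₗ[F] F,
      (∀ u ∈ chainsOf F (⋃ c ∈ D, edgeStar v D c) (j + 2), Φ (bdry F u) = 0) ∧
      ∀ x l, (x :: l).Nodup → (x :: l).toFinset = insert v D →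
        Φ (cherryProduct F l) = listSign F (x :: l) := by
  -- The ratio of the signs of `v, c, c', l` and of `l`, which depends only on the set of entries of
  -- `l`. It is used as `-κ` below because moving the omitted vertex past `v, c, c'` costs three
  -- transpositions.
  set κ : ℕ → ℕ → F := fun c c' => listSign F (v :: c :: c' :: (D \ {c, c'}).sort (· ≤ ·)) *
    listSign F ((D \ {c, c'}).sort (· ≤ ·)) with hκ
  have kap : ∀ c c' l, l.Nodup → l.toFinset = D \ {c, c'} →
      listSign F (v :: c :: c' :: l) = κ c c' * listSign F l := by
    intro c c' l h1 h2
    refine listSign_cons₃_perm ?_ v c c'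
    rw [List.perm_ext_iff_of_nodup h1 (Finset.sort_nodup _ _)]
    intro a
    rw [← List.mem_toFinset, h2, Finset.mem_sort]
  have hne : ∀ c ∈ D, v ≠ c := fun c hc e => hv (e ▸ hc)
  have hcard : ∀ c ∈ D, ∀ c' ∈ D, c ≠ c' → (D \ {c, c'}).card = 3 * j + 1 := by
    intro c hc c' hc' h
    rw [Finset.card_sdiff_of_subset (by simp [Finset.insert_subset_iff, hc, hc']),
      Finset.card_pair h, hD]
    lia
  have hval : ∀ c ∈ D, ∀ c' ∈ D, c ≠ c' → ∀ x l, (x :: l).Nodup →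
      (x :: l).toFinset = D \ {c, c'} →
      (-κ c c' • G (D \ {c, c'})) (cherryProduct F l) = -listSign F (v :: c :: c' :: x :: l) := by
    intro c hc c' hc' h x l h1 h2
    rw [LinearMap.smul_apply, (hG _ (hcard c hc c' hc' h)).2 x l h1 h2, kap c c' _ h1 h2,
      smul_eq_mul, neg_mul]
  obtain ⟨Φ, hΦ, hf⟩ := exists_functional_edgeStars (F := F) hv hD
    (fun c c' => -κ c c' • G (D \ {c, c'}))
    (fun c hc c' hc' h u hu => by
      rw [LinearMap.smul_apply, (hG _ (hcard c hc c' hc' h)).1 u hu, smul_zero])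
    (fun c hc c' hc' h => by
      have : κ c c' = -κ c' c := by
        have h4 := listSign_swap (F := F) [v] h ((D \ {c, c'}).sort (· ≤ ·))
        simp only [List.cons_append, List.nil_append] at h4
        rw [hκ]
        simp only
        rw [h4, Finset.pair_comm c' c, neg_mul]
      refine LinearMap.ext fun w => ?_
      rw [this, Finset.pair_comm c' c, LinearMap.neg_apply, LinearMap.smul_apply,
        LinearMap.smul_apply, neg_neg, neg_smul, neg_neg])
    (fun c hc c' hc' c'' hc'' h h' h'' w hw h0 => by
      have hS : (D \ {c, c', c''}).card = 3 * j := by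
        rw [Finset.card_sdiff_of_subset (by simp [Finset.insert_subset_iff, hc, hc', hc'']), hD,
          Finset.card_eq_three.2 ⟨c, c', c'', h, h', h'', rfl⟩]
        lia
      -- The cocycle condition on a triple intersection, which has `3j` vertices. By
      -- `cycle_mem_cherrySpan` boundaries and products of cherries suffice; boundaries give zero
      -- term by term.
      have hle : cherrySpan F (D \ {c, c', c''}) j ≤ LinearMap.ker
          (-κ c c' • G (D \ {c, c'}) - -κ c c'' • G (D \ {c, c''}) +
            -κ c' c'' • G (D \ {c', c''})) := by
        rw [cherrySpan, sup_le_iff, Submodule.span_le]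
        constructor
        · rintro _ ⟨u, hu, rfl⟩
          have hk : ∀ a ∈ D, ∀ b ∈ D, a ≠ b → ({a, b} : Finset ℕ) ⊆ {c, c', c''} →
              G (D \ {a, b}) (bdry F u) = 0 := fun a ha b hb hab hs =>
            (hG _ (hcard a ha b hb hab)).1 u
              (chainsOf_mono (matchings_mono (Finset.sdiff_subset_sdiff subset_rfl hs)) _ hu)
          simp [hk c hc c' hc' h (by grind), hk c hc c'' hc'' h' (by grind),
            hk c' hc' c'' hc'' h'' (by grind)]
        · rintro _ ⟨l, h1, h2, rfl⟩
          have hl : ∀ a, a ∈ l ↔ a ∈ D ∧ ¬ (a = c ∨ a = c' ∨ a = c'') := fun a => by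
            rw [← List.mem_toFinset, h2]; simp
          have e1 := hval c hc c' hc' h c'' l (by rw [List.nodup_cons, hl]; simp [h1])
            (by ext a; simp only [List.mem_toFinset, List.mem_cons, hl, Finset.mem_sdiff,
              Finset.mem_insert, Finset.mem_singleton]; clear * - hc'' h' h''; grind)
          have e2 := hval c hc c'' hc'' h' c' l (by rw [List.nodup_cons, hl]; simp [h1])
            (by ext a; simp only [List.mem_toFinset, List.mem_cons, hl, Finset.mem_sdiff,
              Finset.mem_insert, Finset.mem_singleton]; clear * - hc' h h''; grind)
          have e3 := hval c' hc' c'' hc'' h'' c l (by rw [List.nodup_cons, hl]; simp [h1])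
            (by ext a; simp only [List.mem_toFinset, List.mem_cons, hl, Finset.mem_sdiff,
              Finset.mem_insert, Finset.mem_singleton]; clear * - hc h h'; grind)
          have s1 : listSign F (v :: c :: c'' :: c' :: l) = _ := listSign_swap [v, c] h''.symm _
          have s2 : listSign F (v :: c' :: c'' :: c :: l) = _ := listSign_swap [v, c'] h'.symm _
          have s3 : listSign F (v :: c' :: c :: c'' :: l) = _ := listSign_swap [v] h.symm _
          simp only [List.cons_append, List.nil_append] at s1 s2 s3
          rw [SetLike.mem_coe, LinearMap.mem_ker, LinearMap.add_apply, LinearMap.sub_apply, e1, e2,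
            e3, s1, s2, s3]
          -- After reordering, the three terms are the same sign, so their sum is a multiple of 3.
          linear_combination (-listSign F (v :: c :: c' :: c'' :: l)) * h3
      exact hle (cycle_mem_cherrySpan j _ hS hw h0)) D subset_rfl
  refine ⟨Φ, hΦ, functional_cherryProduct hv hD hΦ fun x c c' m h1 h2 => ?_⟩
  have h1' := h1
  simp only [List.nodup_cons, List.mem_cons, not_or] at h1'
  have hmem : ∀ z, z ∈ (x :: v :: c :: c' :: m) ↔ z ∈ insert v D := fun z => by
    rw [← h2, List.mem_toFinset]
  have hD' : ∀ z, z ∈ D ↔ z = x ∨ z = c ∨ z = c' ∨ z ∈ m := by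
    intro z
    have := hmem z
    simp only [List.mem_cons, Finset.mem_insert] at this
    by_cases hz : z = v
    · subst hz
      simp only [hv, false_iff, not_or]
      exact ⟨Ne.symm h1'.1.1, h1'.2.1.1, h1'.2.1.2.1, h1'.2.1.2.2⟩
    · simp only [hz, false_or] at this
      exact this.symm
  have hcD : c ∈ D := by rw [hD']; simp
  have hcD' : c' ∈ D := by rw [hD']; simp
  have hU : (x :: m).toFinset = D \ {c, c'} := by
    ext z
    simp only [List.mem_toFinset, List.mem_cons, Finset.mem_sdiff, hD', Finset.mem_insert,
      Finset.mem_singleton]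
    clear * - h1'
    grind
  have hlen : m.length = 3 * j := by
    have := List.toFinset_card_of_nodup (l := x :: m) (by simp only [List.nodup_cons]; tauto)
    rw [hU, hcard c hcD c' hcD' h1'.2.2.1.1, List.length_cons] at this
    lia
  rw [cherryProduct, hf c hcD c' hcD' h1'.2.2.1.1 _ (cherryProduct_mem h1'.2.2.2.2 hlen
      fun z hz => by rw [← hU]; simp [hz]) (bdry_cherryProduct m),
    hval c hcD c' hcD' h1'.2.2.1.1 x m (by simp only [List.nodup_cons]; tauto) hU,
    listSign_rotate (Ne.symm h1'.1.1) (Ne.symm h1'.1.2.1) (Ne.symm h1'.1.2.2.1), neg_neg]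

theorem single_eq_smul_wedge₃ {σ : Finset Edge} {S : Finset ℕ} (hσ : σ ∈ matchings S)
    (h : σ.card = 3) : ∃ a b c d e f : ℕ, ∃ ε : F, [a, b, c, d, e, f].Nodup ∧
      σ.biUnion ends = {a, b, c, d, e, f} ∧ Finsupp.single σ 1 = ε • wedge F (edge a b)
        (wedge F (edge c d) (wedge F (edge e f) (Finsupp.single ∅ 1))) := by
  obtain ⟨e₁, e₂, e₃, h12, h13, h23, rfl⟩ := Finset.card_eq_three.1 h
  have hlt : ∀ e ∈ ({e₁, e₂, e₃} : Finset Edge), (ofLex e).1 < (ofLex e).2 :=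
    fun e he => (hσ.1 e he).1
  have hed : ∀ e ∈ ({e₁, e₂, e₃} : Finset Edge), edge (ofLex e).1 (ofLex e).2 = e := fun e he => by
    unfold edge; rw [if_pos (hlt e he)]; rfl
  have d12 := hσ.2 e₁ (by simp) e₂ (by simp) h12
  have d13 := hσ.2 e₁ (by simp) e₃ (by simp) h13
  have d23 := hσ.2 e₂ (by simp) e₃ (by simp) h23
  have l1 := (hlt e₁ (by simp)).ne
  have l2 := (hlt e₂ (by simp)).ne
  have l3 := (hlt e₃ (by simp)).ne
  refine ⟨(ofLex e₁).1, (ofLex e₁).2, (ofLex e₂).1, (ofLex e₂).2, (ofLex e₃).1, (ofLex e₃).2,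
    faceSign F e₁ {e₁, e₂, e₃} * faceSign F e₂ {e₂, e₃} * faceSign F e₃ {e₃}, ?_, ?_, ?_⟩
  · simp only [ends, Finset.disjoint_insert_left, Finset.disjoint_singleton_left,
      Finset.mem_insert, Finset.mem_singleton, not_or] at d12 d13 d23
    simp only [List.nodup_cons, List.mem_cons, not_or, List.not_mem_nil, not_false_eq_true]
    tauto
  · simp only [Finset.biUnion_insert, Finset.singleton_biUnion, ends]
    ext z; simp; tauto
  · rw [hed e₁ (by simp), hed e₂ (by simp), hed e₃ (by simp), single_eq_wedge (v := e₁) (by simp),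
      Finset.erase_insert (by simp [h12, h13]), single_eq_wedge (σ := {e₂, e₃}) (v := e₂) (by simp),
      Finset.erase_insert (by simp [h23]), single_eq_wedge (σ := {e₃}) (v := e₃) (by simp),
      Finset.erase_singleton]
    simp only [map_smul, smul_smul, mul_assoc]

/-- With the stars handled, what remains is a perfect matching of `D`. Its `j + 2` edges would cover
exactly `3j + 3` vertices, which forces `j = 1`. -/
theorem exists_isFundamental (h3 : (3 : F) = 0) (j : ℕ) (S : Finset ℕ) (hS : S.card = 3 * j + 1) :
    ∃ Φ : (Finset Edge →₀ F) →ₗ[F] F, IsFundamental j S Φ := by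
  induction j generalizing S with
  | zero =>
    obtain ⟨x, rfl⟩ := Finset.card_eq_one.1 hS
    -- A single vertex carries no edge, so the coefficient of the empty matching kills all
    -- boundaries for lack of one-edge matchings.
    refine ⟨Finsupp.lapply ∅, fun u hu => ?_, fun y l hnd hl => ?_⟩
    · refine eqOn_chainsOf (f := (Finsupp.lapply ∅).comp (bdry F)) (g := 0) (fun σ hσ h1 => ?_) hu
      obtain ⟨e, rfl⟩ := Finset.card_eq_one.1 h1
      have := card_biUnion_ends hσ
      have h2 : (({e} : Finset Edge).biUnion ends).card ≤ 1 :=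
        Finset.card_le_card (Finset.biUnion_subset.2 fun f hf => (hσ.1 f hf).2)
      rw [h1] at this
      lia
    · have : l = [] := by
        have h4 := List.toFinset_card_of_nodup hnd
        rw [hl] at h4
        exact List.length_eq_zero_iff.1 (by simpa using h4.symm)
      subst this
      simp [cherryProduct, listSign]
  | succ j ih =>
    obtain ⟨v, hvS⟩ := Finset.card_pos.1 (by lia : 0 < S.card)
    obtain ⟨D, hv, rfl⟩ : ∃ D, v ∉ D ∧ S = insert v D :=
      ⟨S.erase v, Finset.notMem_erase v S, (Finset.insert_erase hvS).symm⟩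
    have hD : D.card = 3 * j + 3 := by
      rw [Finset.card_insert_of_notMem hv] at hS; lia
    have hG : ∀ S : Finset ℕ, ∃ Φ : (Finset Edge →₀ F) →ₗ[F] F,
        S.card = 3 * j + 1 → IsFundamental j S Φ := fun S => by
      by_cases h : S.card = 3 * j + 1
      · obtain ⟨Φ, hΦ⟩ := ih S h
        exact ⟨Φ, fun _ => hΦ⟩
      · exact ⟨0, fun h' => absurd h' h⟩
    choose G hG using hG
    obtain ⟨Φ, hΦ, hc⟩ := exists_isFundamental_edgeStars h3 hv hD G hG
    refine ⟨Φ, fun u hu => ?_, hc⟩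
    refine eqOn_chainsOf (f := Φ.comp (bdry F)) (g := 0) (fun σ hσ hd => ?_) hu
    rw [LinearMap.comp_apply, LinearMap.zero_apply]
    rcases mem_edgeStar_or hσ with ⟨c, hcD, h⟩ | ⟨h, hsub⟩
    · exact hΦ _ (single_mem_chainsOf (Set.mem_biUnion (t := fun c => edgeStar v D c) hcD h) hd 1)
    · have h1 := card_biUnion_ends h
      have h2 : σ.biUnion ends = D :=
        (Finset.biUnion_subset.2 fun e he => (h.1 e he).2).antisymm hsub
      rw [h2, hD, hd] at h1
      obtain rfl : j = 1 := by lia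
      obtain ⟨a, b, c, d, e, f, ε, hnd, hU, hs⟩ := single_eq_smul_wedge₃ (F := F) h hd
      rw [hs, map_smul, map_smul, functional_bdry_perfect_matching (v := v) ?_ (h2.symm.trans hU)
        hΦ hc, smul_zero]
      rw [List.nodup_cons]
      refine ⟨fun hv' => hv ?_, hnd⟩
      rw [← h2, hU]
      simpa using hv'

end Fundamental

/-! ### Rook complexes inside matching complexes -/

section Chessboard

/-- A position of the `n × n` board as the edge that joins its row `i` and its column `n + j`. -/
def rookEdge (n : ℕ) : Position n n ↪o Edge :=
  OrderEmbedding.ofStrictMono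
    (fun p => toLex (((ofLex p).1 : ℕ), n + ((ofLex p).2 : ℕ))) fun p q h => by
      rw [Prod.Lex.lt_iff] at h ⊢
      rcases h with h | ⟨h, h'⟩
      · exact Or.inl h
      · exact Or.inr ⟨congrArg Fin.val h, Nat.add_lt_add_left h' n⟩

theorem rookEdge_eq_edge {n : ℕ} (p : Position n n) :
    rookEdge n p = edge ((ofLex p).1 : ℕ) (n + ((ofLex p).2 : ℕ)) := by
  unfold edge
  rw [if_pos (by have := (ofLex p).1.2; lia)]
  rfl

theorem ends_rookEdge {n : ℕ} (p : Position n n) :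
    ends (rookEdge n p) = {((ofLex p).1 : ℕ), n + ((ofLex p).2 : ℕ)} := rfl

/-- Sharing a row or a column is sharing an endpoint. This embeds the rook complex of every board in
the one matching complex on `2n` vertices. -/
theorem map_rookEdge_mem_iff {n : ℕ} (A : Set (Position n n)) (σ : Finset (Position n n)) :
    (σ.map (rookEdge n).toEmbedding ∈ matchings (Finset.range (2 * n)) ∧ ∀ p ∈ σ, p ∈ A) ↔
      σ ∈ (rookComplex A).faces ∨ σ = ∅ := by
  have hd : ∀ p q : Position n n, Disjoint (ends (rookEdge n p)) (ends (rookEdge n q)) ↔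
      p.row ≠ q.row ∧ p.col ≠ q.col := by
    intro p q
    have h1 := (ofLex p).1.2
    have h2 := (ofLex q).1.2
    simp only [ends_rookEdge, Finset.disjoint_insert_left, Finset.disjoint_singleton_left,
      Finset.mem_insert, Finset.mem_singleton, Position.row, Position.col]
    lia
  have hm : σ.map (rookEdge n).toEmbedding ∈ matchings (Finset.range (2 * n)) ↔
      ∀ p ∈ σ, ∀ q ∈ σ, p ≠ q → p.row ≠ q.row ∧ p.col ≠ q.col := by
    simp only [matchings, Set.mem_ofPred_eq, Finset.forall_mem_map, RelEmbedding.coe_toEmbedding,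
      ne_eq, EmbeddingLike.apply_eq_iff_eq, hd]
    refine and_iff_right fun p hp => ⟨?_, ?_⟩
    · change ((ofLex p).1 : ℕ) < n + ((ofLex p).2 : ℕ)
      have h1 := (ofLex p).1.2
      lia
    · have h1 := (ofLex p).1.2
      have h2 := (ofLex p).2.2
      rw [ends_rookEdge, Finset.insert_subset_iff, Finset.singleton_subset_iff, Finset.mem_range,
        Finset.mem_range]
      lia
  rw [hm]
  rcases σ.eq_empty_or_nonempty with rfl | hne
  · simp
  · simp only [hne.ne_empty, or_false]
    exact ⟨fun h => ⟨hne, h.2, h.1⟩, fun h => ⟨h.2.2, h.2.1⟩⟩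

theorem chainMap_injective {V W : Type*} [LinearOrder V] [LinearOrder W] (f : V ↪o W) :
    Function.Injective (chainMap ℤ f) := by
  have : (chainMap ℤ f : (Finset V →₀ ℤ) → (Finset W →₀ ℤ)) =
      Finsupp.mapDomain (Finset.map f.toEmbedding) := by
    ext1 x
    induction x using Finsupp.induction_linear with
    | zero => simp
    | add x y hx hy => rw [map_add, Finsupp.mapDomain_add, hx, hy]
    | single σ a => simp [chainMap, Finsupp.mapDomain_single]
  rw [this]
  exact Finsupp.mapDomain_injective (Finset.map_injective _)

/-- With the identity on vertices, `chainMap` is reduction of coefficients. Embedding the board and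
then reducing can be done in one map. -/
theorem chainMap_refl_chainMap {V W A : Type*} [LinearOrder V] [LinearOrder W] [CommRing A]
    (f : V ↪o W) (x : Finset V →₀ ℤ) :
    chainMap A (RelEmbedding.refl (· ≤ ·)) (chainMap ℤ f x) = chainMap A f x := by
  induction x using Finsupp.induction_linear with
  | zero => simp
  | add x y hx hy => simp only [map_add, hx, hy]
  | single σ a =>
    rw [single_eq_smul, map_smul, map_smul, map_smul, chainMap_single, chainMap_single,
      chainMap_single]
    congr
    ext; simp

theorem chainMap_refl_cherryProduct (A : Type*) [CommRing A] (l : List ℕ) :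
    chainMap A (RelEmbedding.refl (· ≤ ·)) (cherryProduct ℤ l) = cherryProduct A l := by
  induction l using cherryProduct.induct with
  | case1 a b c l ih =>
    rw [cherryProduct, cherry_apply, map_sub, chainMap_wedge, chainMap_wedge, ih, cherryProduct,
      cherry_apply]
    rfl
  | case2 l h => rw [cherryProduct, cherryProduct, chainMap_single]; exacts [rfl, h, h]

theorem PreAbstractSimplicialComplex.chains_eq_chainsOf {V : Type*}
    (K : PreAbstractSimplicialComplex V) (d : ℕ) :
    K.chains ((d : ℤ) - 1) = chainsOf ℤ {σ | σ ∈ K.faces ∨ σ = ∅} d := by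
  unfold PreAbstractSimplicialComplex.chains chainsOf
  congr 1
  ext σ
  simp

/-- An integral cycle that is detected by a functional modulo `3` on the matching complex of all
rows and columns of the board is not a boundary on any board. -/
theorem exists_cycle_of_functional {n d : ℕ} (hd : (2 * n + 1) / 3 = d) {B : Set (Position n n)}
    {y : Finset Edge →₀ ℤ} (hy : y ∈ chainsOf ℤ (matchings (Finset.range (2 * n))) d)
    (hB : y ∈ chainsOf ℤ {σ | ∀ e ∈ σ, e ∈ rookEdge n '' B} d) (h0 : bdry ℤ y = 0)
    {Φ : (Finset Edge →₀ ZMod 3) →ₗ[ZMod 3] ZMod 3}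
    (hΦ : ∀ u ∈ chainsOf (ZMod 3) (matchings (Finset.range (2 * n))) (d + 1),
      Φ (bdry (ZMod 3) u) = 0)
    (hne : Φ (chainMap (ZMod 3) (RelEmbedding.refl (· ≤ ·)) y) ≠ 0) :
    ∃ z ∈ (rookComplex B).cycles (nu (2 * n)),
      ∀ A, z ∉ (rookComplex A).boundaries (nu (2 * n)) := by
  have hnu : nu (2 * n) = (d : ℤ) - 1 := by rw [nu, hd]
  have hz : y ∈ ((rookComplex B).chains (nu (2 * n))).map (chainMap ℤ (rookEdge n)) := by
    rw [hnu, PreAbstractSimplicialComplex.chains_eq_chainsOf]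
    refine chainsOf_le (fun τ hτ hτd => ?_) ((chainsOf_inter (F := ℤ) _ _ d).ge ⟨hy, hB⟩)
    obtain ⟨σ, hσ, rfl⟩ := Finset.subset_set_image_iff.1 (fun e he => hτ.2 e he)
    rw [← RelEmbedding.coe_toEmbedding, ← Finset.map_eq_image] at hτd hτ ⊢
    rw [Finset.card_map] at hτd
    exact ⟨Finsupp.single σ 1, single_mem_chainsOf ((map_rookEdge_mem_iff B σ).1
      ⟨hτ.1, fun p hp => hσ hp⟩) hτd 1, chainMap_single _ _⟩
  obtain ⟨z, hz, rfl⟩ := hz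
  refine ⟨z, ⟨hz, ?_⟩, ?_⟩
  · rw [SetLike.mem_coe, LinearMap.mem_ker, ← bdry_int]
    refine chainMap_injective (rookEdge n) ?_
    rw [chainMap_bdry, h0, map_zero]
  · rintro A ⟨u, hu, rfl⟩
    refine hne ?_
    rw [chainMap_refl_chainMap, ← bdry_int, chainMap_bdry]
    refine hΦ _ ?_
    rw [hnu, show (d : ℤ) - 1 + 1 = ((d + 1 : ℕ) : ℤ) - 1 by push_cast; ring, SetLike.mem_coe,
      PreAbstractSimplicialComplex.chains_eq_chainsOf] at hu
    have : ∀ u ∈ chainsOf ℤ {σ | σ ∈ (rookComplex A).faces ∨ σ = ∅} (d + 1),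
        u ∈ ((chainsOf (ZMod 3) (matchings (Finset.range (2 * n))) (d + 1)).restrictScalars
          ℤ).comap (chainMap (ZMod 3) (rookEdge n)) := by
      refine fun u hu => chainsOf_le (fun σ hσ hσd => ?_) hu
      rw [Submodule.mem_comap, chainMap_single]
      exact single_mem_chainsOf ((map_rookEdge_mem_iff A σ).2 hσ).1 (by rw [Finset.card_map, hσd]) 1
    exact this u hu

theorem wedge_mem_chainsOf_edges {R : Type*} [CommRing R] {E : Set Edge} {e : Edge} (he : e ∈ E)
    {d : ℕ} {x : Finset Edge →₀ R} (hx : x ∈ chainsOf R {σ | ∀ e ∈ σ, e ∈ E} d) :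
    wedge R e x ∈ chainsOf R {σ | ∀ e ∈ σ, e ∈ E} (d + 1) :=
  wedge_mem_chainsOf (fun σ hσ _ f hf => by
    rcases Finset.mem_insert.1 hf with rfl | hf
    exacts [he, hσ f hf]) hx

theorem cherry_mem_chainsOf_edges {R : Type*} [CommRing R] {E : Set Edge} {a b c : ℕ}
    (hb : edge a b ∈ E) (hc : edge a c ∈ E) {d : ℕ} {x : Finset Edge →₀ R}
    (hx : x ∈ chainsOf R {σ | ∀ e ∈ σ, e ∈ E} d) :
    cherry R a b c x ∈ chainsOf R {σ | ∀ e ∈ σ, e ∈ E} (d + 1) :=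
  sub_mem (wedge_mem_chainsOf_edges hb hx) (wedge_mem_chainsOf_edges hc hx)

/-- A product of cherries over the first `m` diagonal `3 × 3` blocks. -/
theorem exists_blocks (n m : ℕ) (hm : 3 * m ≤ n) (E : Set Edge)
    (hE : ∀ i < m, ∃ a b c d e f,
      [a, b, c, d, e, f].Perm [3 * i, 3 * i + 1, 3 * i + 2, n + 3 * i, n + (3 * i + 1),
        n + (3 * i + 2)] ∧ edge a b ∈ E ∧ edge a c ∈ E ∧ edge d e ∈ E ∧ edge d f ∈ E) :
    ∃ l : List ℕ, l.Nodup ∧ l.length = 6 * m ∧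
      (∀ x, x ∈ l ↔ x < 3 * m ∨ n ≤ x ∧ x < n + 3 * m) ∧
      cherryProduct ℤ l ∈ chainsOf ℤ {σ | ∀ e ∈ σ, e ∈ E} (2 * m) := by
  induction m with
  | zero =>
    refine ⟨[], List.nodup_nil, rfl, fun x => by simp, ?_⟩
    rw [cherryProduct]
    · exact single_mem_chainsOf (by simp) rfl 1
    · simp
  | succ m ih =>
    obtain ⟨l, h1, h2, h3, h4⟩ := ih (by lia) fun i hi => hE i (by lia)
    obtain ⟨a, b, c, d, e, f, hp, hb, hc, he, hf⟩ := hE m (by lia)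
    have hmem : ∀ x, x ∈ [a, b, c, d, e, f] ↔ 3 * m ≤ x ∧ x < 3 * m + 3 ∨
        n + 3 * m ≤ x ∧ x < n + 3 * m + 3 := by
      intro x
      rw [hp.mem_iff]
      simp only [List.mem_cons, List.not_mem_nil, or_false]
      lia
    refine ⟨[a, b, c, d, e, f] ++ l, ?_, ?_, ?_, ?_⟩
    · rw [List.nodup_append']
      refine ⟨hp.nodup_iff.2 ?_, h1, ?_⟩
      · simp only [List.nodup_cons, List.mem_cons, not_or, List.not_mem_nil, not_false_eq_true,
          List.nodup_nil, and_true]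
        clear * - hm
        lia
      · intro x hx hx'
        rw [hmem] at hx
        rw [h3] at hx'
        lia
    · rw [List.length_append, h2]; simp; lia
    · intro x
      rw [List.mem_append, hmem, h3]
      lia
    · exact cherry_mem_chainsOf_edges hb hc (cherry_mem_chainsOf_edges he hf h4)

/-- The list misses exactly one vertex of `S`, so the value is a sign. -/
theorem IsFundamental.cherryProduct_ne_zero {F : Type*} [Field F] {d : ℕ} {S : Finset ℕ}
    {Φ : (Finset Edge →₀ F) →ₗ[F] F} (hΦ : IsFundamental d S Φ) (hS : S.card = 3 * d + 1)
    {l : List ℕ} (hl : l.Nodup) (hd : l.length = 3 * d) (h : ∀ x ∈ l, x ∈ S) :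
    Φ (cherryProduct F l) ≠ 0 := by
  have hlS : l.toFinset ⊆ S := fun x hx => h x (List.mem_toFinset.1 hx)
  have hc := List.toFinset_card_of_nodup hl
  obtain ⟨x, hx, hx'⟩ := Finset.exists_mem_notMem_of_card_lt_card (s := l.toFinset) (t := S)
    (by lia)
  rw [hΦ.2 x l (List.nodup_cons.2 ⟨fun h => hx' (List.mem_toFinset.2 h), hl⟩)]
  · exact listSign_ne_zero _
  · rw [List.toFinset_cons]
    refine Finset.eq_of_subset_of_card_le (Finset.insert_subset hx hlS) ?_
    rw [Finset.card_insert_of_notMem hx']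
    lia

theorem exists_cycle_of_cherryProduct {n d : ℕ} (hd : (2 * n + 1) / 3 = d)
    {B : Set (Position n n)} {l : List ℕ} (hl : l.Nodup) (hld : l.length = 3 * d)
    (hln : ∀ x ∈ l, x < 2 * n)
    (hB : cherryProduct ℤ l ∈ chainsOf ℤ {σ | ∀ e ∈ σ, e ∈ rookEdge n '' B} d) :
    ∃ z ∈ (rookComplex B).cycles (nu (2 * n)),
      ∀ A, z ∉ (rookComplex A).boundaries (nu (2 * n)) := by
  have : Fact (Nat.Prime 3) := ⟨Nat.prime_three⟩
  obtain ⟨Φ, hΦ⟩ := exists_isFundamental (F := ZMod 3) rfl d (Finset.range (3 * d + 1))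
    (Finset.card_range _)
  refine exists_cycle_of_functional hd
    (cherryProduct_mem hl hld fun x hx => Finset.mem_range.2 (hln x hx)) hB
    -- Since `2n ≤ 3d + 1`, the vertices of the graph embed in those of `Φ`; for `3d = 2n` an
    -- auxiliary vertex is the omitted one.
    (bdry_cherryProduct l) (Φ := Φ) (fun u hu => hΦ.1 u (chainsOf_mono (matchings_mono
      (Finset.range_mono (by lia))) _ hu)) ?_
  rw [chainMap_refl_cherryProduct]
  exact hΦ.cherryProduct_ne_zero (Finset.card_range _) hl hld fun x hx => Finset.mem_range.2 (by
    have := hln x hx; lia)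

/-- A cycle on eight vertices, two of which span no edge exactly if they are cyclically adjacent,
multiplied by a cycle on other vertices. -/
noncomputable def octagonCycle {V : Type*} [LinearOrder V] (R : Type*) [CommRing R] (p : ℕ → V)
    (x : Finset V →₀ R) : Finset V →₀ R :=
  wedge R (p 0) (wedge R (p 3) (wedge R (p 6) x))
  - wedge R (p 0) (wedge R (p 3) (wedge R (p 5) x))
  - wedge R (p 0) (wedge R (p 2) (wedge R (p 6) x))
  + wedge R (p 0) (wedge R (p 2) (wedge R (p 5) x))
  - wedge R (p 1) (wedge R (p 3) (wedge R (p 6) x))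
  + wedge R (p 1) (wedge R (p 3) (wedge R (p 7) x))
  + wedge R (p 1) (wedge R (p 4) (wedge R (p 6) x))
  - wedge R (p 1) (wedge R (p 4) (wedge R (p 7) x))
  + wedge R (p 3) (wedge R (p 5) (wedge R (p 7) x))
  - wedge R (p 2) (wedge R (p 5) (wedge R (p 7) x))
  - wedge R (p 2) (wedge R (p 4) (wedge R (p 6) x))
  + wedge R (p 2) (wedge R (p 4) (wedge R (p 7) x))

theorem bdry_octagonCycle {V R : Type*} [LinearOrder V] [CommRing R] (p : ℕ → V)
    {x : Finset V →₀ R} (h : bdry R x = 0) : bdry R (octagonCycle R p x) = 0 := by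
  simp only [octagonCycle, map_sub, map_add, bdry_wedge, h, map_zero, sub_zero]
  abel

/-- The link of `p 0` in the octagon cycle is the product `(p 3 - p 2) ∧ (p 6 - p 5)`, so for
consecutive octagon edges it is a product of two cherries. -/
theorem contract_octagonCycle {V R : Type*} [LinearOrder V] [CommRing R] {p : ℕ → V}
    (hp : ∀ i, 1 ≤ i → i ≤ 7 → p 0 ≠ p i) {x : Finset V →₀ R} (h : contract R (p 0) x = 0) :
    contract R (p 0) (octagonCycle R p x) =
      wedge R (p 3) (wedge R (p 6) x) - wedge R (p 3) (wedge R (p 5) x)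
        - (wedge R (p 2) (wedge R (p 6) x) - wedge R (p 2) (wedge R (p 5) x)) := by
  simp only [octagonCycle, map_sub, map_add, contract_wedge, h, map_zero, sub_zero, if_true,
    (hp 1 (by simp) (by simp)).symm, (hp 2 (by simp) (by simp)).symm,
    (hp 3 (by simp) (by simp)).symm, (hp 4 (by simp) (by simp)).symm,
    (hp 5 (by simp) (by simp)).symm, (hp 6 (by simp) (by simp)).symm,
    (hp 7 (by simp) (by simp)).symm, if_false]
  abel

theorem octagonCycle_induction {V R : Type*} [LinearOrder V] [CommRing R] {p : ℕ → V}
    {x : Finset V →₀ R} {P : Submodule R (Finset V →₀ R)}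
    (h : ∀ i j k, i + 2 ≤ j → j + 2 ≤ k → k ≤ i + 6 → k ≤ 7 →
      wedge R (p i) (wedge R (p j) (wedge R (p k) x)) ∈ P) : octagonCycle R p x ∈ P := by
  unfold octagonCycle
  repeat' first | apply add_mem | apply sub_mem
  all_goals exact h _ _ _ (by simp) (by simp) (by simp) (by simp)

theorem chainMap_octagonCycle {V W A : Type*} [LinearOrder V] [LinearOrder W] [CommRing A]
    (f : V ↪o W) (p : ℕ → V) (x : Finset V →₀ ℤ) :
    chainMap A f (octagonCycle ℤ p x) = octagonCycle A (f ∘ p) (chainMap A f x) := by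
  simp only [octagonCycle, map_sub, map_add, chainMap_wedge, Function.comp_apply]

theorem erase_edge_mem_matchings {S : Finset ℕ} {σ : Finset Edge} (hσ : σ ∈ matchings S) {a b : ℕ}
    (h : edge a b ∈ σ) : σ.erase (edge a b) ∈ matchings (S \ {a, b}) := by
  refine ⟨fun e he => ⟨(hσ.1 e (Finset.mem_of_mem_erase he)).1, ?_⟩,
    fun e he f hf => hσ.2 e (Finset.mem_of_mem_erase he) f (Finset.mem_of_mem_erase hf)⟩
  rw [Finset.subset_sdiff, ← ends_edge]
  exact ⟨(hσ.1 e (Finset.mem_of_mem_erase he)).2,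
    hσ.2 e (Finset.mem_of_mem_erase he) _ h (Finset.ne_of_mem_erase he)⟩

/-- Contraction with `p 0` maps chains on `2n` vertices to chains on the `2n - 2 = 3(2m + 2)`
vertices other than `q 0`, `q 1`, where the fundamental functional detects the resulting product of
cherries. -/
theorem exists_cycle_of_octagonCycle {n m : ℕ} (hn : n = 3 * m + 4) {B : Set (Position n n)}
    {l : List ℕ} (hl : l.Nodup) (hlm : l.length = 6 * m) (q : ℕ → ℕ)
    (hq : ∀ i < 8, ∀ j < i, q i ≠ q j) (hq' : ∀ i < 8, q i ∉ l) (hqn : ∀ i < 8, q i < 2 * n)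
    (hq8 : q 8 = q 0) (hln : ∀ x ∈ l, x < 2 * n)
    (hB : cherryProduct ℤ l ∈ chainsOf ℤ {σ | ∀ e ∈ σ, e ∈ rookEdge n '' B} (2 * m))
    (hqB : ∀ i < 8, edge (q i) (q (i + 1)) ∈ rookEdge n '' B) :
    ∃ z ∈ (rookComplex B).cycles (nu (2 * n)),
      ∀ A, z ∉ (rookComplex A).boundaries (nu (2 * n)) := by
  have : Fact (Nat.Prime 3) := ⟨Nat.prime_three⟩
  have hlS : l.toFinset ⊆ Finset.range (2 * n) := fun x hx =>
    Finset.mem_range.2 (hln x (List.mem_toFinset.1 hx))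
  have hqne : ∀ i < 8, ∀ j < 8, i ≠ j → q i ≠ q j := fun i hi j hj h => by
    rcases lt_or_gt_of_ne h with h | h
    exacts [(hq j hj i h).symm, hq i hi j h]
  have hqm : ∀ i < 8, q i ∈ Finset.range (2 * n) := fun i hi => Finset.mem_range.2 (hqn i hi)
  -- The auxiliary vertex `2 * n` brings the number of vertices to one more than a multiple of
  -- three.
  set S : Finset ℕ := insert (2 * n) (Finset.range (2 * n) \ {q 0, q 1}) with hSdef
  have hS : S.card = 3 * (2 * m + 2) + 1 := by
    rw [hSdef, Finset.card_insert_of_notMem (by simp), Finset.card_sdiff_of_subset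
      (by simp [Finset.insert_subset_iff, hqn]), Finset.card_pair (hqne 0 (by simp) 1 (by simp)
      (by simp)), Finset.card_range]
    lia
  obtain ⟨Φ, hΦ⟩ := exists_isFundamental (F := ZMod 3) rfl (2 * m + 2) S hS
  set p : ℕ → Edge := fun i => edge (q i) (q (i + 1)) with hp
  have hmem : ∀ x ∈ l, x ∈ l.toFinset := fun x hx => List.mem_toFinset.2 hx
  have hlen : l.length = 3 * (2 * m) := by lia
  have hends : ∀ i < 8, ∃ j < 8, p i = edge (q i) (q j) ∧ (j = i + 1 ∨ i = 7 ∧ j = 0) := by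
    intro i hi
    by_cases h : i = 7
    · subst h
      exact ⟨0, by simp, by rw [hp, ← hq8], Or.inr ⟨rfl, rfl⟩⟩
    · exact ⟨i + 1, by lia, rfl, Or.inl rfl⟩
  refine exists_cycle_of_functional (d := 2 * m + 3) (by lia)
    (y := octagonCycle ℤ p (cherryProduct ℤ l)) ?_ ?_ (bdry_octagonCycle p (bdry_cherryProduct l))
    (Φ := Φ.comp (contract (ZMod 3) (p 0))) ?_ ?_
  · refine octagonCycle_induction fun i j k hij hjk hki hk => ?_
    obtain ⟨i', hi', hpi, hi''⟩ := hends i (by lia)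
    obtain ⟨j', hj', hpj, hj''⟩ := hends j (by lia)
    obtain ⟨k', hk', hpk, hk''⟩ := hends k (by lia)
    have h0 := cherryProduct_mem (F := ℤ) hl hlen hmem
    have hT : ∀ t < 8, q t ∉ l.toFinset := fun t ht h => hq' t ht (List.mem_toFinset.1 h)
    rw [hpi, hpj, hpk]
    have h1 := wedge_edge_mem (S := insert (q k) (insert (q k') l.toFinset))
      (fun x hx => Finset.mem_insert_of_mem (Finset.mem_insert_of_mem hx))
      (hqne k (by lia) k' hk' (by lia)) (by simp) (by simp) (hT k (by lia)) (hT k' hk') h0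
    have h2 := wedge_edge_mem
      (S := insert (q j) (insert (q j') (insert (q k) (insert (q k') l.toFinset))))
      (fun x hx => Finset.mem_insert_of_mem (Finset.mem_insert_of_mem hx))
      (hqne j (by lia) j' hj' (by lia)) (by simp) (by simp)
      (by
        simp only [Finset.mem_insert, not_or]
        exact ⟨hqne j (by lia) k (by lia) (by lia), hqne j (by lia) k' hk' (by lia), hT j (by lia)⟩)
      (by
        simp only [Finset.mem_insert, not_or]
        exact ⟨hqne j' hj' k (by lia) (by lia), hqne j' hj' k' hk' (by lia), hT j' hj'⟩) h1
    exact wedge_edge_mem (S := Finset.range (2 * n)) (by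
        simp only [Finset.insert_subset_iff]
        exact ⟨hqm j (by lia), hqm j' hj', hqm k (by lia), hqm k' hk', hlS⟩)
      (hqne i (by lia) i' hi' (by lia)) (hqm i (by lia)) (hqm i' hi')
      (by
        simp only [Finset.mem_insert, not_or]
        exact ⟨hqne i (by lia) j (by lia) (by lia), hqne i (by lia) j' hj' (by lia),
          hqne i (by lia) k (by lia) (by lia), hqne i (by lia) k' hk' (by lia), hT i (by lia)⟩)
      (by
        simp only [Finset.mem_insert, not_or]
        exact ⟨hqne i' hi' j (by lia) (by lia), hqne i' hi' j' hj' (by lia),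
          hqne i' hi' k (by lia) (by lia), hqne i' hi' k' hk' (by lia), hT i' hi'⟩) h2
  · exact octagonCycle_induction fun i j k hij hjk hki hk =>
      wedge_mem_chainsOf_edges (hqB i (by lia)) (wedge_mem_chainsOf_edges (hqB j (by lia))
        (wedge_mem_chainsOf_edges (hqB k (by lia)) hB))
  · intro u hu
    rw [LinearMap.comp_apply, ← neg_eq_zero, ← map_neg, ← bdry_contract]
    refine hΦ.1 _ (chainsOf_mono (matchings_mono (Finset.subset_insert _ _)) _
      (contract_mem_chainsOf (fun σ hσ h => erase_edge_mem_matchings hσ h) hu))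
  · rw [chainMap_octagonCycle, chainMap_refl_cherryProduct, LinearMap.comp_apply]
    change Φ (contract (ZMod 3) (p 0) (octagonCycle (ZMod 3) p (cherryProduct (ZMod 3) l))) ≠ 0
    have hne : ∀ i, 1 ≤ i → i ≤ 7 → p 0 ≠ p i := by
      intro i hi hi7 h
      obtain ⟨j, hj, hpi, hj'⟩ := hends i (by lia)
      have h' := congrArg ends h
      rw [hpi, hp, ends_edge, ends_edge] at h'
      have a : q 0 ∈ ({q i, q j} : Finset ℕ) := h' ▸ Finset.mem_insert_self _ _
      have b : q 1 ∈ ({q i, q j} : Finset ℕ) := h' ▸ by simp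
      simp only [Finset.mem_insert, Finset.mem_singleton] at a b
      have h0i := hqne 0 (by simp) i (by lia) (by lia)
      have h1j : j ≠ 1 := by lia
      have h1j' := hqne 1 (by simp) j (by lia) h1j.symm
      have hi1 : i = 1 := by
        by_contra hne
        exact (b.resolve_right h1j') |> hqne 1 (by simp) i (by lia) (Ne.symm hne)
      have hj2 : j = 2 := by lia
      exact (a.resolve_left h0i) |> hqne 0 (by simp) j (by lia) (by lia)
    rw [contract_octagonCycle hne]
    · have : cherryProduct (ZMod 3) (q 3 :: q 4 :: q 2 :: q 6 :: q 7 :: q 5 :: l) =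
          wedge (ZMod 3) (p 3) (wedge (ZMod 3) (p 6) (cherryProduct (ZMod 3) l)) -
            wedge (ZMod 3) (p 3) (wedge (ZMod 3) (p 5) (cherryProduct (ZMod 3) l)) -
          (wedge (ZMod 3) (p 2) (wedge (ZMod 3) (p 6) (cherryProduct (ZMod 3) l)) -
            wedge (ZMod 3) (p 2) (wedge (ZMod 3) (p 5) (cherryProduct (ZMod 3) l))) := by
        rw [cherryProduct, cherryProduct]
        simp only [cherry_apply, map_sub, hp]
        rw [edge_comm (q 3) (q 2), edge_comm (q 6) (q 5)]
        exact sub_sub_sub_comm _ _ _ _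
      rw [← this]
      refine hΦ.cherryProduct_ne_zero hS ?_ (by simp only [List.length_cons]; lia) ?_
      · simp only [List.nodup_cons, List.mem_cons, not_or, hl, and_true]
        refine ⟨⟨?_, ?_, ?_, ?_, ?_, ?_⟩, ⟨?_, ?_, ?_, ?_, ?_⟩, ⟨?_, ?_, ?_, ?_⟩, ⟨?_, ?_, ?_⟩,
          ⟨?_, ?_⟩, ?_⟩ <;>
        first | exact hq' _ (by simp) | exact hqne _ (by simp) _ (by simp) (by simp)
      · have h2 : ∀ i < 8, 2 ≤ i → q i ∈ S := fun i hi h2 => by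
          rw [hSdef]
          refine Finset.mem_insert_of_mem (Finset.mem_sdiff.2 ⟨hqm i hi, ?_⟩)
          rw [Finset.mem_insert, Finset.mem_singleton, not_or]
          exact ⟨hqne i hi 0 (by simp) (by lia), hqne i hi 1 (by simp) (by lia)⟩
        have h3 : ∀ x ∈ l, x ∈ S := fun x hx => by
          rw [hSdef]
          refine Finset.mem_insert_of_mem (Finset.mem_sdiff.2 ⟨Finset.mem_range.2 (hln x hx), ?_⟩)
          rw [Finset.mem_insert, Finset.mem_singleton, not_or]
          exact ⟨fun e => hq' 0 (by simp) (e ▸ hx), fun e => hq' 1 (by simp) (e ▸ hx)⟩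
        simp only [List.mem_cons, forall_eq_or_imp]
        exact ⟨h2 _ (by simp) (by simp), h2 _ (by simp) (by simp), h2 _ (by simp) (by simp),
          h2 _ (by simp) (by simp), h2 _ (by simp) (by simp), h2 _ (by simp) (by simp), h3⟩
    · refine contract_eq_zero_of_notMem (fun σ hσ h => ?_)
        (cherryProduct_mem (F := ZMod 3) hl hlen hmem)
      have := (hσ.1 _ h).2
      rw [ends_edge, Finset.insert_subset_iff] at this
      exact hq' 0 (by simp) (List.mem_toFinset.1 this.1)

end Chessboard

/-! ### Essential cycles on the boards -/

section Boards

theorem edge_mem_image_rookEdge {n i j : ℕ} {B : Set (Position n n)} (hi : i < n) (hj : j < n)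
    (h : ∀ p : Position n n, p.row = i + 1 → p.col = j + 1 → p ∈ B) :
    edge i (n + j) ∈ rookEdge n '' B :=
  ⟨toLex (⟨i, hi⟩, ⟨j, hj⟩), h _ rfl rfl, rookEdge_eq_edge _⟩

theorem edge_mem_diagonalRemoved {n i j : ℕ} (hi : i < n) (hj : j < n) (h : i ≠ j) :
    edge i (n + j) ∈ rookEdge n '' diagonalRemoved n :=
  edge_mem_image_rookEdge hi hj fun p h1 h2 => by
    rw [diagonalRemoved, Set.mem_ofPred_eq, h1, h2]; lia

theorem edge_mem_diagonalRemoved' {n i j : ℕ} (hi : i < n) (hj : j < n) (h : i ≠ j) :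
    edge (n + j) i ∈ rookEdge n '' diagonalRemoved n := by
  rw [edge_comm]; exact edge_mem_diagonalRemoved hi hj h

/-- The vertices of the octagon of lines through the last four rows and columns. -/
def octagonLine (n i : ℕ) : ℕ :=
  if i % 2 = 0 then n + (n - 4) + (i / 2 + 1) % 4 else n - 4 + i / 2

/-- The octagon runs through the eight off-diagonal squares of the last `4 × 4` block at column
offsets 1 and 2 modulo 4 from their rows, so it serves both kinds of boards. -/
theorem exists_cycle_of_blocks {n m : ℕ} (hn : n = 3 * m + 4) {B : Set (Position n n)}
    {l : List ℕ} (hl : l.Nodup) (hlm : l.length = 6 * m)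
    (hx : ∀ x, x ∈ l ↔ x < 3 * m ∨ n ≤ x ∧ x < n + 3 * m)
    (hB : cherryProduct ℤ l ∈ chainsOf ℤ {σ | ∀ e ∈ σ, e ∈ rookEdge n '' B} (2 * m))
    (hR : ∀ i < 4, ∀ j < 4, i ≠ j → edge (n - 4 + i) (n + (n - 4 + j)) ∈ rookEdge n '' B) :
    ∃ z ∈ (rookComplex B).cycles (nu (2 * n)),
      ∀ A, z ∉ (rookComplex A).boundaries (nu (2 * n)) := by
  refine exists_cycle_of_octagonCycle hn hl hlm (octagonLine n) ?_ ?_ ?_ rfl ?_ hB ?_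
  · intro i hi j hj
    unfold octagonLine
    split_ifs <;> lia
  · intro i hi h
    rw [hx] at h
    unfold octagonLine at h
    split_ifs at h <;> lia
  · intro i hi
    unfold octagonLine
    split_ifs <;> lia
  · intro x h
    rw [hx] at h
    lia
  · intro i hi
    unfold octagonLine
    by_cases h : i % 2 = 0
    · rw [if_pos h, if_neg (by lia), edge_comm]
      have := hR ((i + 1) / 2) (by lia) ((i / 2 + 1) % 4) (by lia) (by lia)
      rwa [← add_assoc] at this
    · rw [if_neg h, if_pos (by lia)]
      have := hR (i / 2) (by lia) (((i + 1) / 2 + 1) % 4) (by lia) (by lia)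
      rwa [← add_assoc] at this

theorem exists_cycle_diagonalRemoved {n : ℕ} (hn : 3 ≤ n) :
    ∃ z ∈ (rookComplex (diagonalRemoved n)).cycles (nu (2 * n)),
      ∀ A, z ∉ (rookComplex A).boundaries (nu (2 * n)) := by
  have hblocks : ∀ m, 3 * m ≤ n → ∃ l : List ℕ, l.Nodup ∧ l.length = 6 * m ∧
      (∀ x, x ∈ l ↔ x < 3 * m ∨ n ≤ x ∧ x < n + 3 * m) ∧
      cherryProduct ℤ l ∈ chainsOf ℤ {σ | ∀ e ∈ σ, e ∈ rookEdge n '' diagonalRemoved n}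
        (2 * m) := by
    refine fun m hm => exists_blocks n m hm _ fun i hi => ⟨3 * i, n + (3 * i + 1), n + (3 * i + 2),
      n + 3 * i, 3 * i + 1, 3 * i + 2, ?_, ?_, ?_, ?_, ?_⟩
    · clear * -; grind
    · exact edge_mem_diagonalRemoved (by lia) (by lia) (by lia)
    · exact edge_mem_diagonalRemoved (by lia) (by lia) (by lia)
    · exact edge_mem_diagonalRemoved' (by lia) (by lia) (by lia)
    · exact edge_mem_diagonalRemoved' (by lia) (by lia) (by lia)
  -- For `n` congruent to 2 five rows and columns are set aside rather than two: off the diagonal, a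
  -- `2 × 2` block has no two squares in one line.
  obtain ⟨m, rfl | rfl | rfl⟩ : ∃ m, n = 3 * m ∨ n = 3 * m + 4 ∨ n = 3 * m + 5 := by
    by_cases h0 : n % 3 = 0
    · exact ⟨n / 3, by lia⟩
    by_cases h1 : n % 3 = 1
    · exact ⟨(n - 4) / 3, by lia⟩
    · exact ⟨(n - 5) / 3, by lia⟩
  · obtain ⟨l, h1, h2, h3, h4⟩ := hblocks m le_rfl
    exact exists_cycle_of_cherryProduct (d := 2 * m) (by lia) h1 (by lia)
      (fun x hx => by rw [h3] at hx; lia) h4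
  · obtain ⟨l, h1, h2, h3, h4⟩ := hblocks m (by lia)
    exact exists_cycle_of_blocks rfl h1 h2 h3 h4 fun i hi j hj hij =>
      edge_mem_diagonalRemoved (by lia) (by lia) (by lia)
  · obtain ⟨l, h1, h2, h3, h4⟩ := hblocks m (by lia)
    set n := 3 * m + 5 with hnm
    -- Three cherries use nine of the ten remaining lines: two are centred at rows, one at a column,
    -- and the last row is omitted.
    refine exists_cycle_of_cherryProduct (d := 2 * m + 3) (l := [3 * m, n + (3 * m + 3),
      n + (3 * m + 4), 3 * m + 3, n + (3 * m + 1), n + (3 * m + 2), n + 3 * m, 3 * m + 1,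
      3 * m + 2] ++ l) (by lia) ?_ (by rw [List.length_append, h2]; simp; lia) ?_ ?_
    · rw [List.nodup_append']
      refine ⟨?_, h1, ?_⟩
      · simp only [List.nodup_cons, List.mem_cons, not_or, List.not_mem_nil, not_false_eq_true,
          List.nodup_nil, and_true]
        clear * - hnm
        lia
      · intro x hx hx'
        rw [h3] at hx'
        simp only [List.mem_cons, List.not_mem_nil, or_false] at hx
        lia
    · intro x hx
      rw [List.mem_append, h3] at hx
      simp only [List.mem_cons, List.not_mem_nil, or_false] at hx
      omega
    · exact cherry_mem_chainsOf_edges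
        (edge_mem_diagonalRemoved (by lia) (by lia) (by lia))
        (edge_mem_diagonalRemoved (by lia) (by lia) (by lia))
        (cherry_mem_chainsOf_edges
          (edge_mem_diagonalRemoved (by lia) (by lia) (by lia))
          (edge_mem_diagonalRemoved (by lia) (by lia) (by lia))
          (cherry_mem_chainsOf_edges
            (edge_mem_diagonalRemoved' (by lia) (by lia) (by lia))
            (edge_mem_diagonalRemoved' (by lia) (by lia) (by lia)) h4))

theorem exists_cycle_patternB {n : ℕ} (hn : 3 ≤ n) :
    ∃ z ∈ (rookComplex (patternB n)).cycles (nu (2 * n)),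
      ∀ A, z ∉ (rookComplex A).boundaries (nu (2 * n)) := by
  have hblocks : 3 * numBlocks n ≤ n → ∃ l : List ℕ, l.Nodup ∧ l.length = 6 * numBlocks n ∧
      (∀ x, x ∈ l ↔ x < 3 * numBlocks n ∨ n ≤ x ∧ x < n + 3 * numBlocks n) ∧
      cherryProduct ℤ l ∈ chainsOf ℤ {σ | ∀ e ∈ σ, e ∈ rookEdge n '' patternB n}
        (2 * numBlocks n) := by
    refine fun hm => exists_blocks n _ hm _ fun i hi => ⟨3 * i, n + 3 * i, n + (3 * i + 1),
      n + (3 * i + 2), 3 * i + 1, 3 * i + 2, ?_, ?_, ?_, ?_, ?_⟩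
    · clear * -; grind
    · refine edge_mem_image_rookEdge (by lia) (by lia) fun p h1 h2 => Or.inl ⟨i, hi, ?_⟩
      simp [h1, h2, blockS]
    · refine edge_mem_image_rookEdge (by lia) (by lia) fun p h1 h2 => Or.inl ⟨i, hi, ?_⟩
      simp [h1, h2, blockS]
    · rw [edge_comm]
      refine edge_mem_image_rookEdge (by lia) (by lia) fun p h1 h2 => Or.inl ⟨i, hi, ?_⟩
      simp [h1, h2, blockS]
    · rw [edge_comm]
      refine edge_mem_image_rookEdge (by lia) (by lia) fun p h1 h2 => Or.inl ⟨i, hi, ?_⟩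
      simp [h1, h2, blockS]
  have hR : ∀ i < n, ∀ j < n, (i + 1, j + 1) ∈ restR n →
      edge i (n + j) ∈ rookEdge n '' patternB n := fun i hi j hj h =>
    edge_mem_image_rookEdge hi hj fun p h1 h2 => Or.inr (by rw [h1, h2]; exact h)
  by_cases h0 : n % 3 = 0
  · have hm : 3 * numBlocks n = n := by rw [numBlocks, if_pos h0]; lia
    obtain ⟨l, h1, h2, h3, h4⟩ := hblocks hm.le
    exact exists_cycle_of_cherryProduct (by lia) h1 (by lia) (fun x hx => by rw [h3] at hx; lia) h4
  by_cases h2 : n % 3 = 2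
  · have hm : 3 * numBlocks n + 2 = n := by rw [numBlocks, if_neg h0, if_pos h2]; lia
    obtain ⟨l, h1, h2', h3, h4⟩ := hblocks (by lia)
    -- The two squares of `restR n` lie in one row and give one more cherry; the last row is left
    -- over.
    refine exists_cycle_of_cherryProduct (d := 2 * numBlocks n + 1)
      (l := [n - 2, n + (n - 2), n + (n - 1)] ++ l) (by lia) ?_
      (by rw [List.length_append, h2']; simp; lia) ?_ ?_
    · rw [List.nodup_append']
      refine ⟨?_, h1, ?_⟩
      · simp only [List.nodup_cons, List.mem_cons, not_or, List.not_mem_nil, not_false_eq_true,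
          List.nodup_nil, and_true]
        clear * - hn
        lia
      · intro x hx hx'
        rw [h3] at hx'
        simp only [List.mem_cons, List.not_mem_nil, or_false] at hx
        lia
    · intro x hx
      rw [List.mem_append, h3] at hx
      simp only [List.mem_cons, List.not_mem_nil, or_false] at hx
      omega
    · refine cherry_mem_chainsOf_edges (hR _ (by lia) _ (by lia) ?_) (hR _ (by lia) _ (by lia) ?_)
        h4
      · rw [restR, if_neg h0, if_pos h2]
        left
        ext <;> simp <;> lia
      · rw [restR, if_neg h0, if_pos h2]
        right
        ext <;> simp <;> lia
  · have hm : n = 3 * numBlocks n + 4 := by rw [numBlocks, if_neg h0, if_neg h2]; lia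
    obtain ⟨l, h1, h2', h3, h4⟩ := hblocks (by lia)
    refine exists_cycle_of_blocks hm h1 h2' h3 h4 fun i hi j hj _ => hR _ (by lia) _ (by lia) ?_
    rw [restR, if_neg h0, if_neg h2]
    have : ∀ i < 4, n - 4 + i + 1 ∈ ({n - 3, n - 2, n - 1, n} : Set ℕ) := fun i hi => by
      simp only [Set.mem_insert_iff, Set.mem_singleton_iff]; lia
    exact ⟨this i hi, this j hj⟩

/-- The blocks and the two-square rest need half-width 1, the `4 × 4` rest needs 3. The band has
half-width 1 for `n = 6` and `n = 8` and at least 3 from `n = 10` on; `n = 7` is excluded because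
its half-width is 2. -/
theorem patternB_subset_bandBoard {n : ℕ} (hn : n = 6 ∨ 8 ≤ n) :
    patternB n ⊆ bandBoard n (2 * nu (2 * n) + 1 - n) := by
  intro p hp
  rw [bandBoard, Set.mem_ofPred_eq, nu, abs_le]
  rcases hp with ⟨i, hi, h⟩ | h
  · simp only [blockS, Set.mem_insert_iff, Set.mem_singleton_iff, Prod.mk.injEq] at h
    lia
  · unfold restR at h
    split_ifs at h with h0 h2
    · exact absurd h (Set.notMem_empty _)
    · simp only [Set.mem_insert_iff, Set.mem_singleton_iff, Prod.mk.injEq] at h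
      lia
    · simp only [Set.mem_prod, Set.mem_insert_iff, Set.mem_singleton_iff] at h
      lia

end Boards

/-! ### Chains of lists and barycentric subdivision -/

section ListChains

variable {E : Type*}

/-- The integral chains spanned by a set of lists. -/
def listChains (P : Set (List E)) : Submodule ℤ (List E →₀ ℤ) := Finsupp.supported ℤ ℤ P

theorem single_mem_listChains {P : Set (List E)} {l : List E} (h : l ∈ P) :
    Finsupp.single l 1 ∈ listChains P := Finsupp.single_mem_supported _ _ h

theorem listChains_le {P : Set (List E)} {Q : Submodule ℤ (List E →₀ ℤ)}
    (h : ∀ l ∈ P, Finsupp.single l 1 ∈ Q) : listChains P ≤ Q := by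
  rw [listChains, Finsupp.supported_eq_span_single, Submodule.span_le]
  rintro _ ⟨l, hl, rfl⟩
  exact h l hl

theorem listChains_mono {P Q : Set (List E)} (h : P ⊆ Q) : listChains P ≤ listChains Q :=
  listChains_le fun _ hl => single_mem_listChains (h hl)

theorem map_mem_listChains {M : Type*} [AddCommGroup M] [Module ℤ M] {P : Set (List E)}
    {f : (List E →₀ ℤ) →ₗ[ℤ] M} {Q : Submodule ℤ M}
    (h : ∀ l ∈ P, f (Finsupp.single l 1) ∈ Q) {x : List E →₀ ℤ} (hx : x ∈ listChains P) :
    f x ∈ Q :=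
  listChains_le (Q := Q.comap f) h hx

theorem eqOn_listChains {M : Type*} [AddCommGroup M] [Module ℤ M] {P : Set (List E)}
    {f g : (List E →₀ ℤ) →ₗ[ℤ] M}
    (h : ∀ l ∈ P, f (Finsupp.single l 1) = g (Finsupp.single l 1))
    {x : List E →₀ ℤ} (hx : x ∈ listChains P) : f x = g x :=
  listChains_le (Q := LinearMap.eqLocus f g) h hx

theorem mem_listChains_univ (x : List E →₀ ℤ) : x ∈ listChains (Set.univ : Set (List E)) := by
  simp [listChains]

/-- The cone with apex `a`. -/
noncomputable def listCone (a : E) : (List E →₀ ℤ) →ₗ[ℤ] (List E →₀ ℤ) :=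
  Finsupp.lmapDomain ℤ ℤ (List.cons a)

theorem listCone_single (a : E) (l : List E) (n : ℤ) :
    listCone a (Finsupp.single l n) = Finsupp.single (a :: l) n := by
  simp [listCone]

/-- The boundary of an ordered simplex. -/
noncomputable def listFaces : List E → (List E →₀ ℤ)
  | [] => 0
  | a :: l => Finsupp.single l 1 - listCone a (listFaces l)

/-- The boundary map on chains of ordered simplices. -/
noncomputable def listBdry : (List E →₀ ℤ) →ₗ[ℤ] (List E →₀ ℤ) :=
  Finsupp.linearCombination ℤ listFaces

theorem listBdry_single (l : List E) : listBdry (Finsupp.single l 1) = listFaces l := by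
  simp [listBdry]

theorem listBdry_listCone (a : E) (x : List E →₀ ℤ) :
    listBdry (listCone a x) = x - listCone a (listBdry x) := by
  refine eqOn_listChains (f := listBdry ∘ₗ listCone a)
    (g := LinearMap.id - listCone a ∘ₗ listBdry) (fun l _ => ?_) (mem_listChains_univ x)
  simp [listCone_single, listBdry_single, listFaces]

theorem listBdry_listBdry (x : List E →₀ ℤ) : listBdry (listBdry x) = 0 := by
  refine eqOn_listChains (f := listBdry ∘ₗ listBdry) (g := 0) (fun l _ => ?_)
    (mem_listChains_univ x)
  induction l with
  | nil => simp [listBdry_single, listFaces]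
  | cons a l ih =>
    rw [LinearMap.comp_apply, ← listCone_single, listBdry_listCone, map_sub, listBdry_listCone]
    have ih := ih (Set.mem_univ l)
    rw [LinearMap.comp_apply] at ih
    simp [ih]

theorem listFaces_mem (l : List E) :
    listFaces l ∈ listChains {w | w.Sublist l ∧ w.length + 1 = l.length} := by
  induction l with
  | nil => exact zero_mem _
  | cons a l ih =>
    refine sub_mem (single_mem_listChains ⟨List.sublist_cons_self a l, rfl⟩) ?_
    refine map_mem_listChains (fun w hw => ?_) ih
    rw [listCone_single]
    exact single_mem_listChains ⟨hw.1.cons_cons a, congrArg (· + 1) hw.2⟩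

/-- The chain map induced by a map of vertices. -/
noncomputable def listMap {E' : Type*} (f : E → E') : (List E →₀ ℤ) →ₗ[ℤ] (List E' →₀ ℤ) :=
  Finsupp.lmapDomain ℤ ℤ (List.map f)

theorem listMap_single {E' : Type*} (f : E → E') (l : List E) :
    listMap f (Finsupp.single l 1) = Finsupp.single (l.map f) 1 := by
  simp [listMap]

theorem listMap_listBdry {E' : Type*} (f : E → E') (x : List E →₀ ℤ) :
    listMap f (listBdry x) = listBdry (listMap f x) := by
  have hc : ∀ a x, listMap f (listCone a x) = listCone (f a) (listMap f x) := fun a x =>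
    eqOn_listChains (f := listMap f ∘ₗ listCone a) (g := listCone (f a) ∘ₗ listMap f)
      (fun l _ => by simp [listCone_single, listMap_single]) (mem_listChains_univ x)
  refine eqOn_listChains (f := listMap f ∘ₗ listBdry) (g := listBdry ∘ₗ listMap f) (fun l _ => ?_)
    (mem_listChains_univ x)
  induction l with
  | nil => simp [listBdry_single, listMap_single, listFaces]
  | cons a l ih =>
    have ih := ih (Set.mem_univ l)
    rw [LinearMap.comp_apply, LinearMap.comp_apply] at ih ⊢
    rw [← listCone_single, listBdry_listCone, map_sub, hc, ih, hc, listBdry_listCone]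

/-- The oriented simplex on a list of labels. -/
noncomputable def listWedge {V : Type*} [LinearOrder V] (f : E → V) :
    (List E →₀ ℤ) →ₗ[ℤ] (Finset V →₀ ℤ) :=
  Finsupp.linearCombination ℤ fun l => l.foldr (fun a x => wedge ℤ (f a) x) (Finsupp.single ∅ 1)

section

variable {V : Type*} [LinearOrder V] (f : E → V)

theorem listWedge_nil : listWedge f (Finsupp.single [] 1) = Finsupp.single ∅ 1 := by
  simp [listWedge]

theorem listWedge_listCone (a : E) (x : List E →₀ ℤ) :
    listWedge f (listCone a x) = wedge ℤ (f a) (listWedge f x) := by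
  refine eqOn_listChains (f := listWedge f ∘ₗ listCone a) (g := wedge ℤ (f a) ∘ₗ listWedge f)
    (fun l _ => ?_) (mem_listChains_univ x)
  simp [listCone_single, listWedge]

theorem bdry_listWedge (x : List E →₀ ℤ) :
    bdry ℤ (listWedge f x) = listWedge f (listBdry x) := by
  refine eqOn_listChains (f := bdry ℤ ∘ₗ listWedge f) (g := listWedge f ∘ₗ listBdry) (fun l _ => ?_)
    (mem_listChains_univ x)
  induction l with
  | nil => simp [listBdry_single, listFaces, listWedge_nil, bdry_single_empty]
  | cons a l ih =>
    have ih := ih (Set.mem_univ l)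
    rw [LinearMap.comp_apply, LinearMap.comp_apply] at ih ⊢
    rw [← listCone_single, listWedge_listCone, bdry_wedge, ih, listBdry_listCone, map_sub,
      listWedge_listCone]

/-- A repeated label gives zero because a vertex wedges to zero with itself, so degenerate labelled
simplices need no separate treatment. -/
theorem listWedge_single_mem (l : List E) : listWedge f (Finsupp.single l 1) ∈
    chainsOf ℤ {τ | ∀ v ∈ τ, ∃ a ∈ l, f a = v} l.length := by
  induction l with
  | nil => rw [listWedge_nil]; exact single_mem_chainsOf (by simp) rfl 1
  | cons a l ih =>
    rw [← listCone_single, listWedge_listCone]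
    refine wedge_mem_chainsOf (fun τ hτ _ v hv => ?_) ih
    rcases Finset.mem_insert.1 hv with rfl | hv
    · exact ⟨a, List.mem_cons_self, rfl⟩
    · obtain ⟨b, hb, h⟩ := hτ v hv
      exact ⟨b, List.mem_cons_of_mem _ hb, h⟩

end

/-- The chain of the increasing lists of vertices. -/
noncomputable def sortedChain {V : Type*} [LinearOrder V] :
    (Finset V →₀ ℤ) →ₗ[ℤ] (List V →₀ ℤ) :=
  Finsupp.lmapDomain ℤ ℤ fun σ => σ.sort (· ≤ ·)

theorem sortedChain_single {V : Type*} [LinearOrder V] (σ : Finset V) (n : ℤ) :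
    sortedChain (Finsupp.single σ n) = Finsupp.single (σ.sort (· ≤ ·)) n := by
  simp [sortedChain]

theorem sort_insert_of_lt {V : Type*} [LinearOrder V] {a : V} {σ : Finset V}
    (h : ∀ x ∈ σ, a < x) : (insert a σ).sort (· ≤ ·) = a :: σ.sort (· ≤ ·) :=
  Finset.sort_insert (h₁ := fun b hb => (h b hb).le) (h₂ := fun ha => lt_irrefl a (h a ha))

theorem wedge_single_of_lt {V : Type*} [LinearOrder V] {a : V} {σ : Finset V}
    (h : ∀ x ∈ σ, a < x) :
    wedge ℤ a (Finsupp.single σ 1) = Finsupp.single (insert a σ) 1 := by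
  rw [wedge_single, if_neg fun ha => lt_irrefl a (h a ha)]
  have : σ.filter (· < a) = ∅ := by
    rw [Finset.filter_eq_empty_iff]
    exact fun x hx => (h x hx).not_gt
  simp [faceSign, this]

theorem listWedge_sort {V : Type*} [LinearOrder V] (σ : Finset V) :
    listWedge id (Finsupp.single (σ.sort (· ≤ ·)) 1) = Finsupp.single σ 1 := by
  induction σ using Finset.induction_on_min with
  | empty => rw [Finset.sort_empty, listWedge_nil]
  | insert a σ h ih =>
    rw [sort_insert_of_lt h, ← listCone_single, listWedge_listCone, ih, id, wedge_single_of_lt h]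

/-- Simplices are built by adding vertices smaller than all others. Such a wedge has sign `+1` and
just prepends to the sorted list, so the two cone formulas coincide. -/
theorem listBdry_sortedChain {V : Type*} [LinearOrder V] (x : Finset V →₀ ℤ) :
    listBdry (sortedChain x) = sortedChain (bdry ℤ x) := by
  induction x using Finsupp.induction_linear with
  | zero => simp
  | add x y hx hy => simp only [map_add, hx, hy]
  | single σ n =>
    rw [single_eq_smul, map_smul, map_smul, map_smul, map_smul]
    congr 1
    induction σ using Finset.induction_on_min with
    | empty => simp [sortedChain_single, listBdry_single, listFaces, bdry_single_empty]
    | insert a σ h ih =>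
      rw [sortedChain_single, sort_insert_of_lt h, ← listCone_single, listBdry_listCone,
        ← sortedChain_single, ih, ← wedge_single_of_lt h, bdry_wedge, map_sub]
      congr 1
      have h1 : bdry ℤ (Finsupp.single σ 1) ∈ chainsOf ℤ {τ | ∀ x ∈ τ, a < x} (σ.card - 1) := by
        rw [bdry_single]
        refine sum_mem fun v hv => ?_
        rw [contract_single, if_pos hv]
        have h2 : σ.erase v ∈ {τ : Finset V | ∀ x ∈ τ, a < x} :=
          fun x hx => h x (Finset.mem_of_mem_erase hx)
        exact single_mem_chainsOf h2 (Finset.card_erase_of_mem hv) _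
      refine eqOn_chainsOf (f := listCone a ∘ₗ sortedChain) (g := sortedChain ∘ₗ wedge ℤ a)
        (fun τ hτ _ => ?_) h1
      rw [LinearMap.comp_apply, LinearMap.comp_apply, wedge_single_of_lt hτ, sortedChain_single,
        sortedChain_single, listCone_single, sort_insert_of_lt hτ]

theorem listFaces_mem_length {l : List E} {m : ℕ} (h : l.length = m + 1) :
    listFaces l ∈ listChains {w : List E | w.length = m} :=
  listChains_mono (fun w hw => by have := hw.2; rw [h] at this; exact Nat.succ_injective this)
    (listFaces_mem l)

end ListChains

/-! ### Barycentric subdivision and its mesh -/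

section Subdivision

variable {E : Type*} [NormedAddCommGroup E] [NormedSpace ℝ E]

/-- The barycenter of a list of points. -/
noncomputable def barycenter (l : List E) : E := (l.length : ℝ)⁻¹ • l.sum

/-- The barycentric subdivision of chains of ordered simplices with `m` vertices. -/
noncomputable def sd : ℕ → (List E →₀ ℤ) →ₗ[ℤ] (List E →₀ ℤ)
  | 0 => LinearMap.id
  | m + 1 => Finsupp.linearCombination ℤ fun l => listCone (barycenter l) (sd m (listFaces l))

theorem sd_zero : sd 0 = (LinearMap.id : (List E →₀ ℤ) →ₗ[ℤ] (List E →₀ ℤ)) := rfl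

theorem sd_succ_single (m : ℕ) (l : List E) :
    sd (m + 1) (Finsupp.single l 1) = listCone (barycenter l) (sd m (listFaces l)) := by
  simp [sd]

attribute [irreducible] sd

/-- The new simplices are cones on the subdivided boundary, and by induction that boundary is a
cycle, so the cone formula leaves only its base. -/
theorem listBdry_sd (m : ℕ) {x : List E →₀ ℤ}
    (hx : x ∈ listChains {w : List E | w.length = m + 1}) :
    listBdry (sd (m + 1) x) = sd m (listBdry x) := by
  induction m generalizing x with
  | zero =>
    refine eqOn_listChains (f := listBdry ∘ₗ sd (0 + 1)) (g := sd 0 ∘ₗ listBdry) (fun l hl => ?_) hx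
    obtain ⟨a, rfl⟩ := List.length_eq_one_iff.1 hl
    simp [sd_succ_single, listBdry_listCone, sd_zero, listBdry_single, listFaces]
  | succ m ih =>
    refine eqOn_listChains (f := listBdry ∘ₗ sd (m + 1 + 1)) (g := sd (m + 1) ∘ₗ listBdry)
      (fun l hl => ?_) hx
    have h := ih (listFaces_mem_length hl)
    rw [← listBdry_single, listBdry_listBdry, map_zero] at h
    rw [LinearMap.comp_apply, LinearMap.comp_apply, sd_succ_single, listBdry_listCone,
      ← listBdry_single, h, map_zero, sub_zero]

/-- Ordered simplices with `m` vertices in `C` and mesh at most `r`. -/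
def smallLists (C : Set E) (m : ℕ) (r : ℝ) : Set (List E) :=
  {l | l.length = m ∧ (∀ p ∈ l, p ∈ C) ∧ ∀ p ∈ l, ∀ q ∈ l, dist p q ≤ r}

theorem barycenter_mem {C : Set E} (hC : Convex ℝ C) {l : List E} (hne : l ≠ [])
    (h : ∀ p ∈ l, p ∈ C) : barycenter l ∈ C := by
  have hl : (0 : ℝ) < l.length := by exact_mod_cast List.length_pos_iff.2 hne
  have hsum : l.sum = ∑ i : Fin l.length, l[i] := by
    simp
  rw [barycenter, hsum, Finset.smul_sum]
  refine hC.sum_mem (fun _ _ => by positivity) ?_ fun i _ => h _ (List.getElem_mem _)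
  simp [hl.ne']

theorem dist_barycenter_le {l : List E} {r : ℝ} {p : E} (hp : p ∈ l)
    (h : ∀ q ∈ l, dist q p ≤ r) :
    dist p (barycenter l) ≤ ((l.length : ℝ) - 1) / l.length * r := by
  have hl : (0 : ℝ) < l.length := by exact_mod_cast List.length_pos_of_mem hp
  have key : ∀ l : List E, (∀ q ∈ l, dist q p ≤ r) →
      ‖l.sum - (l.length : ℝ) • p‖ ≤ l.length * r := by
    intro l
    induction l with
    | nil => simp
    | cons a l ih =>
      intro h
      rw [List.sum_cons, List.length_cons]
      push_cast
      rw [add_smul, one_smul, show a + l.sum - ((l.length : ℝ) • p + p) =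
        (a - p) + (l.sum - (l.length : ℝ) • p) by abel]
      have h1 := norm_add_le (a - p) (l.sum - (l.length : ℝ) • p)
      have h2 := h a List.mem_cons_self
      have h3 := ih fun q hq => h q (List.mem_cons_of_mem _ hq)
      rw [dist_eq_norm] at h2
      linarith
  classical
  have h1 := key (l.erase p) fun q hq => h q (List.mem_of_mem_erase hq)
  have hperm := List.perm_cons_erase hp
  have h2 : l.sum = p + (l.erase p).sum := by rw [hperm.sum_eq, List.sum_cons]
  have h3 : l.length = (l.erase p).length + 1 := by rw [hperm.length_eq, List.length_cons]
  have h4 : ((l.erase p).length : ℝ) = l.length - 1 := by rw [h3]; push_cast; ring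
  rw [h4] at h1
  have h5 : barycenter l - p = (l.length : ℝ)⁻¹ • ((l.erase p).sum - ((l.length : ℝ) - 1) • p) := by
    rw [barycenter, h2, sub_smul, one_smul, smul_sub, smul_sub, smul_smul, inv_mul_cancel₀ hl.ne',
      one_smul, smul_add]
    abel
  rw [dist_comm, dist_eq_norm, h5, norm_smul, norm_inv, Real.norm_natCast, div_mul_eq_mul_div,
    inv_mul_eq_div]
  gcongr

/-- A subdivided simplex is either in a subdivided face, which is smaller by induction, or joins the
barycenter to such a face. The barycenter is within `M / (M + 1) * r` of all vertices and so of
their convex hull. -/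
theorem sd_mem_smallLists {C : Set E} (hC : Convex ℝ C) {M m : ℕ} (hm : m ≤ M + 1) {r : ℝ}
    (hr : 0 ≤ r) {x : List E →₀ ℤ} (hx : x ∈ listChains (smallLists C m r)) :
    sd m x ∈ listChains (smallLists C m ((M : ℝ) / (M + 1) * r)) := by
  induction m generalizing C x with
  | zero =>
    rw [sd_zero]
    refine listChains_mono (fun l hl => ?_) hx
    rw [List.length_eq_zero_iff.1 hl.1]
    simp [smallLists]
  | succ m ih =>
    refine map_mem_listChains (fun l hl => ?_) hx
    obtain ⟨h1, h2, h3⟩ := hl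
    rw [sd_succ_single]
    have hlC : convexHull ℝ {p | p ∈ l} ⊆ C := convexHull_min h2 hC
    have hne : l ≠ [] := by rintro rfl; simp at h1
    have h4 : listFaces l ∈ listChains (smallLists (convexHull ℝ {p | p ∈ l}) m r) :=
      listChains_mono (fun w hw => by
        exact ⟨by have := hw.2; lia, fun p hp => subset_convexHull ℝ _ (hw.1.subset hp),
        fun p hp q hq => h3 p (hw.1.subset hp) q (hw.1.subset hq)⟩) (listFaces_mem l)
    have hθ : ((l.length : ℝ) - 1) / l.length * r ≤ (M : ℝ) / (M + 1) * r := by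
      refine mul_le_mul_of_nonneg_right ?_ hr
      rw [h1]
      push_cast
      rw [div_le_div_iff₀ (by positivity) (by positivity)]
      have : (m : ℝ) ≤ M := by exact_mod_cast Nat.le_of_succ_le_succ hm
      nlinarith
    have hball : convexHull ℝ {p | p ∈ l} ⊆
        Metric.closedBall (barycenter l) ((M : ℝ) / (M + 1) * r) :=
      convexHull_min (fun p hp => Metric.mem_closedBall.2
        ((dist_barycenter_le hp fun q hq => h3 q hq p hp).trans hθ)) (convex_closedBall _ _)
    refine map_mem_listChains (fun w hw => ?_)
      (ih (convex_convexHull ℝ _) (by lia) h4)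
    rw [listCone_single]
    refine single_mem_listChains ⟨congrArg (· + 1) hw.1, ?_, ?_⟩
    · intro p hp
      rcases List.mem_cons.1 hp with rfl | hp
      · exact barycenter_mem hC hne h2
      · exact hlC (hw.2.1 p hp)
    · intro p hp q hq
      rcases List.mem_cons.1 hp with rfl | hp <;> rcases List.mem_cons.1 hq with rfl | hq
      · rw [dist_self]; positivity
      · rw [dist_comm]; exact hball (hw.2.1 q hq)
      · exact hball (hw.2.1 p hp)
      · exact hw.2.2 p hp q hq

theorem sd_pow_mem_smallLists {C : Set E} (hC : Convex ℝ C) {M m : ℕ} (hm : m ≤ M + 1) {r : ℝ}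
    (hr : 0 ≤ r) {x : List E →₀ ℤ} (hx : x ∈ listChains (smallLists C m r)) (N : ℕ) :
    (sd m ^ N) x ∈ listChains (smallLists C m (((M : ℝ) / (M + 1)) ^ N * r)) := by
  induction N with
  | zero => simpa using hx
  | succ N ih =>
    rw [pow_succ' (sd m), Module.End.mul_apply, pow_succ', mul_assoc]
    exact sd_mem_smallLists hC hm (by positivity) ih

theorem sd_mem_length (m : ℕ) {x : List E →₀ ℤ} (hx : x ∈ listChains {w : List E | w.length = m}) :
    sd m x ∈ listChains {w : List E | w.length = m} := by
  induction m generalizing x with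
  | zero => rwa [sd_zero]
  | succ m ih =>
    refine map_mem_listChains (fun l hl => ?_) hx
    rw [sd_succ_single]
    refine map_mem_listChains (fun w hw => ?_)
      (ih (listFaces_mem_length hl))
    rw [listCone_single]
    exact single_mem_listChains (congrArg (· + 1) hw)

theorem listBdry_sd_pow (m N : ℕ) {x : List E →₀ ℤ}
    (hx : x ∈ listChains {w : List E | w.length = m + 1}) :
    listBdry ((sd (m + 1) ^ N) x) = (sd m ^ N) (listBdry x) := by
  induction N generalizing x with
  | zero => rfl
  | succ N ih =>
    rw [pow_succ, Module.End.mul_apply, ih (sd_mem_length _ hx), listBdry_sd m hx, pow_succ,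
      Module.End.mul_apply]

end Subdivision

/-! ### A Sperner lemma for iterated barycentric subdivisions -/

section Sperner

variable {V E : Type*} [LinearOrder V] [NormedAddCommGroup E] [NormedSpace ℝ E]

/-- A labelling of the points of a simplex by vertices of their carriers recovers the simplex from
any of its iterated barycentric subdivisions. -/
theorem listWedge_sd_pow (e : V → E) (f : E → V) (N m : ℕ) (u : List V) (hm : u.length = m)
    (hu : u.Nodup) (H : ∀ w : List V, w ⊆ u → ∀ p ∈ convexHull ℝ (e '' {v | v ∈ w}), f p ∈ w) :
    listWedge f ((sd m ^ N) (Finsupp.single (u.map e) 1)) = listWedge id (Finsupp.single u 1) := by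
  induction m generalizing u with
  | zero =>
    rw [List.length_eq_zero_iff.1 hm, sd_zero, ← Module.End.one_eq_id, one_pow, List.map_nil,
      Module.End.one_apply, listWedge_nil, listWedge_nil]
  | succ m ih =>
    obtain ⟨a, t, rfl⟩ := List.exists_cons_of_length_eq_add_one hm
    set u := a :: t with hut
    set y := listWedge f ((sd (m + 1) ^ N) (Finsupp.single (u.map e) 1)) with hy
    have hlen : (u.map e).length = m + 1 := by rw [List.length_map, hm]
    have hymem : y ∈ chainsOf ℤ {τ | τ ⊆ u.toFinset} (m + 1) := by
      have h1 := sd_pow_mem_smallLists (convex_convexHull ℝ (e '' {v | v ∈ u})) le_rfl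
        (Metric.diam_nonneg (s := {p | p ∈ u.map e})) (M := m)
        (single_mem_listChains (l := u.map e) (show u.map e ∈ smallLists
          (convexHull ℝ (e '' {v | v ∈ u})) (m + 1) (Metric.diam {p | p ∈ u.map e}) from
          ⟨hlen, fun p hp => by
            obtain ⟨v, hv, rfl⟩ := List.mem_map.1 hp
            exact subset_convexHull ℝ _ ⟨v, hv, rfl⟩,
          fun p hp q hq => Metric.dist_le_diam_of_mem (List.finite_toSet _).isBounded hp hq⟩)) N
      refine map_mem_listChains (f := listWedge f) (fun l hl => ?_) h1
      have h2 := listWedge_single_mem f l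
      rw [hl.1] at h2
      refine chainsOf_mono (fun τ hτ v hv => ?_) _ h2
      obtain ⟨p, hp, rfl⟩ := hτ v hv
      exact List.mem_toFinset.2 (H u (List.Subset.refl u) p (hl.2.1 p hp))
    -- On each proper face the labels stay in that face, so by induction the labelled subdivision of
    -- the boundary is the boundary itself.
    have hbdry : bdry ℤ y = bdry ℤ (listWedge id (Finsupp.single u 1)) := by
      rw [hy, bdry_listWedge, bdry_listWedge, listBdry_sd_pow m N (single_mem_listChains hlen),
        ← listMap_single, ← listMap_listBdry, listBdry_single]
      refine eqOn_listChains (f := listWedge f ∘ₗ (sd m ^ N) ∘ₗ listMap e) (g := listWedge id)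
        (fun w hw => ?_) (listFaces_mem u)
      obtain ⟨hw1, hw2⟩ := hw
      rw [LinearMap.comp_apply, LinearMap.comp_apply, listMap_single]
      exact ih w (by lia) (hw1.nodup hu) fun w' hw' => H w' fun v hv => hw1.subset (hw' hv)
    -- All `m + 1` vertices, including `a`, occur in every face of `y`. The cone formula then gives
    -- `y = a ∧ ∂y`, and so `y` is determined by its boundary.
    have h0 : wedge ℤ a y = 0 := by
      refine eqOn_chainsOf (f := wedge ℤ a) (g := 0) (fun τ hτ hc => ?_) hymem
      have : τ = u.toFinset := Finset.eq_of_subset_of_card_le hτ (by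
        rw [hc, ← hm]; exact List.toFinset_card_le u)
      rw [wedge_single, if_pos (by rw [this]; simp [hut]), LinearMap.zero_apply]
    have h1 : wedge ℤ a (listWedge id (Finsupp.single u 1)) = 0 := by
      rw [hut, ← listCone_single, listWedge_listCone, id, wedge_self]
    have h2 := bdry_wedge a y
    have h3 := bdry_wedge a (listWedge id (Finsupp.single u 1))
    rw [h0, map_zero, eq_comm, sub_eq_zero] at h2
    rw [h1, map_zero, eq_comm, sub_eq_zero] at h3
    rw [h2, h3, hbdry]

end Sperner

/-! ### Extending maps over cones -/

section Cone

open Set Metric Topology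

/-- The corner of the cube cut off by the standard simplex. -/
def cornerSimplex (m : ℕ) : Set (EuclideanSpace ℝ (Fin m)) :=
  {w | (∀ i, 0 ≤ w i) ∧ ∑ i, w i ≤ 1}

theorem continuous_coord {m : ℕ} (i : Fin m) : Continuous fun w : EuclideanSpace ℝ (Fin m) => w i :=
  by fun_prop

theorem isClosed_cornerSimplex (m : ℕ) : IsClosed (cornerSimplex m) := by
  have : cornerSimplex m = (⋂ i, {w | 0 ≤ w i}) ∩ {w | ∑ i, w i ≤ 1} := by
    ext w; simp [cornerSimplex]
  rw [this]
  exact (isClosed_iInter fun i => isClosed_le continuous_const (continuous_coord i)).inter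
    (isClosed_le (continuous_finsetSum _ fun i _ => continuous_coord i) continuous_const)

theorem convex_cornerSimplex (m : ℕ) : Convex ℝ (cornerSimplex m) := by
  intro x hx y hy a b ha hb hab
  refine ⟨fun i => ?_, ?_⟩
  · have := hx.1 i
    have := hy.1 i
    simp only [PiLp.add_apply, PiLp.smul_apply, smul_eq_mul]
    positivity
  · simp only [PiLp.add_apply, PiLp.smul_apply, smul_eq_mul, Finset.sum_add_distrib,
      ← Finset.mul_sum]
    calc _ ≤ a * 1 + b * 1 := by gcongr; exacts [hx.2, hy.2]
      _ = 1 := by rw [mul_one, mul_one, hab]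

theorem isBounded_cornerSimplex (m : ℕ) : Bornology.IsBounded (cornerSimplex m) := by
  refine (isBounded_closedBall (x := (0 : EuclideanSpace ℝ (Fin m)))
    (r := Real.sqrt m)).subset fun w hw => ?_
  rw [mem_closedBall_zero_iff, EuclideanSpace.norm_eq]
  refine Real.sqrt_le_sqrt ?_
  calc ∑ i, ‖w i‖ ^ 2 ≤ ∑ i : Fin m, (1 : ℝ) := by
        refine Finset.sum_le_sum fun i _ => ?_
        have h1 : w i ≤ 1 :=
          (Finset.single_le_sum (fun j _ => hw.1 j) (Finset.mem_univ i)).trans hw.2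
        rw [Real.norm_of_nonneg (hw.1 i)]
        exact pow_le_one₀ (hw.1 i) h1
    _ = m := by simp

theorem interior_cornerSimplex (m : ℕ) :
    interior (cornerSimplex m) = {w | (∀ i, 0 < w i) ∧ ∑ i, w i < 1} := by
  apply subset_antisymm
  · intro w hw
    have key : ∀ x : EuclideanSpace ℝ (Fin m), ∃ t : ℝ, 0 < t ∧ w + t • x ∈ cornerSimplex m := by
      intro x
      have hc : Filter.Tendsto (fun t : ℝ => w + t • x) (𝓝 0) (𝓝 w) := by
        have : Continuous fun t : ℝ => w + t • x := by fun_prop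
        simpa using this.tendsto 0
      have h1 := hc.eventually (mem_interior_iff_mem_nhds.1 hw)
      obtain ⟨t, ht, ht'⟩ := ((h1.filter_mono (nhdsWithin_le_nhds (s := Ioi (0 : ℝ)))).and
        self_mem_nhdsWithin).exists
      exact ⟨t, ht', ht⟩
    refine ⟨fun i => ?_, ?_⟩
    · obtain ⟨t, ht, h⟩ := key (EuclideanSpace.single i (-1))
      have := h.1 i
      simp at this
      linarith
    · rcases isEmpty_or_nonempty (Fin m) with _ | ⟨⟨i⟩⟩
      · simp
      · obtain ⟨t, ht, h⟩ := key (EuclideanSpace.single i 1)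
        have := h.2
        simp [Finset.sum_add_distrib] at this
        linarith
  · refine interior_maximal (fun w hw => ⟨fun i => (hw.1 i).le, hw.2.le⟩) ?_
    have : {w : EuclideanSpace ℝ (Fin m) | (∀ i, 0 < w i) ∧ ∑ i, w i < 1} =
        (⋂ i, {w | 0 < w i}) ∩ {w | ∑ i, w i < 1} := by
      ext w; simp
    rw [this]
    exact (isOpen_iInter_of_finite fun i => isOpen_lt continuous_const (continuous_coord i)).inter
      (isOpen_lt (continuous_finsetSum _ fun i _ => continuous_coord i) continuous_const)

theorem frontier_cornerSimplex (m : ℕ) :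
    frontier (cornerSimplex m) = {w ∈ cornerSimplex m | ∑ i, w i = 1 ∨ ∃ i, w i = 0} := by
  rw [(isClosed_cornerSimplex m).frontier_eq, interior_cornerSimplex]
  ext w
  constructor
  · rintro ⟨hw, h⟩
    refine ⟨hw, ?_⟩
    by_contra! h'
    exact h ⟨fun i => (hw.1 i).lt_of_ne' (h'.2 i), hw.2.lt_of_ne h'.1⟩
  · rintro ⟨hw, h⟩
    refine ⟨hw, fun h' => ?_⟩
    rcases h with h | ⟨i, h⟩
    · exact h'.2.ne h
    · exact (h'.1 i).ne' h

theorem interior_cornerSimplex_nonempty (m : ℕ) : (interior (cornerSimplex m)).Nonempty := by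
  rw [interior_cornerSimplex]
  refine ⟨WithLp.toLp 2 fun _ => ((m : ℝ) + 1)⁻¹, fun i => by simp; positivity, ?_⟩
  simp only [Finset.sum_const, Finset.card_univ, Fintype.card_fin, nsmul_eq_mul]
  rw [← div_eq_mul_inv, div_lt_one (by positivity)]
  linarith

variable {V : Type*}

/-- The cone with apex `0` over the simplex spanned by `σ`. -/
def coneCell [Fintype V] (σ : Finset V) : Set (V → ℝ) :=
  {y | (∀ v, 0 ≤ y v) ∧ (∀ v ∉ σ, y v = 0) ∧ ∑ v, y v ≤ 1}

/-- The boundary of a cone cell. -/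
def coneCellBdry [Fintype V] (σ : Finset V) : Set (V → ℝ) :=
  {y ∈ coneCell σ | ∑ v, y v = 1 ∨ ∃ v ∈ σ, y v = 0}

/-- The coordinates of a point on a coordinate subspace. -/
noncomputable def toCoords (σ : Finset V) (y : V → ℝ) : EuclideanSpace ℝ (Fin σ.card) :=
  WithLp.toLp 2 fun i => y (σ.equivFin.symm i)

/-- The point of a coordinate subspace with given coordinates. -/
noncomputable def ofCoords (σ : Finset V) (w : EuclideanSpace ℝ (Fin σ.card)) : V → ℝ :=
  open Classical in fun v => if h : v ∈ σ then w (σ.equivFin ⟨v, h⟩) else 0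

theorem continuous_toCoords (σ : Finset V) : Continuous (toCoords σ) := by
  unfold toCoords; fun_prop

theorem continuous_ofCoords (σ : Finset V) : Continuous (ofCoords σ) := by
  refine continuous_pi fun v => ?_
  unfold ofCoords
  by_cases h : v ∈ σ
  · simp only [h, dif_pos]; fun_prop
  · simp only [h, dif_neg, not_false_eq_true]; fun_prop

theorem toCoords_ofCoords (σ : Finset V) (w : EuclideanSpace ℝ (Fin σ.card)) :
    toCoords σ (ofCoords σ w) = w := by
  ext i
  simp [toCoords, ofCoords]

theorem ofCoords_toCoords {σ : Finset V} {y : V → ℝ} (h : ∀ v ∉ σ, y v = 0) :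
    ofCoords σ (toCoords σ y) = y := by
  ext v
  by_cases hv : v ∈ σ
  · simp [toCoords, ofCoords, hv]
  · simp [ofCoords, hv, h v hv]

theorem sum_toCoords [Fintype V] {σ : Finset V} {y : V → ℝ} (h : ∀ v ∉ σ, y v = 0) :
    ∑ i, toCoords σ y i = ∑ v, y v := by
  rw [← Finset.sum_subset (Finset.subset_univ σ) fun v _ hv => h v hv, ← Finset.sum_coe_sort σ]
  exact Equiv.sum_comp σ.equivFin.symm fun v : σ => y v

theorem ofCoords_of_notMem {σ : Finset V} (w : EuclideanSpace ℝ (Fin σ.card)) {v : V} (hv : v ∉ σ) :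
    ofCoords σ w v = 0 := by
  simp [ofCoords, hv]

theorem toCoords_mem [Fintype V] {σ : Finset V} {y : V → ℝ} (hy : y ∈ coneCell σ) :
    toCoords σ y ∈ cornerSimplex σ.card :=
  ⟨fun _ => hy.1 _, (sum_toCoords hy.2.1).trans_le hy.2.2⟩

theorem toCoords_mem_frontier [Fintype V] {σ : Finset V} {y : V → ℝ} (hy : y ∈ coneCellBdry σ) :
    toCoords σ y ∈ frontier (cornerSimplex σ.card) := by
  rw [frontier_cornerSimplex]
  refine ⟨toCoords_mem hy.1, hy.2.imp (fun h => ?_) ?_⟩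
  · rw [sum_toCoords hy.1.2.1, h]
  · rintro ⟨v, hv, h⟩
    exact ⟨σ.equivFin ⟨v, hv⟩, by simpa [toCoords] using h⟩

theorem ofCoords_mem [Fintype V] {σ : Finset V} {w : EuclideanSpace ℝ (Fin σ.card)}
    (hw : w ∈ frontier (cornerSimplex σ.card)) : ofCoords σ w ∈ coneCellBdry σ := by
  rw [frontier_cornerSimplex] at hw
  have hs : ∑ v, ofCoords σ w v = ∑ i, w i := by
    rw [← sum_toCoords fun v hv => ofCoords_of_notMem w hv, toCoords_ofCoords]
  refine ⟨⟨fun v => ?_, fun v hv => ofCoords_of_notMem w hv, hs.trans_le hw.1.2⟩, ?_⟩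
  · by_cases hv : v ∈ σ
    · simpa [ofCoords, hv] using hw.1.1 _
    · exact (ofCoords_of_notMem w hv).ge
  · refine hw.2.imp (fun h => hs.trans h) ?_
    rintro ⟨i, h⟩
    exact ⟨σ.equivFin.symm i, Subtype.coe_prop _, by simpa [ofCoords] using h⟩

/-- In the coordinates indexed by `σ` the cone is a convex body in a Euclidean space of dimension
`σ.card`. A homeomorphism of the body to the ball carries its frontier to the sphere, so the
extension property transfers. -/
theorem exists_extension_coneCell [Fintype V] {X : Set (V → ℝ)} (σ : Finset V)
    (hX : ∀ f : C(sphere (0 : EuclideanSpace ℝ (Fin σ.card)) 1, X),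
      ∃ g : C(closedBall (0 : EuclideanSpace ℝ (Fin σ.card)) 1, X),
        ∀ x : sphere (0 : EuclideanSpace ℝ (Fin σ.card)) 1,
          g ⟨x, sphere_subset_closedBall x.2⟩ = f x)
    {g : (V → ℝ) → V → ℝ} (hg : ContinuousOn g (coneCellBdry σ))
    (hgX : MapsTo g (coneCellBdry σ) X) :
    ∃ G : (V → ℝ) → V → ℝ, ContinuousOn G (coneCell σ) ∧ MapsTo G (coneCell σ) X ∧
      EqOn G g (coneCellBdry σ) := by
  obtain ⟨h, -, hcl, hfr⟩ := exists_homeomorph_image_interior_closure_frontier_eq_unitBall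
    (convex_cornerSimplex σ.card) (interior_cornerSimplex_nonempty σ.card)
    (isBounded_cornerSimplex σ.card)
  rw [(isClosed_cornerSimplex σ.card).closure_eq] at hcl
  have hmem : ∀ x ∈ sphere (0 : EuclideanSpace ℝ (Fin σ.card)) 1,
      ofCoords σ (h.symm x) ∈ coneCellBdry σ := by
    intro x hx
    rw [← hfr] at hx
    obtain ⟨w, hw, rfl⟩ := hx
    rw [h.symm_apply_apply]
    exact ofCoords_mem hw
  have hball : ∀ y ∈ coneCell σ, h (toCoords σ y) ∈ closedBall 0 1 := fun y hy => by
    rw [← hcl]; exact mem_image_of_mem h (toCoords_mem hy)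
  obtain ⟨G, hG⟩ := hX ⟨fun x => ⟨g (ofCoords σ (h.symm x)), hgX (hmem x x.2)⟩,
    Continuous.subtype_mk (hg.comp_continuous (f := fun x : sphere (0 : EuclideanSpace ℝ
      (Fin σ.card)) 1 => ofCoords σ (h.symm x)) ((continuous_ofCoords σ).comp
      (h.symm.continuous.comp continuous_subtype_val)) fun x => hmem x x.2) _⟩
  classical
  refine ⟨fun y => if hy : h (toCoords σ y) ∈ closedBall 0 1 then G ⟨_, hy⟩ else 0, ?_, ?_, ?_⟩
  · rw [continuousOn_iff_continuous_domRestrict]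
    have : Continuous fun y : coneCell σ => (G ⟨h (toCoords σ y), hball y y.2⟩ : V → ℝ) :=
      continuous_subtype_val.comp (G.continuous.comp (Continuous.subtype_mk
        (h.continuous.comp ((continuous_toCoords σ).comp continuous_subtype_val)) _))
    convert! this using 1
    ext1 y
    rw [domRestrict_apply, dif_pos (hball y y.2)]
  · intro y hy
    simp only [dif_pos (hball y hy)]
    exact Subtype.coe_prop _
  · intro y hy
    have hs : h (toCoords σ y) ∈ sphere 0 1 := by
      rw [← hfr]; exact mem_image_of_mem h (toCoords_mem_frontier hy)
    simp only [dif_pos (hball y hy.1)]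
    have := hG ⟨_, hs⟩
    rw [this]
    simp [ofCoords_toCoords hy.1.2.1]

end Cone

/-! ### Connectivity and homology -/

section Connectivity

open Set Metric

variable {V : Type*} [Fintype V] {K : PreAbstractSimplicialComplex V}

theorem mem_realization {σ : Finset V} (hσ : σ ∈ K.faces) {y : V → ℝ}
    (hy : y ∈ stdSimplex ℝ V) (h : ∀ v ∉ σ, y v = 0) : y ∈ K.realization := by
  classical
  refine ⟨hy, Finset.univ.filter fun v => y v ≠ 0, (K.isRelLowerSet_faces hσ).2 ?_ ?_, by simp⟩
  · intro v hv
    by_contra hv'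
    exact (Finset.mem_filter.1 hv).2 (h v hv')
  · by_contra hne
    rw [Finset.not_nonempty_iff_eq_empty, Finset.filter_eq_empty_iff] at hne
    have : ∑ v, y v = 0 := Finset.sum_eq_zero fun v hv => not_not.1 (hne hv)
    rw [hy.2] at this
    exact one_ne_zero this

theorem isClosed_realization : IsClosed K.realization := by
  have : K.realization = ⋃ σ ∈ K.faces, stdSimplex ℝ V ∩ ⋂ v, {y | v ∉ σ → y v = 0} := by
    ext y
    simp only [mem_iUnion, mem_inter_iff, mem_iInter, exists_prop]
    constructor
    · rintro ⟨hy, σ, hσ, h⟩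
      refine ⟨σ, hσ, hy, fun v hv => ?_⟩
      by_contra h'
      exact hv ((h v).2 h')
    · rintro ⟨σ, hσ, hy, h⟩
      exact mem_realization hσ hy h
  rw [this]
  refine (Set.toFinite K.faces).isClosed_biUnion fun σ _ => (isClosed_stdSimplex ℝ V).inter
    (isClosed_iInter fun v => ?_)
  by_cases hv : v ∈ σ
  · simp [hv]
  · simpa [hv] using isClosed_eq (continuous_apply v) continuous_const

theorem isClosed_coneCell (σ : Finset V) : IsClosed (coneCell σ) := by
  have : coneCell σ = (⋂ v, {y : V → ℝ | 0 ≤ y v}) ∩ ((⋂ v, {y | v ∉ σ → y v = 0}) ∩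
      {y | ∑ v, y v ≤ 1}) := by
    ext y; simp [coneCell]
  rw [this]
  refine (isClosed_iInter fun v => isClosed_le continuous_const (continuous_apply v)).inter
    ((isClosed_iInter fun v => ?_).inter
      (isClosed_le (continuous_finsetSum _ fun v _ => continuous_apply v) continuous_const))
  by_cases hv : v ∈ σ
  · simp [hv]
  · simpa [hv] using isClosed_eq (continuous_apply v) continuous_const

theorem coneCell_subset_Icc (σ : Finset V) : coneCell σ ⊆ Icc 0 1 := fun _ hy =>
  ⟨hy.1, fun v => (Finset.single_le_sum (fun w _ => hy.1 w) (Finset.mem_univ v)).trans hy.2.2⟩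

theorem convex_coneCell (σ : Finset V) : Convex ℝ (coneCell σ) := by
  intro x hx y hy a b ha hb hab
  refine ⟨fun v => ?_, fun v hv => ?_, ?_⟩
  · have := hx.1 v
    have := hy.1 v
    simp only [Pi.add_apply, Pi.smul_apply, smul_eq_mul]
    positivity
  · simp [hx.2.1 v hv, hy.2.1 v hv]
  · simp only [Pi.add_apply, Pi.smul_apply, smul_eq_mul, Finset.sum_add_distrib,
      ← Finset.mul_sum]
    calc _ ≤ a * 1 + b * 1 := by gcongr; exacts [hx.2.2, hy.2.2]
      _ = 1 := by rw [mul_one, mul_one, hab]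

/-- The identity of the realization of `K` extends over the cones over the small faces of `K`. -/
theorem exists_cone_map {d : ℕ}
    (hX : ∀ e ≤ d, ∀ f : C(sphere (0 : EuclideanSpace ℝ (Fin e)) 1, K.realization),
      ∃ g : C(closedBall (0 : EuclideanSpace ℝ (Fin e)) 1, K.realization),
        ∀ x : sphere (0 : EuclideanSpace ℝ (Fin e)) 1,
          g ⟨x, sphere_subset_closedBall x.2⟩ = f x)
    (s : Finset (Finset V)) (hs : ∀ σ ∈ s, ∀ τ ⊆ σ, τ ∈ s)
    (hK : ∀ σ ∈ s, (σ ∈ K.faces ∨ σ = ∅) ∧ σ.card ≤ d) :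
    ∃ F : (V → ℝ) → V → ℝ, ContinuousOn F (K.realization ∪ ⋃ σ ∈ s, coneCell σ) ∧
      MapsTo F (K.realization ∪ ⋃ σ ∈ s, coneCell σ) K.realization ∧
      ∀ y ∈ K.realization, F y = y := by
  classical
  revert hs hK
  -- Faces are added by increasing cardinality, so when the cone over `a` is attached, the cones
  -- over all proper faces of `a` are present.
  refine Finset.induction_on_max_value Finset.card s (fun _ _ => ?_)
    (fun a s ha hmax ih hs hK => ?_)
  · refine ⟨id, continuousOn_id, ?_, fun _ _ => rfl⟩
    simp [MapsTo]
  · have hsub : ∀ τ ⊆ a, τ ≠ a → τ ∈ s := fun τ hτ hne =>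
      Finset.mem_of_mem_insert_of_ne (hs a (Finset.mem_insert_self _ _) τ hτ) hne
    obtain ⟨F, hF, hFX, hFid⟩ := ih (fun σ hσ τ hτ => by
        refine Finset.mem_of_mem_insert_of_ne (hs σ (Finset.mem_insert_of_mem hσ) τ hτ) ?_
        rintro rfl
        exact ha ((Finset.eq_of_subset_of_card_le hτ (hmax σ hσ)) ▸ hσ))
      fun σ hσ => hK σ (Finset.mem_insert_of_mem hσ)
    set Y := K.realization ∪ ⋃ σ ∈ s, coneCell σ with hY
    have hYc : IsClosed Y := isClosed_realization.union
      (s.finite_toSet.isClosed_biUnion fun σ _ => isClosed_coneCell σ)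
    obtain ⟨haK, had⟩ := hK a (Finset.mem_insert_self _ _)
    have hbY : coneCellBdry a ⊆ Y := by
      rintro y ⟨hy, h | ⟨v, hv, h⟩⟩
      · left
        refine mem_realization (haK.resolve_right ?_) ⟨hy.1, h⟩ hy.2.1
        rintro rfl
        rw [Finset.sum_eq_zero fun v _ => hy.2.1 v (Finset.notMem_empty v)] at h
        exact zero_ne_one h
      · right
        refine mem_biUnion (x := a.erase v) (hsub _ (Finset.erase_subset _ _)
          (Finset.erase_ssubset hv).ne) ⟨hy.1, fun w hw => ?_, hy.2.2⟩
        by_cases hwv : w = v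
        · rw [hwv, h]
        · exact hy.2.1 w fun hwa => hw (Finset.mem_erase.2 ⟨hwv, hwa⟩)
    -- The new cone meets the earlier space only in its boundary: points of the realization have
    -- coordinate sum 1, and an earlier `σ` misses some vertex of `a`.
    have hYb : ∀ y ∈ Y, y ∈ coneCell a → y ∈ coneCellBdry a := by
      rintro y (hy | hy) hya
      · exact ⟨hya, Or.inl hy.1.2⟩
      · simp only [mem_iUnion] at hy
        obtain ⟨σ, hσ, hy⟩ := hy
        have : ¬ a ⊆ σ := fun h => ha (Finset.eq_of_subset_of_card_le h (hmax σ hσ) ▸ hσ)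
        obtain ⟨v, hv, hv'⟩ := Finset.not_subset.1 this
        exact ⟨hya, Or.inr ⟨v, hv, hy.2.1 v hv'⟩⟩
    obtain ⟨G, hG, hGX, hGF⟩ := exists_extension_coneCell a (hX _ had) (hF.mono hbY)
      (hFX.mono_left hbY)
    set H : (V → ℝ) → V → ℝ := fun y => if y ∈ coneCell a then G y else F y with hH
    have h1 : ∀ y ∈ coneCell a, H y = G y := fun y hy => if_pos hy
    have h2 : ∀ y ∈ Y, H y = F y := fun y hy => by
      by_cases hya : y ∈ coneCell a
      · rw [h1 y hya, hGF (hYb y hy hya)]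
      · exact if_neg hya
    have hU : K.realization ∪ ⋃ σ ∈ insert a s, coneCell σ = Y ∪ coneCell a := by
      rw [Finset.set_biUnion_insert, hY, union_assoc, union_comm (coneCell a)]
    rw [hU]
    refine ⟨H, (hF.congr h2).union_of_isClosed (hG.congr h1) hYc (isClosed_coneCell a), ?_,
      fun y hy => ?_⟩
    · rintro y (hy | hy)
      · rw [h2 y hy]; exact hFX hy
      · rw [h1 y hy]; exact hGX hy
    · rw [h2 y (Or.inl hy), hFid y hy]

variable [LinearOrder V]

/-- A sufficiently connected complex has no reduced homology: a Hurewicz-type statement. -/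
theorem mem_boundaries_of_isTopologicallyConnected [Nonempty V] {d : ℕ}
    (hconn : IsTopologicallyConnected ((d : ℤ) - 1) K.realization)
    {z : Finset V →₀ ℤ} (hz : z ∈ K.cycles ((d : ℤ) - 1)) : z ∈ K.boundaries ((d : ℤ) - 1) := by
  classical
  obtain ⟨hz, h0⟩ := hz
  rw [SetLike.mem_coe, K.chains_eq_chainsOf] at hz
  rw [SetLike.mem_coe, LinearMap.mem_ker, ← bdry_int] at h0
  set s : Finset (Finset V) := Finset.univ.filter
    fun σ => (σ ∈ K.faces ∨ σ = ∅) ∧ σ.card ≤ d with hs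
  obtain ⟨F, hF, hFX, hFid⟩ := exists_cone_map (K := K) (d := d)
    (fun e he f => hconn e (by lia) f) s
    (fun σ hσ τ hτ => by
      rw [hs, Finset.mem_filter] at hσ ⊢
      refine ⟨Finset.mem_univ _, ?_, (Finset.card_le_card hτ).trans hσ.2.2⟩
      rcases τ.eq_empty_or_nonempty with h | h
      · exact Or.inr h
      · refine Or.inl ((K.isRelLowerSet_faces (hσ.2.1.resolve_right ?_)).2 hτ h)
        rintro rfl
        exact h.ne_empty (Finset.subset_empty.1 hτ))
    fun σ hσ => (Finset.mem_filter.1 hσ).2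
  set Y := K.realization ∪ ⋃ σ ∈ s, coneCell σ with hY
  have hYc : IsCompact Y := by
    refine isCompact_Icc.of_isClosed_subset (isClosed_realization.union
      (s.finite_toSet.isClosed_biUnion fun σ _ => isClosed_coneCell σ)) (?_ : Y ⊆ Icc 0 1)
    refine union_subset (fun y hy => ⟨hy.1.1, fun v => ?_⟩)
      (iUnion₂_subset fun σ _ => coneCell_subset_Icc σ)
    exact (Finset.single_le_sum (fun w _ => hy.1.1 w) (Finset.mem_univ v)).trans hy.1.2.le
  have hcell : ∀ σ, (σ ∈ K.faces ∨ σ = ∅) → σ.card ≤ d → coneCell σ ⊆ Y := fun σ h1 h2 y hy =>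
    Or.inr (mem_biUnion (x := σ) (Finset.mem_filter.2 ⟨Finset.mem_univ _, h1, h2⟩) hy)
  have hcard : (0 : ℝ) < (Fintype.card V : ℝ)⁻¹ := by
    have : 0 < Fintype.card V := Fintype.card_pos
    positivity
  obtain ⟨δ, hδ, hFδ⟩ := Metric.uniformContinuousOn_iff.1
    (hYc.uniformContinuousOn_of_continuous hF) _ hcard
  -- The coordinates of `F p` sum to 1, so one of them is at least the average. Points outside `Y`
  -- get an arbitrary label.
  have hlabel : ∀ p, ∃ v, p ∈ Y → (Fintype.card V : ℝ)⁻¹ ≤ F p v := by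
    intro p
    by_cases hp : p ∈ Y
    · obtain ⟨v, -, hv⟩ := Finset.exists_le_of_sum_le (s := Finset.univ)
        (f := fun _ : V => (Fintype.card V : ℝ)⁻¹) (g := F p) Finset.univ_nonempty (by
          rw [(hFX hp).1.2]
          simp)
      exact ⟨v, fun _ => hv⟩
    · exact ⟨Classical.arbitrary V, fun h => absurd h hp⟩
  choose f hf using hlabel
  obtain ⟨N, hN⟩ := exists_pow_lt_of_lt_one hδ
    (show (d : ℝ) / (d + 1) < 1 by rw [div_lt_one (by positivity)]; linarith)
  set e : V → V → ℝ := fun v => Pi.single v 1 with he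
  have he' : ∀ v, e v ∈ stdSimplex ℝ V := fun v => single_mem_stdSimplex ℝ v
  have he0 : ∀ (σ : Finset V), ∀ v ∈ σ, ∀ w ∉ σ, e v w = 0 := fun σ v hv w hw =>
    Pi.single_eq_of_ne (M := fun _ => ℝ) (ne_of_mem_of_not_mem hv hw).symm 1
  set T : (Finset V →₀ ℤ) →ₗ[ℤ] (List (V → ℝ) →₀ ℤ) := listMap e ∘ₗ sortedChain with hT
  have hTs : ∀ σ : Finset V, T (Finsupp.single σ 1) =
      Finsupp.single ((σ.sort (· ≤ ·)).map e) 1 := fun σ => by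
    rw [hT, LinearMap.comp_apply, sortedChain_single, listMap_single]
  -- The filling: the cone on `z` with apex `0`, subdivided `N` times and then labelled.
  set c := listWedge f ((sd (d + 1) ^ N) (listCone 0 (T z))) with hc
  have hmem : ∀ σ, (σ ∈ K.faces ∨ σ = ∅) → σ.card = d →
      listCone 0 (T (Finsupp.single σ 1)) ∈ listChains (smallLists (coneCell σ) (d + 1) 1) := by
    intro σ _ hσd
    rw [hTs, listCone_single]
    have hp : ∀ p ∈ (0 : V → ℝ) :: (σ.sort (· ≤ ·)).map e, p ∈ coneCell σ := by
      intro p hp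
      rcases List.mem_cons.1 hp with rfl | hp
      · exact ⟨fun _ => le_rfl, fun _ _ => rfl, by simp⟩
      · obtain ⟨v, hv, rfl⟩ := List.mem_map.1 hp
        exact ⟨(he' v).1, he0 σ v ((Finset.mem_sort _).1 hv), (he' v).2.le⟩
    refine single_mem_listChains ⟨by simp [hσd], hp, fun p hp' q hq' => ?_⟩
    have h1 := coneCell_subset_Icc σ (hp p hp')
    have h2 := coneCell_subset_Icc σ (hp q hq')
    exact (dist_pi_le_iff zero_le_one).2 fun v => Real.dist_le_of_mem_Icc_01
      ⟨h1.1 v, h1.2 v⟩ ⟨h2.1 v, h2.2 v⟩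
  refine ⟨c, ?_, ?_⟩
  · rw [show (d : ℤ) - 1 + 1 = ((d + 1 : ℕ) : ℤ) - 1 by push_cast; ring, SetLike.mem_coe,
      K.chains_eq_chainsOf]
    refine chainsOf_le (P := (chainsOf ℤ {σ | σ ∈ K.faces ∨ σ = ∅} (d + 1)).comap
      (listWedge f ∘ₗ (sd (d + 1) ^ N) ∘ₗ listCone 0 ∘ₗ T)) (fun σ hσ hσd => ?_) hz
    rw [Submodule.mem_comap, LinearMap.comp_apply, LinearMap.comp_apply, LinearMap.comp_apply]
    refine map_mem_listChains (fun l hl => ?_) (sd_pow_mem_smallLists (convex_coneCell σ) le_rfl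
      zero_le_one (hmem σ hσ hσd) N)
    obtain ⟨h1, h2, h3⟩ := hl
    have h4 := listWedge_single_mem f l
    rw [h1] at h4
    refine chainsOf_mono (fun τ hτ => ?_) _ h4
    rcases τ.eq_empty_or_nonempty with h | h
    · exact Or.inr h
    left
    obtain ⟨p, hp⟩ := List.exists_mem_of_length_pos (l := l) (by lia)
    have hpY := hcell σ hσ hσd.le (h2 p hp)
    obtain ⟨hp1, ρ, hρ, hρ'⟩ := hFX hpY
    -- If `q` is close to `p`, the coordinate of `F p` at the label of `q` is still positive. Hence
    -- all labels of a small simplex lie in the carrier of the single point `F p`, which is a face.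
    refine (K.isRelLowerSet_faces hρ).2 (fun v hv => ?_) h
    obtain ⟨q, hq, rfl⟩ := hτ v hv
    have hqY := hcell σ hσ hσd.le (h2 q hq)
    rw [hρ']
    have h5 := hFδ p hpY q hqY ((h3 p hp q hq).trans_lt (by rwa [mul_one]))
    have h6 := (dist_le_pi_dist (F p) (F q) (f q)).trans_lt h5
    rw [Real.dist_eq, abs_lt] at h6
    have h7 := hf q hqY
    intro h8
    linarith [h6.1]
  · have hTz : listBdry (T z) = 0 := by
      rw [hT, LinearMap.comp_apply, ← listMap_listBdry, listBdry_sortedChain, h0, map_zero,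
        map_zero]
    have hlen : listCone 0 (T z) ∈ listChains {w : List (V → ℝ) | w.length = d + 1} :=
      chainsOf_le (P := (listChains {w : List (V → ℝ) | w.length = d + 1}).comap
        (listCone 0 ∘ₗ T)) (fun σ hσ hσd => listChains_mono (fun l hl => hl.1) (hmem σ hσ hσd)) hz
    rw [← bdry_int, hc, bdry_listWedge, listBdry_sd_pow d N hlen, listBdry_listCone, hTz, map_zero,
      sub_zero]
    -- On the realization `F` is the identity, so each label is a vertex of the carrier of its point
    -- and the Sperner argument returns every simplex of `z` unchanged.
    refine eqOn_chainsOf (f := listWedge f ∘ₗ (sd d ^ N) ∘ₗ T) (g := LinearMap.id)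
      (fun σ hσ hσd => ?_) hz
    rw [LinearMap.comp_apply, LinearMap.comp_apply, hTs, LinearMap.id_apply,
      listWedge_sd_pow e f N d _ (by simp [hσd]) (Finset.sort_nodup _ _), listWedge_sort]
    intro w hw p hp
    have hp' : p ∈ stdSimplex ℝ V ∩ {y | ∀ v, v ∉ w → y v = 0} := by
      refine convexHull_min ?_ ((convex_stdSimplex ℝ V).inter ?_) hp
      · rintro _ ⟨v, hv, rfl⟩
        exact ⟨he' v, fun u hu => Pi.single_eq_of_ne (M := fun _ => ℝ)
          (ne_of_mem_of_not_mem hv hu).symm 1⟩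
      · intro x hx y hy a b _ _ _ v hv
        simp [hx v hv, hy v hv]
    have hσne : σ ∈ K.faces := by
      refine hσ.resolve_right ?_
      rintro rfl
      rw [Finset.sort_empty] at hw
      rw [List.subset_nil.1 hw] at hp
      simp at hp
    have hpX : p ∈ K.realization := mem_realization hσne hp'.1 fun v hv => hp'.2 v fun hvw =>
      hv ((Finset.mem_sort _).1 (hw hvw))
    have h1 := hf p (Or.inl hpX)
    rw [hFid p hpX] at h1
    by_contra h2
    rw [hp'.2 _ h2] at h1
    linarith

end Connectivity

theorem theorem8 :
    -- the board with the diagonal removed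
    (∀ n : ℕ, 3 ≤ n →
      Nontrivial ((rookComplex (diagonalRemoved n)).ReducedHomology (nu (2 * n))) ∧
      ¬ IsTopologicallyConnected (nu (2 * n)) (rookComplex (diagonalRemoved n)).realization) ∧
    -- every board that contains the pattern `B_n`
    (∀ n : ℕ, 3 ≤ n → ∀ A : Set (Position n n), patternB n ⊆ A →
      Nontrivial ((rookComplex A).ReducedHomology (nu (2 * n))) ∧
      ¬ IsTopologicallyConnected (nu (2 * n)) (rookComplex A).realization) ∧
    -- every board that contains the band `Γ(n, 2 ν_{2n} + 1 - n)`
    (∀ n : ℕ, (n = 6 ∨ 8 ≤ n) →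
      ∀ A : Set (Position n n), bandBoard n (2 * nu (2 * n) + 1 - n) ⊆ A →
      Nontrivial ((rookComplex A).ReducedHomology (nu (2 * n))) ∧
      ¬ IsTopologicallyConnected (nu (2 * n)) (rookComplex A).realization) := by
  have key : ∀ n : ℕ, 3 ≤ n → ∀ A B : Set (Position n n), B ⊆ A →
      (∃ z ∈ (rookComplex B).cycles (nu (2 * n)),
        ∀ A, z ∉ (rookComplex A).boundaries (nu (2 * n))) →
      Nontrivial ((rookComplex A).ReducedHomology (nu (2 * n))) ∧
        ¬ IsTopologicallyConnected (nu (2 * n)) (rookComplex A).realization := by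
    rintro n hn A B hBA ⟨z, ⟨hz, h0⟩, hz'⟩
    have hzA : z ∈ (rookComplex A).cycles (nu (2 * n)) := by
      refine ⟨Finsupp.supported_mono ?_ hz, h0⟩
      rintro σ ⟨h | h, hc⟩
      · exact ⟨Or.inl ⟨h.1, fun p hp => hBA (h.2.1 p hp), h.2.2⟩, hc⟩
      · exact ⟨Or.inr h, hc⟩
    refine ⟨⟨Submodule.Quotient.mk ⟨z, hzA⟩, 0, fun h => hz' A ?_⟩, fun h => hz' A ?_⟩
    · rwa [Submodule.Quotient.mk_eq_zero] at h
    · have : Nonempty (Position n n) := ⟨toLex (⟨0, by lia⟩, ⟨0, by lia⟩)⟩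
      exact mem_boundaries_of_isTopologicallyConnected h hzA
  exact ⟨fun n hn => key n hn _ _ subset_rfl (exists_cycle_diagonalRemoved hn),
    fun n hn A hA => key n hn A _ hA (exists_cycle_patternB hn),
    fun n hn A hA => key n (by lia) A _ ((patternB_subset_bandBoard hn).trans hA)
      (exists_cycle_patternB (by lia))⟩
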